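/- Let $q\in\mathbb C$ with $0<|q|<1$, put $\Omega_q=\{q^{-k}:k=0,1,2,\dots\}$, $(x;q)_n=\prod_{j=0}^{n-1}(1-xq^j)$, $(x;q)_\infty=\prod_{j\ge 0}(1-xq^j)$, $(x_1,\dots,x_m;q)_n=\prod_i(x_i;q)_n$ for $n\in\{0,1,2,\dots\}\cup\{\infty\}$, and $${}_8W_7(b;c_1,\dots,c_5;q,z)=\sum_{k=0}^\infty\frac{(q\sqrt b,-q\sqrt b,b,c_1,\dots,c_5;q)_k}{(q,\sqrt b,-\sqrt b,qb/c_1,\dots,qb/c_5;q)_k}\,z^k ,$$ where $\pm\sqrt b,\,qb/c_1,\dots,qb/c_5\notin\Omega_q$. Let $a_1,\dots,a_5,\lambda$ be nonzero complex numbers, put $A=a_1a_2a_3a_4a_5$, and assume $|q|<|A/\lambda|<1$. Assume that no infinite product in a denominator below vanishes and that no denominator parameter of an ${}_8W_7$ below lies in $\Omega_q$; explicitly, $a_ia_j\notin\Omega_q$ and $a_j/a_i\notin\Omega_q$ for all $i\ne j$; $a_i,\,-a_i,\,\lambda a_i\notin\Omega_q$ for all $i$; $\lambda^2\notin\Omega_q$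 and $\lambda^2\ne q$. Then all the ${}_8W_7$ series below converge absolutely, and $$\sum_{k=1}^5\frac{(\lambda a_k,\,a_k^{-2},\,\lambda/a_k;q)_\infty}{\prod_{j\ne k}(a_ka_j,\,a_j/a_k;q)_\infty}\;{}_8W_7\!\left(a_k^2;\{a_ka_j\}_{j\ne k},\frac{qa_k}{\lambda};q,\frac{q\lambda}{A}\right)$$ $$=\frac{2\,(\lambda a_1,\dots,\lambda a_5,\,A/\lambda;q)_\infty}{(\lambda^2;q)_\infty\prod_{1\le i<j\le5}(a_ia_j;q)_\infty}\;{}_8W_7\!\left(\frac{\lambda^2}{q};\frac{\lambda}{a_1},\dots,\frac{\lambda}{a_5};q,\frac{A}{\lambda}\right).$$ -/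

import Mathlib

namespace BasicHyp

noncomputable section

/-- The set `Ω_q = {q^{-k} : k = 0, 1, 2, …}`. -/
def Omega (q : ℂ) : Set ℂ := {z | ∃ k : ℕ, z = (q ^ k)⁻¹}

/-- The finite `q`-shifted factorial `(x;q)_n = (1-x)(1-xq)⋯(1-xq^{n-1})`. -/
def qPoch (x q : ℂ) (n : ℕ) : ℂ := ∏ j ∈ Finset.range n, (1 - x * q ^ j)

/-- The infinite `q`-shifted factorial `(x;q)_∞ = ∏_{n ≥ 0} (1 - x q^n)`, used for `|q| < 1`. -/
def qPochInf (x q : ℂ) : ℂ := ∏' n : ℕ, (1 - x * q ^ n)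

/-- The `k`-th term of the basic hypergeometric series `_{r+1}φ_s` with numerator parameters `as`
(`r + 1` of them), denominator parameters `bs` (`s` of them), base `q` and argument `z`. The
exponent below is `s - r`. -/
def phiTerm (as bs : List ℂ) (q z : ℂ) (k : ℕ) : ℂ :=
  (as.map fun x => qPoch x q k).prod / (qPoch q q k * (bs.map fun x => qPoch x q k).prod) *
    ((-1) ^ k * q ^ k.choose 2) ^ ((bs.length : ℤ) + 1 - (as.length : ℤ)) * z ^ k

/-- Numerator parameters `±q√b, b, a_4, …, a_{r+1}` of the very-well-poised series. -/
def vwpNum (b : ℂ) (as : List ℂ) (q : ℂ) : List ℂ :=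
  [q * Complex.sqrt b, -(q * Complex.sqrt b), b] ++ as

/-- Denominator parameters `±√b, qb/a_4, …, qb/a_{r+1}` of the very-well-poised series. -/
def vwpDen (b : ℂ) (as : List ℂ) (q : ℂ) : List ℂ :=
  [Complex.sqrt b, -Complex.sqrt b] ++ as.map fun x => q * b / x

/-- The `k`-th term of the very-well-poised series `_{r+1}W_r(b; as; q, z)`. -/
def WTerm (b : ℂ) (as : List ℂ) (q z : ℂ) (k : ℕ) : ℂ :=
  phiTerm (vwpNum b as q) (vwpDen b as q) q z k

/-- The very-well-poised series `_{r+1}W_r(b; as; q, z)`, where `as = [a_4, …, a_{r+1}]`. -/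
def W (b : ℂ) (as : List ℂ) (q z : ℂ) : ℂ := ∑' k : ℕ, WTerm b as q z k

/-- The symmetric sum `f(a) + idem(a_0; a_1, …, a_n)`: the sum of `f(a)` and of the `n` expressions
obtained by interchanging `a_0` with `a_k`, `k = 1, …, n` (the summand `k = 0` is `f(a)`). -/
def symSum {n : ℕ} (f : (Fin (n + 1) → ℂ) → ℂ) (a : Fin (n + 1) → ℂ) : ℂ :=
  ∑ k : Fin (n + 1), f (a ∘ Equiv.swap 0 k)

/-- With `a = (a_1, …, a_5)`, the last five parameters `a_1a_2, …, a_1a_5, qa_1/λ` of the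
`_8W_7` with base `a_1²`. -/
def leftParams (l q : ℂ) (a : Fin 5 → ℂ) : List ℂ :=
  [a 0 * a 1, a 0 * a 2, a 0 * a 3, a 0 * a 4, q * a 0 / l]

/-- The last five parameters `λ/a_1, …, λ/a_5` of the `_8W_7` with base `λ²/q`. -/
def rightParams (l : ℂ) (a : Fin 5 → ℂ) : List ℂ :=
  [l / a 0, l / a 1, l / a 2, l / a 3, l / a 4]

/-- The expression that is symmetrized: an infinite product times the `_8W_7` with base `a_1²`
and argument `qλ/(a_1a_2a_3a_4a_5)`. -/
def leftSummand (l q : ℂ) (a : Fin 5 → ℂ) : ℂ :=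
  qPochInf (l * a 0) q * qPochInf (1 / a 0 ^ 2) q * qPochInf (l / a 0) q /
      ((∏ j : Fin 4, qPochInf (a 0 * a j.succ) q) * ∏ j : Fin 4, qPochInf (a j.succ / a 0) q) *
    W (a 0 ^ 2) (leftParams l q a) q (q * l / ∏ i, a i)

end

end BasicHyp

/-!
The integral over the unit circle of the Nassrallah--Rahman weight
`(z², z⁻², λ z, λ / z; q)_∞ / ∏ᵢ (aᵢ z, aᵢ / z; q)_∞` is computed in two ways, first for
`|aᵢ| < 1` and `|λ² / q| < 1`.

* For `λ = a₅` this is the Askey--Wilson weight of four parameters. Divided by the expected product,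
  its integral is unchanged when a parameter is multiplied by `q`, hence constant, and for the
  parameters `q, -q, √q, -√q` the weight is a Laurent polynomial. For `a₅ = λ q^M` with `M > 0`,
  expand the factor `(1 - λ z) (1 - λ / z)` in terms of the same factors for `a₃` and `a₄`; by
  induction on `M` the integral equals the product side, which satisfies the same contiguous
  relation by telescoping. As `λ q^M → 0`, the identity theorem in `a₅` gives the general case.
* Shrinking the circle to `0` along radii `ρ |q|^N`, on which the integral tends to `0`, leaves
  the residues at the poles `aₖ q^n`. The functional equation of the weight under `z ↦ q z` shows
  that they are the terms of the very-well-poised series with base `aₖ²`.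

The size conditions are removed by analytic continuation along `(a, λ) ↦ (s a, s⁵ λ)`: it leaves
`A / λ` and `aⱼ / aᵢ` unchanged, and for given parameters the excluded `s` form a countable closed
set.
-/

namespace BasicHyp

open Filter Topology

noncomputable section

section Pochhammer

variable {q : ℂ}

theorem qPoch_zero (x q : ℂ) : qPoch x q 0 = 1 := by simp [qPoch]

theorem qPoch_succ (x q : ℂ) (n : ℕ) : qPoch x q (n + 1) = qPoch x q n * (1 - x * q ^ n) := by
  simp [qPoch, Finset.prod_range_succ]

theorem qPoch_succ' (x q : ℂ) (n : ℕ) : qPoch x q (n + 1) = (1 - x) * qPoch (x * q) q n := by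
  simp only [qPoch, Finset.prod_range_succ', pow_zero, mul_one, pow_succ', mul_assoc]
  rw [mul_comm]

theorem one_sub_mul_pow_ne_zero {x : ℂ} (hx : x ∉ Omega q) (n : ℕ) : 1 - x * q ^ n ≠ 0 :=
  fun h => hx ⟨n, eq_inv_of_mul_eq_one_left (sub_eq_zero.1 h).symm⟩

theorem qPoch_ne_zero {x : ℂ} (hx : x ∉ Omega q) (n : ℕ) : qPoch x q n ≠ 0 :=
  Finset.prod_ne_zero_iff.2 fun j _ => one_sub_mul_pow_ne_zero hx j

theorem differentiable_qPoch (q : ℂ) (n : ℕ) : Differentiable ℂ fun x => qPoch x q n := by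
  unfold qPoch
  fun_prop

theorem notMem_Omega_of_norm_lt_one (hq : q ≠ 0) (hq1 : ‖q‖ < 1) {x : ℂ} (hx : ‖x‖ < 1) :
    x ∉ Omega q := by
  rintro ⟨k, rfl⟩
  rw [norm_inv, norm_pow] at hx
  have hpos : 0 < ‖q‖ ^ k := pow_pos (norm_pos_iff.2 hq) k
  have hle : ‖q‖ ^ k ≤ 1 := pow_le_one₀ (norm_nonneg _) hq1.le
  exact hx.not_ge ((one_le_inv₀ hpos).2 hle)

theorem summable_norm_mul_pow (hq1 : ‖q‖ < 1) (x : ℂ) : Summable fun n : ℕ => ‖-(x * q ^ n)‖ := by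
  simpa [norm_mul, norm_pow] using (summable_geometric_of_lt_one (norm_nonneg q) hq1).mul_left ‖x‖

theorem multipliable_one_sub_mul_pow (hq1 : ‖q‖ < 1) (x : ℂ) :
    Multipliable fun n : ℕ => 1 - x * q ^ n := by
  simpa [sub_eq_add_neg] using multipliable_one_add_of_summable (summable_norm_mul_pow hq1 x)

theorem qPochInf_zero (q : ℂ) : qPochInf 0 q = 1 := by simp [qPochInf]

theorem qPochInf_eq_mul (hq1 : ‖q‖ < 1) (x : ℂ) :
    qPochInf x q = (1 - x) * qPochInf (x * q) q := by
  have h := tprod_eq_zero_mul' (f := fun n : ℕ => 1 - x * q ^ n)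
    (by simpa [pow_succ', mul_assoc] using multipliable_one_sub_mul_pow hq1 (x * q))
  simpa [qPochInf, pow_succ', mul_assoc] using h

theorem qPochInf_eq_qPoch_mul (hq1 : ‖q‖ < 1) (x : ℂ) (n : ℕ) :
    qPochInf x q = qPoch x q n * qPochInf (x * q ^ n) q := by
  induction n with
  | zero => simp [qPoch_zero]
  | succ n ih => rw [ih, qPoch_succ, qPochInf_eq_mul hq1 (x * q ^ n), pow_succ]; ring_nf

theorem qPochInf_ne_zero (hq1 : ‖q‖ < 1) {x : ℂ} (hx : x ∉ Omega q) : qPochInf x q ≠ 0 := by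
  simpa [qPochInf, sub_eq_add_neg] using
    tprod_one_add_ne_zero_of_summable (f := fun n : ℕ => -(x * q ^ n))
      (fun n => by simpa [sub_eq_add_neg] using one_sub_mul_pow_ne_zero hx n)
      (summable_norm_mul_pow hq1 x)

theorem qPochInf_ne_zero_of_norm_lt_one (hq : q ≠ 0) (hq1 : ‖q‖ < 1) {x : ℂ} (hx : ‖x‖ < 1) :
    qPochInf x q ≠ 0 :=
  qPochInf_ne_zero hq1 (notMem_Omega_of_norm_lt_one hq hq1 hx)

theorem differentiable_qPochInf (hq1 : ‖q‖ < 1) : Differentiable ℂ fun x => qPochInf x q := by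
  have differentiableOn_ball (R : ℝ) :
      DifferentiableOn ℂ (fun x => qPochInf x q) (Metric.ball 0 R) := by
    have hprod := Summable.hasProdLocallyUniformlyOn_nat_one_add
      (f := fun (n : ℕ) (x : ℂ) => -(x * q ^ n)) (K := Metric.ball 0 R) Metric.isOpen_ball
      (u := fun n => R * ‖q‖ ^ n)
      ((summable_geometric_of_lt_one (norm_nonneg q) hq1).mul_left R)
      (Eventually.of_forall fun n x hx => by
        rw [norm_neg, norm_mul, norm_pow]
        gcongr
        simpa using (Metric.mem_ball.1 hx).le)
      (fun n => by fun_prop)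
    simpa [qPochInf, sub_eq_add_neg] using
      hprod.differentiableOn (Eventually.of_forall fun s => by fun_prop) Metric.isOpen_ball
  exact fun x => (differentiableOn_ball (‖x‖ + 1)).differentiableAt
    (Metric.isOpen_ball.mem_nhds (by simp))

attribute [fun_prop] differentiable_qPoch differentiable_qPochInf

@[fun_prop]
theorem continuous_qPochInf (hq1 : ‖q‖ < 1) : Continuous fun x => qPochInf x q :=
  (differentiable_qPochInf hq1).continuous

end Pochhammer

section RatioTest

variable {q : ℂ}

theorem exists_summable_bound_of_ratio (hq1 : ‖q‖ < 1) {X E : Type*} [TopologicalSpace X]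
    [NormedAddCommGroup E] [NormedSpace ℂ E] {U : Set X} (hU : IsOpen U) {T : ℕ → X → E}
    {R : ℂ → X → ℂ} (hT : ∀ n, ContinuousOn (T n) U)
    (hR : ∀ s ∈ U, ContinuousAt (fun p : ℂ × X => R p.1 p.2) (0, s))
    (hR0 : ∀ s ∈ U, ‖R 0 s‖ < 1)
    (hrec : ∀ n, ∀ s ∈ U, T (n + 1) s = R (q ^ n) s • T n s) {s : X} (hs : s ∈ U) :
    ∃ V ⊆ U, IsOpen V ∧ s ∈ V ∧ ∃ N : ℕ, ∃ u : ℕ → ℝ, Summable u ∧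
      ∀ n, ∀ w ∈ V, ‖T (n + N) w‖ ≤ u n := by
  obtain ⟨κ, hκ0, hκ1⟩ := exists_between (hR0 s hs)
  have hκ : 0 ≤ κ := (norm_nonneg _).trans hκ0.le
  have hR_lt : ∀ᶠ p : ℂ × X in 𝓝 (0, s), ‖R p.1 p.2‖ < κ :=
    (hR s hs).norm.eventually_lt_const hκ0
  rw [nhds_prod_eq] at hR_lt
  obtain ⟨P, hP, Q, hQ, hPQ⟩ := eventually_prod_iff.1 hR_lt
  obtain ⟨N, hN⟩ :=
    eventually_atTop.1 ((tendsto_pow_atTop_nhds_zero_of_norm_lt_one hq1).eventually hP)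
  have hT_lt : ∀ᶠ w in 𝓝 s, ‖T N w‖ < ‖T N s‖ + 1 :=
    ((hT N).continuousAt (hU.mem_nhds hs)).norm.eventually_lt_const (lt_add_one _)
  obtain ⟨V, hV, hVo, hsV⟩ := eventually_nhds_iff.1 ((hQ.and hT_lt).and (hU.mem_nhds hs))
  refine ⟨V, fun w hw => (hV w hw).2, hVo, hsV, N, fun n => (‖T N s‖ + 1) * κ ^ n,
    (summable_geometric_of_lt_one hκ hκ1).mul_left _, fun n w hw => ?_⟩
  obtain ⟨⟨hwQ, hwT⟩, hwU⟩ := hV w hw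
  induction n with
  | zero => simpa using hwT.le
  | succ n ih =>
    have hratio : ‖R (q ^ (n + N)) w‖ ≤ κ := (hPQ (hN (n + N) (by omega)) hwQ).le
    calc ‖T (n + 1 + N) w‖ = ‖R (q ^ (n + N)) w‖ * ‖T (n + N) w‖ := by
          rw [add_right_comm, hrec _ _ hwU, norm_smul]
      _ ≤ κ * ((‖T N s‖ + 1) * κ ^ n) := by gcongr
      _ = (‖T N s‖ + 1) * κ ^ (n + 1) := by ring

theorem differentiableOn_tsum_of_ratio (hq1 : ‖q‖ < 1) {U : Set ℂ} (hU : IsOpen U)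
    {T : ℕ → ℂ → ℂ} {R : ℂ → ℂ → ℂ} (hT : ∀ n, DifferentiableOn ℂ (T n) U)
    (hR : ∀ s ∈ U, ContinuousAt (fun p : ℂ × ℂ => R p.1 p.2) (0, s))
    (hR0 : ∀ s ∈ U, ‖R 0 s‖ < 1)
    (hrec : ∀ n, ∀ s ∈ U, T (n + 1) s = R (q ^ n) s * T n s) :
    DifferentiableOn ℂ (fun s => ∑' n, T n s) U := by
  intro s hs
  obtain ⟨V, hVU, hV, hsV, N, u, hu, h⟩ := exists_summable_bound_of_ratio hq1 hU
    (fun n => (hT n).continuousOn) hR hR0 hrec hs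
  have htail : DifferentiableOn ℂ (fun s => ∑' n, T (n + N) s) V :=
    Complex.differentiableOn_tsum_of_summable_norm hu (fun n => (hT _).mono hVU) hV h
  have hsplit : DifferentiableOn ℂ
      (fun s => ∑ n ∈ Finset.range N, T n s + ∑' n, T (n + N) s) V :=
    (DifferentiableOn.fun_sum fun n _ => (hT n).mono hVU).add htail
  have hsummable (w : ℂ) (hw : w ∈ V) : Summable fun n => T n w :=
    (summable_nat_add_iff N).1 (hu.of_norm_bounded fun n => h n w hw)
  exact ((hsplit.congr fun w hw => ((hsummable w hw).sum_add_tsum_nat_add N).symm).differentiableAt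
    (hV.mem_nhds hsV)).differentiableWithinAt

theorem summable_of_ratio (hq1 : ‖q‖ < 1) {T : ℕ → ℂ} {R : ℂ → ℂ} (hR : ContinuousAt R 0)
    (hR0 : ‖R 0‖ < 1) (hrec : ∀ n, T (n + 1) = R (q ^ n) * T n) : Summable T := by
  obtain ⟨V, -, -, hs, N, u, hu, h⟩ := exists_summable_bound_of_ratio hq1 isOpen_univ
    (T := fun n (_ : Unit) => T n) (R := fun x _ => R x) (fun n => continuousOn_const)
    (fun s _ => ContinuousAt.comp (g := R) (x := ((0 : ℂ), s)) hR continuousAt_fst)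
    (fun _ _ => hR0) (fun n _ _ => hrec n) (Set.mem_univ ())
  exact (summable_nat_add_iff N).1 (hu.of_norm_bounded fun n => h n () hs)

end RatioTest

section VeryWellPoised

/-- The terms of a very-well-poised series with base `b` and argument `z`; the numerator parameters
are `c` and `y / z`, the denominator parameters are `d`. The numerator factors of `y / z` are merged
with `z ^ n`, which makes the terms polynomial in `z`, so that `z = 0` is allowed. -/
def vwpTerm {ι κ : Type*} [Fintype ι] [Fintype κ] (b : ℂ) (c : ι → ℂ) (d : κ → ℂ) (q y z : ℂ)
    (n : ℕ) : ℂ :=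
  (1 - b * q ^ (2 * n)) / (1 - b) * (qPoch b q n / qPoch q q n) *
    ((∏ i, qPoch (c i) q n) / ∏ i, qPoch (d i) q n) * ∏ j ∈ Finset.range n, (z - y * q ^ j)

/-- The ratio of consecutive terms of a very-well-poised series, as a function of `x = q ^ n`. -/
def vwpRatio {ι κ : Type*} [Fintype ι] [Fintype κ] (b : ℂ) (c : ι → ℂ) (d : κ → ℂ)
    (q y z x : ℂ) : ℂ :=
  (1 - b * q ^ 2 * x ^ 2) / (1 - b * x ^ 2) * ((1 - b * x) / (1 - q * x)) *
    ((∏ i, (1 - c i * x)) / ∏ i, (1 - d i * x)) * (z - y * x)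

variable {ι κ : Type*} [Fintype ι] [Fintype κ] {q : ℂ}

theorem vwpTerm_succ {b : ℂ} (hb : ∀ n : ℕ, 1 - b * q ^ (2 * n) ≠ 0) (c : ι → ℂ)
    (d : κ → ℂ) (y z : ℂ) (n : ℕ) :
    vwpTerm b c d q y z (n + 1) = vwpRatio b c d q y z (q ^ n) * vwpTerm b c d q y z n := by
  have hbase : (1 - b * q ^ (2 * (n + 1))) / (1 - b) =
      (1 - b * q ^ 2 * (q ^ n) ^ 2) / (1 - b * (q ^ n) ^ 2) *
        ((1 - b * q ^ (2 * n)) / (1 - b)) := by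
    rw [show 1 - b * (q ^ n) ^ 2 = 1 - b * q ^ (2 * n) by ring, div_mul_div_cancel₀ (hb n)]
    ring
  simp only [vwpTerm, vwpRatio, hbase, qPoch_succ, Finset.prod_mul_distrib, Finset.prod_range_succ,
    mul_div_mul_comm]
  ring

theorem continuousAt_vwpRatio {X : Type*} [TopologicalSpace X] {b : X → ℂ} {c : X → ι → ℂ}
    {d : X → κ → ℂ} {y z x : X → ℂ} {p : X} (hb : ContinuousAt b p)
    (hc : ∀ i, ContinuousAt (fun s => c s i) p) (hd : ∀ i, ContinuousAt (fun s => d s i) p)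
    (hy : ContinuousAt y p) (hz : ContinuousAt z p) (hx : ContinuousAt x p) (hx0 : x p = 0) :
    ContinuousAt (fun s => vwpRatio (b s) (c s) (d s) q (y s) (z s) (x s)) p := by
  unfold vwpRatio
  fun_prop (disch := simp [hx0])

theorem vwpRatio_zero (b : ℂ) (c : ι → ℂ) (d : κ → ℂ) (q y z : ℂ) :
    vwpRatio b c d q y z 0 = z := by simp [vwpRatio]

theorem summable_vwpTerm (hq1 : ‖q‖ < 1) {b : ℂ} (hb : ∀ n : ℕ, 1 - b * q ^ (2 * n) ≠ 0)
    (c : ι → ℂ) (d : κ → ℂ) (y : ℂ) {z : ℂ} (hz : ‖z‖ < 1) :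
    Summable (vwpTerm b c d q y z) := by
  refine summable_of_ratio hq1 (R := vwpRatio b c d q y z) ?_ (by rwa [vwpRatio_zero])
    (vwpTerm_succ hb c d y z)
  exact continuousAt_vwpRatio continuousAt_const (fun _ => continuousAt_const)
    (fun _ => continuousAt_const) continuousAt_const continuousAt_const continuousAt_id rfl

theorem differentiableOn_vwpTerm {U : Set ℂ} {b : ℂ → ℂ}
    {c : ℂ → ι → ℂ} {d : ℂ → κ → ℂ} {y z : ℂ → ℂ} (hb : DifferentiableOn ℂ b U)
    (hc : ∀ i, DifferentiableOn ℂ (fun s => c s i) U)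
    (hd : ∀ i, DifferentiableOn ℂ (fun s => d s i) U) (hy : DifferentiableOn ℂ y U)
    (hz : DifferentiableOn ℂ z U) (hb1 : ∀ s ∈ U, 1 - b s ≠ 0)
    (hdΩ : ∀ s ∈ U, ∀ i, d s i ∉ Omega q) (n : ℕ) :
    DifferentiableOn ℂ (fun s => vwpTerm (b s) (c s) (d s) q (y s) (z s) n) U := by
  have hd0 (s : ℂ) (hs : s ∈ U) : ∏ i, qPoch (d s i) q n ≠ 0 :=
    Finset.prod_ne_zero_iff.2 fun i _ => qPoch_ne_zero (hdΩ s hs i) n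
  unfold vwpTerm
  fun_prop (disch := assumption)

theorem differentiableOn_tsum_vwpTerm (hq1 : ‖q‖ < 1) {U : Set ℂ} (hU : IsOpen U)
    {b : ℂ → ℂ} {c : ℂ → ι → ℂ} {d : ℂ → κ → ℂ} {y z : ℂ → ℂ}
    (hb : DifferentiableOn ℂ b U) (hc : ∀ i, DifferentiableOn ℂ (fun s => c s i) U)
    (hd : ∀ i, DifferentiableOn ℂ (fun s => d s i) U) (hy : DifferentiableOn ℂ y U)
    (hz : DifferentiableOn ℂ z U) (hbΩ : ∀ s ∈ U, ∀ n : ℕ, 1 - b s * q ^ (2 * n) ≠ 0)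
    (hdΩ : ∀ s ∈ U, ∀ i, d s i ∉ Omega q) (hz1 : ∀ s ∈ U, ‖z s‖ < 1) :
    DifferentiableOn ℂ (fun s => ∑' n, vwpTerm (b s) (c s) (d s) q (y s) (z s) n) U := by
  refine differentiableOn_tsum_of_ratio hq1 hU
    (R := fun x s => vwpRatio (b s) (c s) (d s) q (y s) (z s) x)
    (differentiableOn_vwpTerm hb hc hd hy hz
      (fun s hs => by simpa using hbΩ s hs 0) hdΩ) (fun s hs => ?_)
    (fun s hs => by simpa only [vwpRatio_zero] using hz1 s hs)
    (fun n s hs => vwpTerm_succ (hbΩ s hs) _ _ _ _ n)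
  have continuousAt_snd_comp {f : ℂ → ℂ} (hf : DifferentiableOn ℂ f U) :
      ContinuousAt (fun p : ℂ × ℂ => f p.2) (0, s) :=
    (hf.differentiableAt (hU.mem_nhds hs)).continuousAt.comp (x := ((0 : ℂ), s)) continuousAt_snd
  exact continuousAt_vwpRatio (continuousAt_snd_comp hb) (fun i => continuousAt_snd_comp (hc i))
    (fun i => continuousAt_snd_comp (hd i)) (continuousAt_snd_comp hy) (continuousAt_snd_comp hz)
    continuousAt_fst rfl

end VeryWellPoised

section Contour

open Metric Real MeasureTheory

variable {E : Type*} [NormedAddCommGroup E] [NormedSpace ℂ E]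

theorem circleAverage_comp_mul_left (f : ℂ → E) (w : ℂ) (R : ℝ) :
    circleAverage (fun z => f (w * z)) 0 R = circleAverage f 0 (‖w‖ * R) := by
  rw [circleAverage_eq_integral_add (f := f) (Complex.arg w), circleAverage]
  congr! 4 with θ
  conv_lhs => rw [← Complex.norm_mul_exp_arg_mul_I w]
  simp only [circleMap, zero_add, Complex.ofReal_mul, Complex.ofReal_add, add_mul, Complex.exp_add]
  ring

theorem norm_circleAverage_le_of_norm_le_const {f : ℂ → E} {c : ℂ} {R C : ℝ}
    (hf : ∀ z ∈ sphere c |R|, ‖f z‖ ≤ C) : ‖circleAverage f c R‖ ≤ C := by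
  have hint : ‖∫ θ in (0)..2 * π, f (circleMap c R θ)‖ ≤ C * |2 * π - 0| :=
    intervalIntegral.norm_integral_le_of_norm_le_const fun θ _ => hf _ (circleMap_mem_sphere' c R θ)
  rw [circleAverage, norm_smul, norm_inv, Real.norm_eq_abs, inv_mul_le_iff₀ (by positivity)]
  simpa [mul_comm] using hint

theorem circleIntegral_inv_sub_of_lt_norm {p : ℂ} {R : ℝ} (hR : 0 ≤ R) (hp : R < ‖p‖) :
    (∮ z in C(0, R), (z - p)⁻¹) = 0 := by
  have hne (z : ℂ) (hz : z ∈ closedBall 0 R) : z - p ≠ 0 := by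
    rintro h
    rw [sub_eq_zero.1 h, mem_closedBall_zero_iff] at hz
    exact hz.not_gt hp
  refine Complex.circleIntegral_eq_zero_of_differentiable_on_off_countable hR Set.countable_empty
    (fun z hz => ?_) (fun z hz => ?_)
  · have := hne z hz
    fun_prop (disch := assumption)
  · have := hne z (ball_subset_closedBall hz.1)
    fun_prop (disch := assumption)

/-- The function extended by `limUnder` into finitely many removable singularities is continuous on
the closed annulus, and Cauchy's theorem tolerates countably many points of mere continuity. -/
theorem circleIntegral_eq_of_removable_singularities [CompleteSpace E] {r R : ℝ} (hr : 0 < r)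
    (hrR : r ≤ R) (S : Finset ℂ) (hS : ∀ p ∈ S, r < ‖p‖ ∧ ‖p‖ < R) {f : ℂ → E}
    (hf : ∀ z : ℂ, r ≤ ‖z‖ → ‖z‖ ≤ R → z ∉ S → DifferentiableAt ℂ f z)
    (hlim : ∀ p ∈ S, ∃ y, Tendsto f (𝓝[≠] p) (𝓝 y)) :
    (∮ z in C(0, R), f z) = ∮ z in C(0, r), f z := by
  classical
  let g : ℂ → E := fun z => if z ∈ S then limUnder (𝓝[≠] z) f else f z
  have g_eq {z : ℂ} (hz : z ∉ S) : g z = f z := if_neg hz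
  have g_eventuallyEq {z : ℂ} (hz : z ∉ S) : g =ᶠ[𝓝 z] f := by
    filter_upwards [S.finite_toSet.isClosed.isOpen_compl.mem_nhds hz] with w hw using g_eq hw
  have g_punctured (p : ℂ) : g =ᶠ[𝓝[≠] p] f :=
    (S.eventually_cofinite_notMem.mono fun w hw => g_eq hw).filter_mono (nhdsNE_le_cofinite p)
  have integral_g {ρ : ℝ} (hρ : 0 ≤ ρ) (h : ∀ p ∈ S, ‖p‖ ≠ ρ) :
      (∮ z in C(0, ρ), f z) = ∮ z in C(0, ρ), g z :=
    circleIntegral.integral_congr hρ fun z hz =>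
      (g_eq fun hzS => h z hzS (mem_sphere_zero_iff_norm.1 hz)).symm
  rw [integral_g (hr.le.trans hrR) fun p hp => (hS p hp).2.ne,
    integral_g hr.le fun p hp => (hS p hp).1.ne']
  refine Complex.circleIntegral_eq_of_differentiable_on_annulus_off_countable hr hrR
    S.countable_toSet (fun z hz => ContinuousAt.continuousWithinAt ?_) (fun z hz => ?_)
  · by_cases hzS : z ∈ S
    · rw [continuousAt_iff_punctured_nhds, show g z = limUnder (𝓝[≠] z) f from if_pos hzS]
      exact (tendsto_nhds_limUnder (hlim z hzS)).congr' (g_punctured z).symm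
    · refine ContinuousAt.congr ?_ (g_eventuallyEq hzS).symm
      exact (hf z (by simpa using hz.2) (by simpa using hz.1) hzS).continuousAt
  · have hzr : r < ‖z‖ := by simpa using hz.1.2
    refine DifferentiableAt.congr_of_eventuallyEq ?_ (g_eventuallyEq hz.2)
    exact hf z hzr.le (by simpa using (mem_ball_zero_iff.1 hz.1.1).le) hz.2

theorem exists_tendsto_of_tendsto_sub_mul_zero {f : ℂ → ℂ} {p : ℂ}
    (hd : ∀ᶠ z in 𝓝[≠] p, DifferentiableAt ℂ f z)
    (hf : Tendsto (fun z => (z - p) * f z) (𝓝[≠] p) (𝓝 0)) :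
    ∃ y, Tendsto f (𝓝[≠] p) (𝓝 y) := by
  refine ⟨_, Complex.tendsto_limUnder_of_differentiable_on_punctured_nhds_of_isLittleO hd ?_⟩
  have hsub : Tendsto (fun z : ℂ => z - p) (𝓝[≠] p) (𝓝 0) := by
    simpa only [sub_self] using
      ((continuous_sub_right p).continuousWithinAt (s := {p}ᶜ) (x := p)).tendsto
  refine (Asymptotics.isLittleO_iff_tendsto' ?_).2 ?_
  · filter_upwards [self_mem_nhdsWithin] with z hz h
    exact absurd (inv_eq_zero.1 h) (sub_ne_zero.2 hz)
  · have hlim := hf.sub (hsub.mul_const (f p))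
    rw [zero_mul, sub_zero] at hlim
    exact hlim.congr fun z => by rw [div_inv_eq_mul]; ring

/-- The sum of the principal parts at simple poles `p ∈ S` with residues `c p`. -/
def principalPart (S : Finset ℂ) (c : ℂ → ℂ) (z : ℂ) : ℂ := ∑ p ∈ S, c p * (z - p)⁻¹

theorem differentiableAt_principalPart {S : Finset ℂ} (c : ℂ → ℂ) {z : ℂ} (hz : z ∉ S) :
    DifferentiableAt ℂ (principalPart S c) z :=
  DifferentiableAt.fun_sum fun p hp => DifferentiableAt.const_mul (a := fun z => (z - p)⁻¹)
    (DifferentiableAt.inv (by fun_prop) (sub_ne_zero.2 (ne_of_mem_of_not_mem hp hz).symm)) _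

theorem tendsto_sub_mul_principalPart {S : Finset ℂ} (c : ℂ → ℂ) {p : ℂ} (hp : p ∈ S) :
    Tendsto (fun z => (z - p) * principalPart S c z) (𝓝[≠] p) (𝓝 (c p)) := by
  classical
  have hrest : ContinuousAt (principalPart (S.erase p) c) p :=
    (differentiableAt_principalPart c (Finset.notMem_erase p S)).continuousAt
  have hlim : ContinuousAt (fun z => c p + (z - p) * principalPart (S.erase p) c z) p := by
    fun_prop
  have htendsto := (hlim.continuousWithinAt (s := {p}ᶜ)).tendsto
  rw [sub_self, zero_mul, add_zero] at htendsto
  refine htendsto.congr' ?_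
  filter_upwards [self_mem_nhdsWithin] with z hz
  rw [principalPart, principalPart, ← Finset.add_sum_erase _ _ hp, mul_add, mul_left_comm,
    mul_inv_cancel₀ (sub_ne_zero.2 hz), mul_one]

theorem circleIntegral_principalPart {ρ : ℝ} (hρ : 0 ≤ ρ) {S : Finset ℂ} (c : ℂ → ℂ)
    (h : ∀ p ∈ S, ‖p‖ ≠ ρ) :
    (∮ z in C(0, ρ), principalPart S c z) = ∑ p ∈ S, c p * ∮ z in C(0, ρ), (z - p)⁻¹ := by
  simp only [principalPart, ← circleIntegral.integral_const_mul]
  refine circleIntegral.integral_fun_sum fun p hp => ContinuousOn.circleIntegrable hρ ?_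
  refine continuousOn_const.mul (ContinuousOn.inv₀ (by fun_prop) fun z hz => sub_ne_zero.2 ?_)
  rintro rfl
  exact h z hp (mem_sphere_zero_iff_norm.1 hz)

theorem circleIntegral_principalPart_sub {r R : ℝ} (hr : 0 < r) (hrR : r ≤ R) {S : Finset ℂ}
    (hS : ∀ p ∈ S, r < ‖p‖ ∧ ‖p‖ < R) (c : ℂ → ℂ) :
    (∮ z in C(0, R), principalPart S c z) - (∮ z in C(0, r), principalPart S c z) =
      2 * π * Complex.I * ∑ p ∈ S, c p := by
  rw [circleIntegral_principalPart (hr.le.trans hrR) c fun p hp => (hS p hp).2.ne,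
    circleIntegral_principalPart hr.le c fun p hp => (hS p hp).1.ne',
    ← Finset.sum_sub_distrib, Finset.mul_sum]
  refine Finset.sum_congr rfl fun p hp => ?_
  rw [circleIntegral.integral_sub_inv_of_mem_ball (by simpa using (hS p hp).2),
    circleIntegral_inv_sub_of_lt_norm hr.le (hS p hp).1]
  ring

theorem circleIntegral_sub_circleIntegral_eq_sum_residues {r R : ℝ} (hr : 0 < r) (hrR : r ≤ R)
    {S : Finset ℂ} (hS : ∀ p ∈ S, r < ‖p‖ ∧ ‖p‖ < R) {f c : ℂ → ℂ}
    (hf : ∀ z : ℂ, r ≤ ‖z‖ → ‖z‖ ≤ R → z ∉ S → DifferentiableAt ℂ f z)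
    (hres : ∀ p ∈ S, Tendsto (fun z => (z - p) * f z) (𝓝[≠] p) (𝓝 (c p))) :
    (∮ z in C(0, R), f z) - (∮ z in C(0, r), f z) = 2 * π * Complex.I * ∑ p ∈ S, c p := by
  have differentiableAt_sub (z : ℂ) (hzr : r ≤ ‖z‖) (hzR : ‖z‖ ≤ R) (hz : z ∉ S) :
      DifferentiableAt ℂ (fun z => f z - principalPart S c z) z :=
    (hf z hzr hzR hz).sub (differentiableAt_principalPart c hz)
  have removable (p : ℂ) (hp : p ∈ S) :
      ∃ y, Tendsto (fun z => f z - principalPart S c z) (𝓝[≠] p) (𝓝 y) := by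
    refine exists_tendsto_of_tendsto_sub_mul_zero ?_ ?_
    · have hlt := ((continuous_norm (E := ℂ)).tendsto p).eventually
        (Ioo_mem_nhds (hS p hp).1 (hS p hp).2)
      filter_upwards [hlt.filter_mono nhdsWithin_le_nhds,
        S.eventually_cofinite_notMem.filter_mono (nhdsNE_le_cofinite p)]
        with z hz hzS using differentiableAt_sub z hz.1.le hz.2.le hzS
    · simpa [mul_sub] using (hres p hp).sub (tendsto_sub_mul_principalPart c hp)
  have integral_sub {ρ : ℝ} (hrρ : r ≤ ρ) (hρR : ρ ≤ R) (h : ∀ p ∈ S, ‖p‖ ≠ ρ) :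
      (∮ z in C(0, ρ), (f z - principalPart S c z)) =
        (∮ z in C(0, ρ), f z) - ∮ z in C(0, ρ), principalPart S c z := by
    have integrable {g : ℂ → ℂ} (hg : ∀ z, r ≤ ‖z‖ → ‖z‖ ≤ R → z ∉ S → DifferentiableAt ℂ g z) :
        CircleIntegrable g 0 ρ := ContinuousOn.circleIntegrable (hr.le.trans hrρ) fun z hz => by
      rw [mem_sphere_zero_iff_norm] at hz
      exact (hg z (hrρ.trans_eq hz.symm) (hz.trans_le hρR)
        fun hzS => h z hzS hz).continuousAt.continuousWithinAt
    exact circleIntegral.integral_sub (integrable hf)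
      (integrable fun z _ _ => differentiableAt_principalPart c)
  have hcauchy := circleIntegral_eq_of_removable_singularities hr hrR S hS differentiableAt_sub
    removable
  rw [integral_sub hrR le_rfl fun p hp => (hS p hp).2.ne,
    integral_sub le_rfl hrR fun p hp => (hS p hp).1.ne'] at hcauchy
  linear_combination hcauchy + circleIntegral_principalPart_sub hr hrR hS c

theorem circleAverage_eq_of_differentiableAt [CompleteSpace E] {f : ℂ → E} {r R : ℝ} (hr : 0 < r)
    (hrR : r ≤ R) (hf : ∀ z : ℂ, r ≤ ‖z‖ → ‖z‖ ≤ R → DifferentiableAt ℂ f z) :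
    circleAverage f 0 R = circleAverage f 0 r := by
  rw [circleAverage_eq_circleIntegral hr.ne', circleAverage_eq_circleIntegral (hr.trans_le hrR).ne',
    circleIntegral_eq_of_removable_singularities hr hrR ∅ (by simp) (fun z hzr hzR _ => ?_)
      (by simp)]
  have hz0 : z - 0 ≠ 0 := by simpa using norm_pos_iff.1 (hr.trans_le hzr)
  have := hf z hzr hzR
  fun_prop (disch := assumption)

theorem aestronglyMeasurable_deriv {α : Type*} [MeasurableSpace α] {μ : Measure α}
    {F : ℂ → α → E} {s : ℂ} (hF : ∀ᶠ w in 𝓝 s, AEStronglyMeasurable (F w) μ)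
    (hd : ∀ x, DifferentiableAt ℂ (fun w => F w x) s) :
    AEStronglyMeasurable (fun x => deriv (fun w => F w x) s) μ := by
  obtain ⟨w, hw⟩ := exists_seq_tendsto (𝓝[≠] s)
  have hFw : ∀ᶠ n in atTop, AEStronglyMeasurable (F (w n)) μ :=
    hw.eventually (hF.filter_mono nhdsWithin_le_nhds)
  obtain ⟨N, hN⟩ := eventually_atTop.1 hFw
  refine aestronglyMeasurable_of_tendsto_ae atTop
    (f := fun n x => slope (fun w => F w x) s (w (n + N))) (fun n => ?_) (ae_of_all _ fun x => ?_)
  · exact ((hN _ (by omega)).sub hF.self_of_nhds).const_smul _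
  · exact (hasDerivAt_iff_tendsto_slope.1 (hd x).hasDerivAt).comp
      (hw.comp (tendsto_add_atTop_nat N))

theorem norm_deriv_le_of_forall_closedBall_norm_le {f : ℂ → E} {s w : ℂ} {ε C : ℝ} (hε : 0 < ε)
    (hf : DifferentiableOn ℂ f (closedBall s ε)) (hC : ∀ x ∈ closedBall s ε, ‖f x‖ ≤ C)
    (hw : w ∈ ball s (ε / 2)) : ‖deriv f w‖ ≤ C / (ε / 2) := by
  have hsub : closedBall w (ε / 2) ⊆ closedBall s ε :=
    closedBall_subset_closedBall' (by linarith [mem_ball.1 hw])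
  exact Complex.norm_deriv_le_of_forall_mem_sphere_norm_le (half_pos hε)
    ((hf.mono hsub).diffContOnCl_ball subset_rfl)
    fun x hx => hC x (hsub (sphere_subset_closedBall hx))

theorem differentiableOn_circleAverage [CompleteSpace E] {U : Set ℂ} (hU : IsOpen U) {c : ℂ}
    {R : ℝ} {Φ : ℂ → ℂ → E}
    (hc : ContinuousOn (fun p : ℂ × ℂ => Φ p.1 p.2) (U ×ˢ sphere c |R|))
    (hd : ∀ z ∈ sphere c |R|, DifferentiableOn ℂ (fun s => Φ s z) U) :
    DifferentiableOn ℂ (fun s => circleAverage (Φ s) c R) U := by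
  intro s hs
  obtain ⟨ε, hε, hεU⟩ := nhds_basis_closedBall.mem_iff.1 (hU.mem_nhds hs)
  obtain ⟨C, hC⟩ := ((isCompact_closedBall s ε).prod
    (isCompact_sphere c |R|)).exists_bound_of_continuousOn (hc.mono (Set.prod_mono hεU subset_rfl))
  have hmap (θ : ℝ) : circleMap c R θ ∈ sphere c |R| := circleMap_mem_sphere' c R θ
  have hcont (w : ℂ) (hw : w ∈ U) : Continuous fun θ : ℝ => Φ w (circleMap c R θ) :=
    hc.comp_continuous (f := fun θ : ℝ => (w, circleMap c R θ)) (by fun_prop) fun θ => ⟨hw, hmap θ⟩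
  have hderiv (θ : ℝ) (w : ℂ) (hw : w ∈ U) :
      DifferentiableAt ℂ (fun x => Φ x (circleMap c R θ)) w :=
    (hd _ (hmap θ)).differentiableAt (hU.mem_nhds hw)
  have cauchy_estimate (θ : ℝ) (w : ℂ) (hw : w ∈ ball s (ε / 2)) :
      ‖deriv (fun x => Φ x (circleMap c R θ)) w‖ ≤ C / (ε / 2) :=
    norm_deriv_le_of_forall_closedBall_norm_le hε ((hd _ (hmap θ)).mono hεU)
      (fun x hx => hC (x, _) ⟨hx, hmap θ⟩) hw
  have hU_ball {w : ℂ} (hw : w ∈ ball s (ε / 2)) : w ∈ U :=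
    hεU (ball_subset_closedBall (ball_subset_ball (half_le_self hε.le) hw))
  have hmeas : ∀ᶠ w in 𝓝 s, AEStronglyMeasurable (fun θ => Φ w (circleMap c R θ))
      (volume.restrict (Set.uIoc 0 (2 * π))) := by
    filter_upwards [hU.mem_nhds hs] with w hw using (hcont w hw).aestronglyMeasurable
  have hderiv_integral := (intervalIntegral.hasDerivAt_integral_of_dominated_loc_of_deriv_le
    (bound := fun _ => C / (ε / 2)) (ball_mem_nhds s (half_pos hε)) hmeas
    ((hcont s hs).intervalIntegrable 0 (2 * π))
    (aestronglyMeasurable_deriv hmeas fun θ => hderiv θ s hs)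
    (ae_of_all _ fun θ _ w hw => cauchy_estimate θ w hw) intervalIntegrable_const
    (ae_of_all _ fun θ _ w hw => (hderiv θ w (hU_ball hw)).hasDerivAt)).2
  exact (hderiv_integral.const_smul (2 * π)⁻¹).differentiableAt.differentiableWithinAt

end Contour

section Weight

open Metric Real

variable {q : ℂ}

/-- The product `(x z, x / z; q)_∞` of which Askey--Wilson type weights are made. -/
def qPochPM (x q z : ℂ) : ℂ := qPochInf (x * z) q * qPochInf (x / z) q

/-- The weight `(z², z⁻²; q)_∞ / ∏ᵢ (aᵢ z, aᵢ / z; q)_∞`; four parameters give the Askey--Wilson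
weight. -/
def awWeight {ι : Type*} [Fintype ι] (q : ℂ) (a : ι → ℂ) (z : ℂ) : ℂ :=
  qPochInf (z ^ 2) q * qPochInf (1 / z ^ 2) q / ∏ i, qPochPM (a i) q z

/-- The average of the Askey--Wilson weight over the unit circle. -/
def awIntegral {ι : Type*} [Fintype ι] (q : ℂ) (a : ι → ℂ) : ℂ := circleAverage (awWeight q a) 0 1

theorem ne_zero_of_norm_eq_one {z : ℂ} (hz : ‖z‖ = 1) : z ≠ 0 :=
  norm_ne_zero_iff.1 (hz ▸ one_ne_zero)

theorem one_sub_ne_zero_of_norm_lt_one {x : ℂ} (hx : ‖x‖ < 1) : 1 - x ≠ 0 := fun h => by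
  simp [← sub_eq_zero.1 h] at hx

theorem norm_mul_lt_one {x y : ℂ} (hx : ‖x‖ < 1) (hy : ‖y‖ < 1) : ‖x * y‖ < 1 := by
  rw [norm_mul]
  exact mul_lt_one_of_nonneg_of_lt_one_left (norm_nonneg _) hx hy.le

theorem norm_mul_pow_lt_one (hq1 : ‖q‖ < 1) {x : ℂ} (hx : ‖x‖ < 1) (n : ℕ) : ‖x * q ^ n‖ < 1 := by
  rw [norm_mul, norm_pow]
  exact mul_lt_one_of_nonneg_of_lt_one_left (norm_nonneg _) hx
    (pow_le_one₀ (norm_nonneg _) hq1.le)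

theorem qPochPM_eq_mul (hq1 : ‖q‖ < 1) (x z : ℂ) :
    qPochPM x q z = (1 - x * z) * (1 - x / z) * qPochPM (x * q) q z := by
  rw [qPochPM, qPochInf_eq_mul hq1, qPochInf_eq_mul hq1 (x / z), qPochPM, mul_right_comm x z q,
    div_mul_eq_mul_div]
  ring

theorem qPochPM_ne_zero (hq : q ≠ 0) (hq1 : ‖q‖ < 1) {x z : ℂ} (hx : ‖x‖ < 1) (hz : ‖z‖ = 1) :
    qPochPM x q z ≠ 0 :=
  mul_ne_zero (qPochInf_ne_zero_of_norm_lt_one hq hq1 (by simpa [hz] using hx))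
    (qPochInf_ne_zero_of_norm_lt_one hq hq1 (by simpa [hz] using hx))

theorem continuousOn_qPochPM (hq1 : ‖q‖ < 1) {X : Type*} [TopologicalSpace X] {x z : X → ℂ}
    {s : Set X} (hx : ContinuousOn x s) (hz : ContinuousOn z s) (hz0 : ∀ p ∈ s, z p ≠ 0) :
    ContinuousOn (fun p => qPochPM (x p) q (z p)) s := by
  unfold qPochPM
  fun_prop (disch := assumption)

theorem differentiable_qPochPM (hq1 : ‖q‖ < 1) (z : ℂ) :
    Differentiable ℂ fun x => qPochPM x q z := by
  unfold qPochPM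
  fun_prop (disch := assumption)

attribute [fun_prop] differentiable_qPochPM

variable {ι : Type*} [Fintype ι]

theorem prod_qPochPM_ne_zero (hq : q ≠ 0) (hq1 : ‖q‖ < 1) {a : ι → ℂ} (ha : ∀ i, ‖a i‖ < 1)
    {z : ℂ} (hz : ‖z‖ = 1) : ∏ i, qPochPM (a i) q z ≠ 0 :=
  Finset.prod_ne_zero_iff.2 fun i _ => qPochPM_ne_zero hq hq1 (ha i) hz

theorem awWeight_comp_perm (σ : Equiv.Perm ι) (q : ℂ) (a : ι → ℂ) :
    awWeight q (a ∘ σ) = awWeight q a := by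
  ext z
  simp only [awWeight, Function.comp_apply, Equiv.prod_comp σ fun i => qPochPM (a i) q z]

theorem awWeight_update_mul [DecidableEq ι] (hq : q ≠ 0) (hq1 : ‖q‖ < 1) {a : ι → ℂ} {i : ι}
    (hi : ‖a i‖ < 1) {z : ℂ} (hz : ‖z‖ = 1) :
    awWeight q (Function.update a i (a i * q)) z =
      (1 - a i * z) * (1 - a i / z) * awWeight q a z := by
  have hne := qPochPM_ne_zero hq hq1 hi hz
  rw [qPochPM_eq_mul hq1] at hne
  have hprod := Finset.prod_update_of_mem (Finset.mem_univ i) (fun j => qPochPM (a j) q z)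
    (qPochPM (a i * q) q z)
  simp only [awWeight, Function.apply_update (fun _ x => qPochPM x q z), hprod]
  rw [← Finset.mul_prod_erase _ _ (Finset.mem_univ i), Finset.sdiff_singleton_eq_erase,
    qPochPM_eq_mul hq1 (a i), mul_assoc _ (qPochPM _ _ _), ← mul_div_assoc,
    mul_div_mul_left _ _ (left_ne_zero_of_mul hne)]

theorem continuousOn_awWeight (hq : q ≠ 0) (hq1 : ‖q‖ < 1) {X : Type*} [TopologicalSpace X]
    {a : X → ι → ℂ} {z : X → ℂ} {s : Set X} (ha : ∀ i, ContinuousOn (fun p => a p i) s)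
    (hz : ContinuousOn z s) (ha1 : ∀ p ∈ s, ∀ i, ‖a p i‖ < 1) (hz1 : ∀ p ∈ s, ‖z p‖ = 1) :
    ContinuousOn (fun p => awWeight q (a p) (z p)) s := by
  have hz0 (p : X) (hp : p ∈ s) : z p ≠ 0 := ne_zero_of_norm_eq_one (hz1 p hp)
  have hz2 (p : X) (hp : p ∈ s) : z p ^ 2 ≠ 0 := pow_ne_zero 2 (hz0 p hp)
  have hden (p : X) (hp : p ∈ s) : ∏ i, qPochPM (a p i) q (z p) ≠ 0 :=
    prod_qPochPM_ne_zero hq hq1 (ha1 p hp) (hz1 p hp)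
  have hprod : ContinuousOn (fun p => ∏ i, qPochPM (a p i) q (z p)) s :=
    continuousOn_finsetProd _ fun i _ => continuousOn_qPochPM hq1 (ha i) hz hz0
  unfold awWeight
  fun_prop (disch := assumption)

theorem differentiableOn_awWeight (hq : q ≠ 0) (hq1 : ‖q‖ < 1) {a : ℂ → ι → ℂ} {U : Set ℂ}
    (ha : ∀ i, DifferentiableOn ℂ (fun s => a s i) U) (ha1 : ∀ s ∈ U, ∀ i, ‖a s i‖ < 1) {z : ℂ}
    (hz : ‖z‖ = 1) : DifferentiableOn ℂ (fun s => awWeight q (a s) z) U := by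
  have hden (s : ℂ) (hs : s ∈ U) : ∏ i, qPochPM (a s i) q z ≠ 0 :=
    prod_qPochPM_ne_zero hq hq1 (ha1 s hs) hz
  unfold awWeight
  fun_prop (disch := assumption)

theorem circleIntegrable_awWeight (hq : q ≠ 0) (hq1 : ‖q‖ < 1) {a : ι → ℂ} (ha : ∀ i, ‖a i‖ < 1) :
    CircleIntegrable (awWeight q a) 0 1 :=
  ContinuousOn.circleIntegrable zero_le_one <| continuousOn_awWeight hq hq1
    (fun _ => continuousOn_const) continuousOn_id (fun _ _ => ha)
    fun _ hz => mem_sphere_zero_iff_norm.1 hz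

theorem differentiableOn_awIntegral (hq : q ≠ 0) (hq1 : ‖q‖ < 1) {a : ℂ → ι → ℂ} {U : Set ℂ}
    (hU : IsOpen U) (ha : ∀ i, DifferentiableOn ℂ (fun s => a s i) U)
    (ha1 : ∀ s ∈ U, ∀ i, ‖a s i‖ < 1) :
    DifferentiableOn ℂ (fun s => awIntegral q (a s)) U := by
  refine differentiableOn_circleAverage hU ?_ fun z hz =>
    differentiableOn_awWeight hq hq1 ha ha1 (by simpa using hz)
  exact continuousOn_awWeight hq hq1
    (fun i => (ha i).continuousOn.comp continuousOn_fst fun p hp => hp.1) continuousOn_snd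
    (fun p hp => ha1 p.1 hp.1) fun p hp => by simpa using hp.2

end Weight

section AskeyWilson

open Metric Real

variable {q : ℂ}

/-- The function of which the difference of contiguous Askey--Wilson weights is a `q`-difference;
it is holomorphic on the annulus `|q| ≤ |z| ≤ 1`. -/
def awAux (q : ℂ) (a : Fin 4 → ℂ) (z : ℂ) : ℂ :=
  z ^ 3 * (qPochInf (q * z ^ 2) q * qPochInf (1 / z ^ 2) q) /
    ∏ i, (qPochInf (a i * z) q * qPochInf (a i * q / z) q)

/-- The common factor of `awWeight q a z`, `awAux q a z` and `awAux q a (q * z)`, which are rational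
multiples of it. -/
def awCore (q : ℂ) (a : Fin 4 → ℂ) (z : ℂ) : ℂ :=
  qPochInf (q * z ^ 2) q * qPochInf (q / z ^ 2) q / ∏ i, qPochPM (a i * q) q z

theorem awWeight_eq_mul_awCore (hq1 : ‖q‖ < 1) (a : Fin 4 → ℂ) (z : ℂ) :
    awWeight q a z = (1 - z ^ 2) * (1 - 1 / z ^ 2) /
      ((∏ i, (1 - a i * z)) * ∏ i, (1 - a i / z)) * awCore q a z := by
  simp only [awWeight, awCore, qPochPM_eq_mul hq1 (a _), Finset.prod_mul_distrib]
  rw [qPochInf_eq_mul hq1 (z ^ 2), qPochInf_eq_mul hq1 (1 / z ^ 2), mul_comm (z ^ 2) q,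
    one_div_mul_eq_div, div_mul_div_comm]
  ring

theorem awAux_eq_mul_awCore (hq1 : ‖q‖ < 1) (a : Fin 4 → ℂ) (z : ℂ) :
    awAux q a z = z ^ 3 * (1 - 1 / z ^ 2) / (∏ i, (1 - a i * z)) * awCore q a z := by
  have hfactor (i : Fin 4) : qPochInf (a i * z) q * qPochInf (a i * q / z) q =
      (1 - a i * z) * qPochPM (a i * q) q z := by
    rw [qPochPM, qPochInf_eq_mul hq1 (a i * z), mul_right_comm (a i) z q, mul_assoc]
  simp only [awAux, awCore, hfactor, Finset.prod_mul_distrib]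
  rw [qPochInf_eq_mul hq1 (1 / z ^ 2), one_div_mul_eq_div, div_mul_div_comm]
  ring

theorem awAux_mul_eq_mul_awCore (hq : q ≠ 0) (hq1 : ‖q‖ < 1) (a : Fin 4 → ℂ) {z : ℂ}
    (hz : z ≠ 0) :
    awAux q a (q * z) = (1 - 1 / z ^ 2) / (z * ∏ i, (1 - a i / z)) * awCore q a z := by
  have hfactor (i : Fin 4) : qPochInf (a i * (q * z)) q * qPochInf (a i * q / (q * z)) q =
      (1 - a i / z) * qPochPM (a i * q) q z := by
    rw [qPochPM, mul_comm q z, mul_div_mul_right _ _ hq, qPochInf_eq_mul hq1 (a i / z),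
      div_mul_eq_mul_div]
    ring_nf
  have hup : qPochInf (q * z ^ 2) q =
      (1 - q * z ^ 2) * (1 - q ^ 2 * z ^ 2) * qPochInf (q * (q * z) ^ 2) q := by
    rw [qPochInf_eq_mul hq1, qPochInf_eq_mul hq1 (q * z ^ 2 * q)]
    ring_nf
  have hdown : qPochInf (1 / (q * z) ^ 2) q = (1 - 1 / (q * z) ^ 2) * (1 - 1 / (q * z ^ 2)) *
      (1 - 1 / z ^ 2) * qPochInf (q / z ^ 2) q := by
    rw [qPochInf_eq_mul hq1, show 1 / (q * z) ^ 2 * q = 1 / (q * z ^ 2) by field_simp,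
      qPochInf_eq_mul hq1, show 1 / (q * z ^ 2) * q = 1 / z ^ 2 by field_simp,
      qPochInf_eq_mul hq1, one_div_mul_eq_div]
    ring
  have hz3 : (q * z) ^ 3 * ((1 - 1 / (q * z) ^ 2) * (1 - 1 / (q * z ^ 2))) =
      z⁻¹ * ((1 - q * z ^ 2) * (1 - q ^ 2 * z ^ 2)) := by
    field_simp
    ring
  simp only [awAux, awCore, hfactor, Finset.prod_mul_distrib]
  rw [hup, hdown, div_mul_div_comm]
  linear_combination (qPochInf (q * (q * z) ^ 2) q * (1 - 1 / z ^ 2) * qPochInf (q / z ^ 2) q /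
    ((∏ i, (1 - a i / z)) * ∏ i, qPochPM (a i * q) q z)) * hz3

theorem aw_rational_identity {a b c d z : ℂ} (hz : z ≠ 0)
    (hplus : ∏ i, (1 - ![a, b, c, d] i * z) ≠ 0) (hminus : ∏ i, (1 - ![a, b, c, d] i / z) ≠ 0) :
    ((1 - a * b * c * d) * ((1 - a * z) * (1 - a / z)) - (1 - a * b) * (1 - a * c) * (1 - a * d)) *
        ((1 - z ^ 2) * (1 - 1 / z ^ 2) /
          ((∏ i, (1 - ![a, b, c, d] i * z)) * ∏ i, (1 - ![a, b, c, d] i / z))) =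
      a * (z ^ 3 * (1 - 1 / z ^ 2) / (∏ i, (1 - ![a, b, c, d] i * z)) -
        (1 - 1 / z ^ 2) / (z * ∏ i, (1 - ![a, b, c, d] i / z))) := by
  have hpoly : ((1 - a * b * c * d) * ((1 - a * z) * (1 - a / z)) -
      (1 - a * b) * (1 - a * c) * (1 - a * d)) * (1 - z ^ 2) =
      a * (z ^ 3 * (∏ i, (1 - ![a, b, c, d] i / z)) -
        z⁻¹ * ∏ i, (1 - ![a, b, c, d] i * z)) := by
    simp only [Fin.prod_univ_four, Matrix.cons_val]
    field_simp
    ring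
  generalize ∏ i, (1 - ![a, b, c, d] i * z) = P at *
  generalize ∏ i, (1 - ![a, b, c, d] i / z) = M at *
  rw [← mul_div_assoc, ← mul_assoc, hpoly]
  field_simp

theorem awWeight_contiguous (hq : q ≠ 0) (hq1 : ‖q‖ < 1) {a b c d z : ℂ}
    (h : ∀ i, ‖![a, b, c, d] i‖ < 1) (hz : ‖z‖ = 1) :
    (1 - a * b * c * d) * awWeight q ![a * q, b, c, d] z =
      (1 - a * b) * (1 - a * c) * (1 - a * d) * awWeight q ![a, b, c, d] z +
        a * (awAux q ![a, b, c, d] z - awAux q ![a, b, c, d] (q * z)) := by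
  have hz0 := ne_zero_of_norm_eq_one hz
  have hplus : ∏ i, (1 - ![a, b, c, d] i * z) ≠ 0 := Finset.prod_ne_zero_iff.2 fun i _ =>
    one_sub_ne_zero_of_norm_lt_one (by rw [norm_mul, hz, mul_one]; exact h i)
  have hminus : ∏ i, (1 - ![a, b, c, d] i / z) ≠ 0 := Finset.prod_ne_zero_iff.2 fun i _ =>
    one_sub_ne_zero_of_norm_lt_one (by rw [norm_div, hz, div_one]; exact h i)
  have hshift := awWeight_update_mul hq hq1 (h 0) hz
  have hupdate : Function.update ![a, b, c, d] 0 (a * q) = ![a * q, b, c, d] :=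
    Fin.update_cons_zero ..
  simp only [Matrix.cons_val_zero, hupdate] at hshift
  rw [hshift, awWeight_eq_mul_awCore hq1, awAux_eq_mul_awCore hq1,
    awAux_mul_eq_mul_awCore hq hq1 _ hz0]
  linear_combination awCore q ![a, b, c, d] z * aw_rational_identity hz0 hplus hminus

theorem differentiableAt_awAux (hq : q ≠ 0) (hq1 : ‖q‖ < 1) {a : Fin 4 → ℂ} {z : ℂ}
    (ha : ∀ i, ‖a i‖ < 1) (hzq : ‖q‖ ≤ ‖z‖) (hz1 : ‖z‖ ≤ 1) :
    DifferentiableAt ℂ (awAux q a) z := by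
  have hzpos : 0 < ‖z‖ := (norm_pos_iff.2 hq).trans_le hzq
  have hz0 : z ≠ 0 := norm_pos_iff.1 hzpos
  have hz2 : z ^ 2 ≠ 0 := pow_ne_zero 2 hz0
  have hden : ∏ i, (qPochInf (a i * z) q * qPochInf (a i * q / z) q) ≠ 0 := by
    refine Finset.prod_ne_zero_iff.2 fun i _ => mul_ne_zero
      (qPochInf_ne_zero_of_norm_lt_one hq hq1 ?_) (qPochInf_ne_zero_of_norm_lt_one hq hq1 ?_)
    · rw [norm_mul]
      exact mul_lt_one_of_nonneg_of_lt_one_left (norm_nonneg _) (ha i) hz1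
    · rw [norm_div, norm_mul, div_lt_one hzpos]
      exact (mul_lt_of_lt_one_left (norm_pos_iff.2 hq) (ha i)).trans_le hzq
  unfold awAux
  fun_prop (disch := assumption)

theorem circleAverage_awAux_sub (hq : q ≠ 0) (hq1 : ‖q‖ < 1) {a : Fin 4 → ℂ}
    (ha : ∀ i, ‖a i‖ < 1) :
    CircleIntegrable (fun z => awAux q a z - awAux q a (q * z)) 0 1 ∧
      circleAverage (fun z => awAux q a z - awAux q a (q * z)) 0 1 = 0 := by
  have hdiff (z : ℂ) (hzq : ‖q‖ ≤ ‖z‖) (hz1 : ‖z‖ ≤ 1) : DifferentiableAt ℂ (awAux q a) z :=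
    differentiableAt_awAux hq hq1 ha hzq hz1
  have hint : CircleIntegrable (awAux q a) 0 1 :=
    ContinuousOn.circleIntegrable zero_le_one fun z hz => by
      rw [mem_sphere_zero_iff_norm] at hz
      exact (hdiff z (hz ▸ hq1.le) hz.le).continuousAt.continuousWithinAt
  have hint_mul : CircleIntegrable (fun z => awAux q a (q * z)) 0 1 :=
    ContinuousOn.circleIntegrable zero_le_one fun z hz => by
      have hqz : ‖q * z‖ = ‖q‖ := by rw [norm_mul, mem_sphere_zero_iff_norm.1 hz, mul_one]
      exact ((hdiff (q * z) hqz.ge (hqz ▸ hq1.le)).continuousAt.comp (f := fun z => q * z)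
        (by fun_prop)).continuousWithinAt
  refine ⟨hint.sub hint_mul, ?_⟩
  rw [circleAverage_fun_sub hint hint_mul, circleAverage_comp_mul_left, mul_one,
    circleAverage_eq_of_differentiableAt (norm_pos_iff.2 hq) hq1.le hdiff, sub_self]

theorem awIntegral_contiguous (hq : q ≠ 0) (hq1 : ‖q‖ < 1) {a b c d : ℂ}
    (h : ∀ i, ‖![a, b, c, d] i‖ < 1) :
    (1 - a * b * c * d) * awIntegral q ![a * q, b, c, d] =
      (1 - a * b) * (1 - a * c) * (1 - a * d) * awIntegral q ![a, b, c, d] := by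
  obtain ⟨hint_aux, haux⟩ := circleAverage_awAux_sub hq hq1 h
  have hweight := circleAverage_congr_sphere (c := 0) (R := 1)
    (f₁ := (1 - a * b * c * d) • awWeight q ![a * q, b, c, d])
    (f₂ := ((1 - a * b) * (1 - a * c) * (1 - a * d)) • awWeight q ![a, b, c, d] +
      a • fun z => awAux q ![a, b, c, d] z - awAux q ![a, b, c, d] (q * z))
    (fun z hz => awWeight_contiguous hq hq1 h (by simpa using hz))
  rwa [circleAverage_add (circleIntegrable_awWeight hq hq1 h).const_smul hint_aux.const_smul,
    circleAverage_smul, circleAverage_smul, circleAverage_smul, haux, smul_zero,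
    add_zero] at hweight

/-- The Askey--Wilson integral divided by the infinite products it is proportional to; the
contiguous relation shows that it does not depend on the parameters. -/
def awNormalized (q a b c d : ℂ) : ℂ :=
  awIntegral q ![a, b, c, d] * (qPochInf (a * b) q * qPochInf (a * c) q * qPochInf (a * d) q *
    qPochInf (b * c) q * qPochInf (b * d) q * qPochInf (c * d) q) / qPochInf (a * b * c * d) q

theorem forall_norm_lt_one_vec {a b c d : ℂ} (ha : ‖a‖ < 1) (hb : ‖b‖ < 1) (hc : ‖c‖ < 1)
    (hd : ‖d‖ < 1) (i : Fin 4) : ‖![a, b, c, d] i‖ < 1 := by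
  fin_cases i <;> assumption

theorem awNormalized_rotate (q a b c d : ℂ) : awNormalized q b c d a = awNormalized q a b c d := by
  have hperm : ![b, c, d, a] = ![a, b, c, d] ∘ finRotate 4 := by
    ext i
    fin_cases i <;> rfl
  simp only [awNormalized, awIntegral, hperm, awWeight_comp_perm]
  ring_nf

theorem awNormalized_mul_left (hq : q ≠ 0) (hq1 : ‖q‖ < 1) {a b c d : ℂ} (ha : ‖a‖ < 1)
    (hb : ‖b‖ < 1) (hc : ‖c‖ < 1) (hd : ‖d‖ < 1) :
    awNormalized q (a * q) b c d = awNormalized q a b c d := by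
  have hcontiguous := awIntegral_contiguous hq hq1 (forall_norm_lt_one_vec ha hb hc hd)
  have hshift (x : ℂ) : qPochInf (a * x) q = (1 - a * x) * qPochInf (a * q * x) q := by
    rw [qPochInf_eq_mul hq1, mul_right_comm]
  have habcd : qPochInf (a * b * c * d) q ≠ 0 := qPochInf_ne_zero_of_norm_lt_one hq hq1
    (norm_mul_lt_one (norm_mul_lt_one (norm_mul_lt_one ha hb) hc) hd)
  have hshift_prod : qPochInf (a * b * c * d) q =
      (1 - a * b * c * d) * qPochInf (a * q * b * c * d) q := by
    rw [qPochInf_eq_mul hq1]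
    ring_nf
  rw [hshift_prod] at habcd
  rw [awNormalized, awNormalized, hshift_prod, hshift, hshift, hshift,
    div_eq_div_iff (right_ne_zero_of_mul habcd) habcd]
  linear_combination (qPochInf (a * q * b) q * qPochInf (a * q * c) q * qPochInf (a * q * d) q *
    qPochInf (b * c) q * qPochInf (b * d) q * qPochInf (c * d) q) *
    qPochInf (a * q * b * c * d) q * hcontiguous

theorem awNormalized_mul (hq : q ≠ 0) (hq1 : ‖q‖ < 1) {a b c d : ℂ} (ha : ‖a‖ < 1)
    (hb : ‖b‖ < 1) (hc : ‖c‖ < 1) (hd : ‖d‖ < 1) :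
    awNormalized q (a * q) (b * q) (c * q) (d * q) = awNormalized q a b c d := by
  have hbq := norm_mul_lt_one hb hq1
  have hcq := norm_mul_lt_one hc hq1
  have hdq := norm_mul_lt_one hd hq1
  rw [awNormalized_mul_left hq hq1 ha hbq hcq hdq, ← awNormalized_rotate,
    awNormalized_mul_left hq hq1 hb hcq hdq ha, ← awNormalized_rotate,
    awNormalized_mul_left hq hq1 hc hdq ha hb, ← awNormalized_rotate,
    awNormalized_mul_left hq hq1 hd ha hb hc, ← awNormalized_rotate]

theorem awNormalized_pow_mul (hq : q ≠ 0) (hq1 : ‖q‖ < 1) {a b c d : ℂ} (ha : ‖a‖ < 1)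
    (hb : ‖b‖ < 1) (hc : ‖c‖ < 1) (hd : ‖d‖ < 1) (n : ℕ) :
    awNormalized q (q ^ n * a) (q ^ n * b) (q ^ n * c) (q ^ n * d) = awNormalized q a b c d := by
  have hpow {x : ℂ} (hx : ‖x‖ < 1) (n : ℕ) : ‖q ^ n * x‖ < 1 := by
    rw [norm_mul, norm_pow]
    exact mul_lt_one_of_nonneg_of_lt_one_right (pow_le_one₀ (norm_nonneg _) hq1.le)
      (norm_nonneg _) hx
  induction n with
  | zero => simp
  | succ n ih =>
    rw [← ih, ← awNormalized_mul hq hq1 (hpow ha n) (hpow hb n) (hpow hc n) (hpow hd n)]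
    ring_nf

theorem awNormalized_eq_awNormalized_zero (hq : q ≠ 0) (hq1 : ‖q‖ < 1) {a b c d : ℂ}
    (ha : ‖a‖ < 1) (hb : ‖b‖ < 1) (hc : ‖c‖ < 1) (hd : ‖d‖ < 1) :
    awNormalized q a b c d = awNormalized q 0 0 0 0 := by
  have hintegral :
      ContinuousAt (fun t => awIntegral q ![t * a, t * b, t * c, t * d]) 0 := by
    refine ((differentiableOn_awIntegral hq hq1 isOpen_ball (fun i => ?_) fun t ht =>
      ?_).differentiableAt (ball_mem_nhds 0 one_pos)).continuousAt
    · fin_cases i <;> exact (differentiable_id.mul_const _).differentiableOn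
    · rw [mem_ball_zero_iff] at ht
      exact forall_norm_lt_one_vec (norm_mul_lt_one ht ha) (norm_mul_lt_one ht hb)
        (norm_mul_lt_one ht hc) (norm_mul_lt_one ht hd)
  have hcont : ContinuousAt (fun t => awNormalized q (t * a) (t * b) (t * c) (t * d)) 0 := by
    have hden : qPochInf (0 * a * (0 * b) * (0 * c) * (0 * d)) q ≠ 0 := by simp [qPochInf_zero]
    unfold awNormalized
    fun_prop (disch := assumption)
  have hlim := hcont.tendsto.comp (tendsto_pow_atTop_nhds_zero_of_norm_lt_one hq1)
  simp only [Function.comp_def, awNormalized_pow_mul hq hq1 ha hb hc hd, zero_mul] at hlim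
  exact tendsto_nhds_unique tendsto_const_nhds hlim

theorem norm_pow_lt_one {x : ℂ} (hx : ‖x‖ < 1) {n : ℕ} (hn : n ≠ 0) : ‖x ^ n‖ < 1 := by
  rw [norm_pow]
  exact pow_lt_one₀ (norm_nonneg x) hx hn

theorem qPochInf_base_sq {r : ℂ} (hr1 : ‖r‖ < 1) (x : ℂ) :
    qPochInf x r = qPochInf x (r ^ 2) * qPochInf (r * x) (r ^ 2) := by
  have hr21 := norm_pow_lt_one hr1 two_ne_zero
  have hodd (n : ℕ) : 1 - r * x * (r ^ 2) ^ n = 1 - x * r ^ (2 * n + 1) := by ring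
  have hsplit := tprod_even_mul_odd (f := fun n : ℕ => 1 - x * r ^ n)
    (by simpa only [pow_mul] using multipliable_one_sub_mul_pow hr21 x)
    ((multipliable_one_sub_mul_pow hr21 (r * x)).congr hodd)
  simp only [qPochInf, ← hsplit, hodd, pow_mul]

theorem qPochInf_sq_base_sq {r : ℂ} (hr1 : ‖r‖ < 1) (x : ℂ) :
    qPochInf (x ^ 2) (r ^ 2) = qPochInf x r * qPochInf (-x) r := by
  rw [qPochInf, qPochInf, qPochInf, ← (multipliable_one_sub_mul_pow hr1 x).tprod_mul
    (multipliable_one_sub_mul_pow hr1 (-x))]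
  exact tprod_congr fun n => by ring

theorem qPochInf_sq {r : ℂ} (hr1 : ‖r‖ < 1) (x : ℂ) :
    qPochInf (x ^ 2) (r ^ 2) = qPochInf x (r ^ 2) * qPochInf (-x) (r ^ 2) *
      (qPochInf (r * x) (r ^ 2) * qPochInf (-(r * x)) (r ^ 2)) := by
  rw [qPochInf_sq_base_sq hr1, qPochInf_base_sq hr1, qPochInf_base_sq hr1 (-x), mul_neg]
  ring

theorem circleAverage_zpow_of_ne_zero {n : ℤ} (hn : n ≠ 0) :
    circleAverage (fun z : ℂ => z ^ n) 0 1 = 0 := by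
  have hcongr : (∮ z in C(0, 1), (z - 0)⁻¹ • z ^ n) = ∮ z in C(0, 1), (z - 0) ^ (n - 1) :=
    circleIntegral.integral_congr zero_le_one fun z hz => by
      have hz0 : z ≠ 0 := ne_zero_of_norm_eq_one (by simpa using hz)
      simp only [sub_zero, smul_eq_mul]
      rw [zpow_sub_one₀ hz0, mul_comm]
  rw [circleAverage_eq_circleIntegral one_ne_zero, hcongr,
    circleIntegral.integral_sub_zpow_of_ne (by lia), smul_zero]

theorem circleAverage_one_sub_sq_mul_one_sub_inv_sq :
    circleAverage (fun z : ℂ => (1 - z ^ 2) * (1 - 1 / z ^ 2)) 0 1 = 2 := by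
  have hint (n : ℤ) : CircleIntegrable (fun z : ℂ => z ^ n) 0 1 :=
    ContinuousOn.circleIntegrable zero_le_one fun z hz =>
      (continuousAt_zpow₀ z n (.inl (ne_zero_of_norm_eq_one (by simpa using
        hz)))).continuousWithinAt
  have hconst : CircleIntegrable (fun _ : ℂ => (2 : ℂ)) 0 1 := circleIntegrable_const ..
  have hexpand := circleAverage_congr_sphere (c := 0) (R := 1)
    (f₁ := fun z : ℂ => (1 - z ^ 2) * (1 - 1 / z ^ 2))
    (f₂ := ((fun _ => 2) - fun z : ℂ => z ^ (2 : ℤ)) - fun z => z ^ (-2 : ℤ)) fun z hz => by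
      have hz0 : z ≠ 0 := ne_zero_of_norm_eq_one (by simpa using hz)
      simp only [Pi.sub_apply, zpow_neg]
      norm_cast
      field_simp
      ring
  rw [hexpand, circleAverage_sub (hconst.sub (hint 2)) (hint _),
    circleAverage_sub hconst (hint 2), circleAverage_zpow_of_ne_zero two_ne_zero,
    circleAverage_zpow_of_ne_zero (by norm_num), circleAverage_const, sub_zero, sub_zero]

/-- For these parameters the weight reduces to `(1 - z²)(1 - z⁻²)`. -/
theorem awIntegral_half_period {r : ℂ} (hr : r ≠ 0) (hr1 : ‖r‖ < 1) :
    awIntegral (r ^ 2) ![r ^ 2, -r ^ 2, r, -r] = 2 := by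
  have hr21 := norm_pow_lt_one hr1 two_ne_zero
  have hparams := forall_norm_lt_one_vec hr21 ((norm_neg _).trans_lt hr21) hr1
    ((norm_neg _).trans_lt hr1)
  have hsq (x : ℂ) : qPochInf (x ^ 2) (r ^ 2) = (1 - x ^ 2) *
      ∏ i, qPochInf (![r ^ 2, -r ^ 2, r, -r] i * x) (r ^ 2) := by
    rw [qPochInf_sq hr1, qPochInf_eq_mul hr21 x, qPochInf_eq_mul hr21 (-x)]
    simp only [Fin.prod_univ_four, Matrix.cons_val]
    ring_nf
  rw [awIntegral, ← circleAverage_one_sub_sq_mul_one_sub_inv_sq]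
  refine circleAverage_congr_sphere fun z hz => ?_
  have hden := prod_qPochPM_ne_zero (pow_ne_zero 2 hr) hr21 hparams (z := z) (by simpa using hz)
  rw [awWeight, div_eq_iff hden, ← one_div_pow, hsq, hsq]
  simp only [qPochPM, Finset.prod_mul_distrib, mul_one_div]
  ring

theorem qPochInf_euler {r : ℂ} (hr : r ≠ 0) (hr1 : ‖r‖ < 1) :
    qPochInf r (r ^ 2) * qPochInf (-r) (r ^ 2) * qPochInf (-r ^ 2) (r ^ 2) = 1 := by
  have hr21 := norm_pow_lt_one hr1 two_ne_zero
  have hsq := qPochInf_sq hr1 r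
  rw [← sq] at hsq
  refine mul_left_cancel₀ (qPochInf_ne_zero_of_norm_lt_one (pow_ne_zero 2 hr) hr21 hr21) ?_
  linear_combination -hsq

theorem awNormalized_zero {r : ℂ} (hr : r ≠ 0) (hr1 : ‖r‖ < 1) :
    awNormalized (r ^ 2) 0 0 0 0 = 2 / qPochInf (r ^ 2) (r ^ 2) := by
  have hr21 := norm_pow_lt_one hr1 two_ne_zero
  have hne {n : ℕ} (hn : n ≠ 0) : qPochInf (r ^ n) (r ^ 2) ≠ 0 :=
    qPochInf_ne_zero_of_norm_lt_one (pow_ne_zero 2 hr) hr21 (norm_pow_lt_one hr1 hn)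
  have hsix : qPochInf (r ^ 6) (r ^ 2) = qPochInf (r ^ 3) (r ^ 2) * qPochInf (-r ^ 3) (r ^ 2) *
      (qPochInf (r ^ 4) (r ^ 2) * qPochInf (-r ^ 4) (r ^ 2)) := by
    rw [show r ^ 6 = (r ^ 3) ^ 2 by ring, qPochInf_sq hr1, ← pow_succ']
  have heuler := qPochInf_euler hr hr1
  rw [qPochInf_eq_mul hr21 r, ← pow_succ', qPochInf_eq_mul hr21 (-r),
    show -r * r ^ 2 = -r ^ 3 by ring] at heuler
  have hbase : qPochInf (r ^ 2) (r ^ 2) = (1 - r ^ 2) * qPochInf (r ^ 4) (r ^ 2) := by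
    rw [qPochInf_eq_mul hr21, ← pow_add]
  have hnum : (r ^ 2 * -r ^ 2 = -r ^ 4 ∧ r ^ 2 * r = r ^ 3 ∧ r ^ 2 * -r = -r ^ 3) ∧
      (-r ^ 2 * r = -r ^ 3 ∧ -r ^ 2 * -r = r ^ 3 ∧ r * -r = -r ^ 2) ∧ -r ^ 4 * r * -r = r ^ 6 := by
    refine ⟨⟨?_, ?_, ?_⟩, ⟨?_, ?_, ?_⟩, ?_⟩ <;> ring
  obtain ⟨⟨hab, hac, had⟩, ⟨hbc, hbd, hcd⟩, habcd⟩ := hnum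
  rw [← awNormalized_eq_awNormalized_zero (pow_ne_zero 2 hr) hr21 hr21
    ((norm_neg _).trans_lt hr21) hr1 ((norm_neg _).trans_lt hr1), awNormalized,
    awIntegral_half_period hr hr1, hab, hac, had, hbc, hbd, hcd, habcd,
    div_eq_div_iff (hne (by norm_num)) (hne two_ne_zero), hbase, hsix]
  linear_combination (2 * qPochInf (r ^ 3) (r ^ 2) * qPochInf (-r ^ 3) (r ^ 2) *
    qPochInf (r ^ 4) (r ^ 2) * qPochInf (-r ^ 4) (r ^ 2)) * heuler

theorem awIntegral_eq (hq : q ≠ 0) (hq1 : ‖q‖ < 1) {a b c d : ℂ} (ha : ‖a‖ < 1)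
    (hb : ‖b‖ < 1) (hc : ‖c‖ < 1) (hd : ‖d‖ < 1) :
    awIntegral q ![a, b, c, d] = 2 * qPochInf (a * b * c * d) q /
      (qPochInf q q * (qPochInf (a * b) q * qPochInf (a * c) q * qPochInf (a * d) q *
        qPochInf (b * c) q * qPochInf (b * d) q * qPochInf (c * d) q)) := by
  obtain ⟨r, rfl⟩ := IsAlgClosed.exists_pow_nat_eq q zero_lt_two
  have hr1 : ‖r‖ < 1 := by
    rw [norm_pow] at hq1
    exact (pow_lt_one_iff_of_nonneg (norm_nonneg r) two_ne_zero).1 hq1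
  have hconst := awNormalized_eq_awNormalized_zero hq hq1 ha hb hc hd
  rw [awNormalized_zero (pow_ne_zero_iff two_ne_zero |>.1 hq) hr1, awNormalized] at hconst
  have hne {x y : ℂ} (hx : ‖x‖ < 1) (hy : ‖y‖ < 1) : qPochInf (x * y) (r ^ 2) ≠ 0 :=
    qPochInf_ne_zero_of_norm_lt_one hq hq1 (norm_mul_lt_one hx hy)
  have habcd := hne (norm_mul_lt_one (norm_mul_lt_one ha hb) hc) hd
  have hbase := qPochInf_ne_zero_of_norm_lt_one hq hq1 hq1
  have hpairs := mul_ne_zero (mul_ne_zero (mul_ne_zero (mul_ne_zero (mul_ne_zero (hne ha hb)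
    (hne ha hc)) (hne ha hd)) (hne hb hc)) (hne hb hd)) (hne hc hd)
  rw [div_eq_div_iff habcd hbase] at hconst
  rw [eq_div_iff (mul_ne_zero hbase hpairs)]
  linear_combination hconst

end AskeyWilson

section NassrallahRahman

open Metric Real

theorem norm_update_lt_one {ι : Type*} [DecidableEq ι] {a : ι → ℂ} (ha : ∀ i, ‖a i‖ < 1) {x : ℂ}
    (hx : ‖x‖ < 1) (i j : ι) : ‖Function.update a i x j‖ < 1 := by
  rw [Function.update_apply]
  split_ifs
  exacts [hx, ha j]

variable {q : ℂ} {ι : Type*} [Fintype ι]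

/-- The weight `(z², z⁻², l z, l / z; q)_∞ / ∏ᵢ (aᵢ z, aᵢ / z; q)_∞`; five parameters give the
Nassrallah--Rahman weight. -/
def nrWeight (q l : ℂ) (a : ι → ℂ) (z : ℂ) : ℂ := qPochPM l q z * awWeight q a z

/-- The average of the Nassrallah--Rahman weight over the unit circle. -/
def nrIntegral (q l : ℂ) (a : ι → ℂ) : ℂ := circleAverage (nrWeight q l a) 0 1

theorem continuousOn_nrWeight (hq : q ≠ 0) (hq1 : ‖q‖ < 1) {X : Type*} [TopologicalSpace X]
    (l : ℂ) {a : X → ι → ℂ} {z : X → ℂ} {s : Set X} (ha : ∀ i, ContinuousOn (fun p => a p i) s)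
    (hz : ContinuousOn z s) (ha1 : ∀ p ∈ s, ∀ i, ‖a p i‖ < 1) (hz1 : ∀ p ∈ s, ‖z p‖ = 1) :
    ContinuousOn (fun p => nrWeight q l (a p) (z p)) s :=
  (continuousOn_qPochPM hq1 continuousOn_const hz fun p hp => ne_zero_of_norm_eq_one (hz1 p hp)).mul
    (continuousOn_awWeight hq hq1 ha hz ha1 hz1)

theorem circleIntegrable_nrWeight (hq : q ≠ 0) (hq1 : ‖q‖ < 1) (l : ℂ) {a : ι → ℂ}
    (ha : ∀ i, ‖a i‖ < 1) : CircleIntegrable (nrWeight q l a) 0 1 :=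
  ContinuousOn.circleIntegrable zero_le_one <| continuousOn_nrWeight hq hq1 l
    (fun _ => continuousOn_const) continuousOn_id (fun _ _ => ha)
    fun _ hz => mem_sphere_zero_iff_norm.1 hz

theorem differentiableOn_nrIntegral (hq : q ≠ 0) (hq1 : ‖q‖ < 1) (l : ℂ) {a : ℂ → ι → ℂ}
    {U : Set ℂ} (hU : IsOpen U) (ha : ∀ i, DifferentiableOn ℂ (fun s => a s i) U)
    (ha1 : ∀ s ∈ U, ∀ i, ‖a s i‖ < 1) :
    DifferentiableOn ℂ (fun s => nrIntegral q l (a s)) U := by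
  refine differentiableOn_circleAverage hU ?_ fun z hz =>
    (differentiableOn_awWeight hq hq1 ha ha1 (by simpa using hz)).const_mul _
  exact continuousOn_nrWeight hq hq1 l
    (fun i => (ha i).continuousOn.comp continuousOn_fst fun p hp => hp.1) continuousOn_snd
    (fun p hp => ha1 p.1 hp.1) fun p hp => by simpa using hp.2

/-- The coefficient of `(1 - c z) (1 - c / z)` in the expansion of `(1 - l z) (1 - l / z)` as a
combination of `(1 - c z) (1 - c / z)` and `(1 - d z) (1 - d / z)`. -/
def nrCoeff (l c d : ℂ) : ℂ := (1 - l * d) * (1 - l / d) / ((1 - c * d) * (1 - c / d))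

theorem one_sub_mul_mul_one_sub_div_eq (l : ℂ) {c d z : ℂ} (hc : c ≠ 0) (hd : d ≠ 0) (hcd : c ≠ d)
    (hcd1 : 1 - c * d ≠ 0) (hz : z ≠ 0) :
    (1 - l * z) * (1 - l / z) = nrCoeff l c d * ((1 - c * z) * (1 - c / z)) +
      nrCoeff l d c * ((1 - d * z) * (1 - d / z)) := by
  have hdc1 : 1 - d * c ≠ 0 := by rwa [mul_comm]
  have hsub : c - d ≠ 0 := sub_ne_zero.2 hcd
  rw [nrCoeff, nrCoeff, show 1 - c / d = -((c - d) / d) by field_simp; ring,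
    show 1 - d / c = (c - d) / c by field_simp]
  field_simp
  ring

variable [DecidableEq ι]

theorem nrWeight_contiguous (hq : q ≠ 0) (hq1 : ‖q‖ < 1) (l : ℂ) {a : ι → ℂ} {i j : ι}
    (hi : ‖a i‖ < 1) (hj : ‖a j‖ < 1) (hi0 : a i ≠ 0) (hj0 : a j ≠ 0) (hij : a i ≠ a j) {z : ℂ}
    (hz : ‖z‖ = 1) :
    nrWeight q l a z =
      nrCoeff l (a i) (a j) * nrWeight q (l * q) (Function.update a i (a i * q)) z +
        nrCoeff l (a j) (a i) * nrWeight q (l * q) (Function.update a j (a j * q)) z := by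
  have hexpand := one_sub_mul_mul_one_sub_div_eq l hi0 hj0 hij
    (one_sub_ne_zero_of_norm_lt_one (norm_mul_lt_one hi hj)) (ne_zero_of_norm_eq_one hz)
  simp only [nrWeight, awWeight_update_mul hq hq1 hi hz, awWeight_update_mul hq hq1 hj hz,
    qPochPM_eq_mul hq1 l]
  linear_combination qPochPM (l * q) q z * awWeight q a z * hexpand

theorem nrIntegral_contiguous (hq : q ≠ 0) (hq1 : ‖q‖ < 1) (l : ℂ) {a : ι → ℂ}
    (ha : ∀ i, ‖a i‖ < 1) {i j : ι} (hi0 : a i ≠ 0) (hj0 : a j ≠ 0) (hij : a i ≠ a j) :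
    nrIntegral q l a =
      nrCoeff l (a i) (a j) * nrIntegral q (l * q) (Function.update a i (a i * q)) +
        nrCoeff l (a j) (a i) * nrIntegral q (l * q) (Function.update a j (a j * q)) := by
  have hint (i : ι) : CircleIntegrable (nrWeight q (l * q) (Function.update a i (a i * q))) 0 1 :=
    circleIntegrable_nrWeight hq hq1 _ (norm_update_lt_one ha (norm_mul_lt_one (ha i) hq1) i)
  have hweight := circleAverage_congr_sphere (c := 0) (R := 1) (f₁ := nrWeight q l a)
    (f₂ := nrCoeff l (a i) (a j) • nrWeight q (l * q) (Function.update a i (a i * q)) +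
      nrCoeff l (a j) (a i) • nrWeight q (l * q) (Function.update a j (a j * q)))
    (fun z hz => nrWeight_contiguous hq hq1 l (ha i) (ha j) hi0 hj0 hij (by simpa using hz))
  rwa [circleAverage_add (hint i).const_smul (hint j).const_smul, circleAverage_smul,
    circleAverage_smul] at hweight

end NassrallahRahman

section NassrallahRahmanSeries

variable {q : ℂ}

/-- The terms of the very-well-poised series on the product side of the identity. -/
def rightTerm (q l : ℂ) (a : Fin 5 → ℂ) (n : ℕ) : ℂ :=
  vwpTerm (l ^ 2 / q) (fun i : Fin 4 => l / a i.castSucc) (fun i => l * a i) q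
    (∏ i : Fin 4, a i.castSucc) ((∏ i, a i) / l) n

/-- The product of `(aᵢ aⱼ; q)_∞` over all pairs `i < j`. -/
def pairProd (q : ℂ) (a : Fin 5 → ℂ) : ℂ := ∏ i, ∏ j ∈ Finset.Ioi i, qPochInf (a i * a j) q

/-- The product side of the identity, which also evaluates the Nassrallah--Rahman integral. -/
def rightSide (q l : ℂ) (a : Fin 5 → ℂ) : ℂ :=
  2 * ((∏ i, qPochInf (l * a i) q) * qPochInf ((∏ i, a i) / l) q) /
    (pairProd q a * qPochInf (l ^ 2) q) *
    ∑' n, rightTerm q l a n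

/-- The factor contributed by the parameter `x` to the `m`-th term of the series in `rightSide`,
multiplied by the infinite products. -/
def nrFactor (q l x : ℂ) (m : ℕ) : ℂ := qPochInf (l * x * q ^ m) q * qPoch (l / x) q m

/-- The terms of the series in `rightSide`, multiplied by the infinite products that depend
on `l`. -/
def nrTerm (q l : ℂ) (a : Fin 5 → ℂ) (m : ℕ) : ℂ :=
  (1 - l ^ 2 * q ^ (2 * m) / q) / (qPochInf (l ^ 2 * q ^ m / q) q * qPoch q q m) *
    (∏ i, nrFactor q l (a i) m) * ((∏ i, a i) / l) ^ m

theorem qPochInf_mul_pow (hq1 : ‖q‖ < 1) {x : ℂ} (hx : x ∉ Omega q) (m : ℕ) :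
    qPochInf (x * q ^ m) q = qPochInf x q / qPoch x q m := by
  rw [qPochInf_eq_qPoch_mul hq1 x m, mul_div_cancel_left₀ _ (qPoch_ne_zero hx m)]

theorem prod_range_sub_mul_pow {e t y : ℂ} (hy : y = t * e) (m : ℕ) :
    ∏ j ∈ Finset.range m, (t - y * q ^ j) = qPoch e q m * t ^ m := by
  calc ∏ j ∈ Finset.range m, (t - y * q ^ j)
      = ∏ j ∈ Finset.range m, (1 - e * q ^ j) * t :=
        Finset.prod_congr rfl fun j _ => by rw [hy]; ring
    _ = qPoch e q m * t ^ m := by rw [← Finset.prod_mul_pow_card, Finset.card_range, qPoch]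

theorem prod_castSucc_eq {l : ℂ} (hl : l ≠ 0) {a : Fin 5 → ℂ} (ha : a 4 ≠ 0) :
    ∏ i : Fin 4, a i.castSucc = (∏ i, a i) / l * (l / a 4) := by
  rw [Fin.prod_univ_castSucc a, show Fin.last 4 = 4 from rfl]
  field_simp

theorem nrTerm_eq (hq : q ≠ 0) (hq1 : ‖q‖ < 1) {l : ℂ} (hl : l ≠ 0) {a : Fin 5 → ℂ}
    (ha : a 4 ≠ 0) (hlq : l ^ 2 / q ∉ Omega q) (hla : ∀ i, l * a i ∉ Omega q) (m : ℕ) :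
    nrTerm q l a m =
      (∏ i, qPochInf (l * a i) q) / qPochInf (l ^ 2) q * rightTerm q l a m := by
  have hbase : (1 - l ^ 2 / q * q ^ (2 * m)) / qPochInf (l ^ 2 / q * q ^ m) q =
      (1 - l ^ 2 / q * q ^ (2 * m)) / (1 - l ^ 2 / q) * qPoch (l ^ 2 / q) q m /
        qPochInf (l ^ 2) q := by
    rw [qPochInf_mul_pow hq1 hlq, qPochInf_eq_mul hq1 (l ^ 2 / q), div_mul_cancel₀ _ hq]
    simp only [div_eq_mul_inv, mul_inv, inv_inv]
    ring
  have hnum := prod_range_sub_mul_pow (q := q) (prod_castSucc_eq hl ha) m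
  simp only [nrTerm, nrFactor, rightTerm, vwpTerm, Finset.prod_mul_distrib, hnum,
    Fin.prod_univ_castSucc fun i => qPoch (l / a i) q m, fun i => qPochInf_mul_pow hq1 (hla i) m,
    Finset.prod_div_distrib, ← div_div, mul_div_right_comm (l ^ 2), hbase, Fin.reduceLast]
  ring

theorem rightSide_eq_tsum_nrTerm (hq : q ≠ 0) (hq1 : ‖q‖ < 1) {l : ℂ} (hl : l ≠ 0)
    {a : Fin 5 → ℂ} (ha : a 4 ≠ 0) (hlq : l ^ 2 / q ∉ Omega q) (hla : ∀ i, l * a i ∉ Omega q) :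
    rightSide q l a =
      2 * qPochInf ((∏ i, a i) / l) q / pairProd q a * ∑' m, nrTerm q l a m := by
  simp only [nrTerm_eq hq hq1 hl ha hlq hla, tsum_mul_left, rightSide]
  ring

theorem summable_nrTerm (hq : q ≠ 0) (hq1 : ‖q‖ < 1) {l : ℂ} (hl : l ≠ 0) {a : Fin 5 → ℂ}
    (ha : a 4 ≠ 0) (hlq : l ^ 2 / q ∉ Omega q) (hla : ∀ i, l * a i ∉ Omega q)
    (ht : ‖(∏ i, a i) / l‖ < 1) : Summable (nrTerm q l a) :=
  ((summable_vwpTerm hq1 (fun n => one_sub_mul_pow_ne_zero hlq (2 * n)) _ _ _ ht).mul_left _).congr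
    fun m => (nrTerm_eq hq hq1 hl ha hlq hla m).symm

theorem nrFactor_succ_mul (hq1 : ‖q‖ < 1) (l x : ℂ) (m : ℕ) :
    (1 - l * x * q ^ m) * nrFactor q l x (m + 1) = (1 - l / x * q ^ m) * nrFactor q l x m := by
  rw [nrFactor, nrFactor, qPochInf_eq_mul hq1 (l * x * q ^ m), qPoch_succ, pow_succ,
    ← mul_assoc (l * x)]
  ring

theorem nrFactor_succ (q l x : ℂ) (m : ℕ) :
    nrFactor q l x (m + 1) = (1 - l / x) * nrFactor q (l * q) x m := by
  rw [nrFactor, nrFactor, qPoch_succ', pow_succ', mul_right_comm l q x, mul_assoc (l * x) q,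
    div_mul_eq_mul_div]
  ring

theorem nrFactor_succ_eq_mul (hq : q ≠ 0) (hq1 : ‖q‖ < 1) (l x : ℂ) (m : ℕ) :
    nrFactor q l x (m + 1) =
      (1 - l * x * q ^ (m + 1)) * (1 - l * q ^ m / x) * nrFactor q (l * q) (x * q) m := by
  rw [nrFactor, nrFactor, qPochInf_eq_mul hq1 (l * x * q ^ (m + 1)), qPoch_succ,
    mul_div_mul_right _ _ hq, div_mul_eq_mul_div,
    show l * q * (x * q) * q ^ m = l * x * q ^ (m + 1) * q by ring]
  ring

/-- The common part of the terms `nrTerm q l ![a, b, c, d, e] (m + 1)`,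
`nrTerm q (l * q) ![a, b, c * q, d, e] m` and `nrTerm q (l * q) ![a, b, c, d * q, e] m`. -/
def nrCore (q l a b c d e : ℂ) (m : ℕ) : ℂ :=
  (nrFactor q (l * q) a m * nrFactor q (l * q) b m * nrFactor q (l * q) e m *
      (nrFactor q (l * q) (c * q) m * nrFactor q (l * q) (d * q) m)) /
    (qPochInf (l ^ 2 * q ^ (m + 1)) q * qPoch q q m) * (a * b * c * d * e / l) ^ m

/-- The Gosper certificate of the contiguous relation for the series `∑ nrTerm`. -/
def nrCert (q l a b c d e : ℂ) (m : ℕ) : ℂ :=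
  (1 - l * c) * (1 - l * d) / (1 - l ^ 2 * q ^ m) *
    ((1 - l * a * q ^ m) * (1 - l * b * q ^ m) * (1 - l * e * q ^ m)) *
    ((1 - l * c * q ^ (m + 1)) * (1 - l * d * q ^ (m + 1))) * nrCore q l a b c d e m

theorem nrTerm_succ (hq : q ≠ 0) (hq1 : ‖q‖ < 1) (l a b c d e : ℂ) (m : ℕ) :
    nrTerm q l ![a, b, c, d, e] (m + 1) =
      a * b * c * d * e / l * (1 - l ^ 2 * q ^ m * q ^ (m + 1)) /
        ((1 - l ^ 2 * q ^ m) * (1 - q ^ (m + 1))) *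
      ((1 - l / a) * (1 - l / b) * (1 - l / e)) *
      ((1 - l * c * q ^ (m + 1)) * (1 - l * q ^ m / c) *
        ((1 - l * d * q ^ (m + 1)) * (1 - l * q ^ m / d))) * nrCore q l a b c d e m := by
  have hbase : qPochInf (l ^ 2 * q ^ (m + 1) / q) q =
      (1 - l ^ 2 * q ^ m) * qPochInf (l ^ 2 * q ^ (m + 1)) q := by
    rw [pow_succ q, ← mul_assoc, mul_div_cancel_right₀ _ hq, qPochInf_eq_mul hq1, mul_assoc]
  have hpow : l ^ 2 * q ^ (2 * (m + 1)) / q = l ^ 2 * q ^ m * q ^ (m + 1) := by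
    field_simp
    ring
  simp only [nrTerm, nrCore, Fin.prod_univ_five, Matrix.cons_val, nrFactor_succ q l a,
    nrFactor_succ q l b, nrFactor_succ q l e, nrFactor_succ_eq_mul hq hq1 l c,
    nrFactor_succ_eq_mul hq hq1 l d, hbase, hpow, qPoch_succ, ← pow_succ' q]
  simp only [div_eq_mul_inv, mul_inv]
  ring

theorem nrTerm_update_two (hq : q ≠ 0) (hq1 : ‖q‖ < 1) (l a b c d e : ℂ) (m : ℕ) :
    (1 - l / d) * nrTerm q (l * q) ![a, b, c * q, d, e] m =
      (1 - l ^ 2 * q ^ m * q ^ (m + 1)) * ((1 - l * d * q ^ (m + 1)) * (1 - l * q ^ m / d)) *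
        nrCore q l a b c d e m := by
  have hbase : (l * q) ^ 2 * q ^ m / q = l ^ 2 * q ^ (m + 1) := by
    field_simp
    ring
  have hpow : (l * q) ^ 2 * q ^ (2 * m) / q = l ^ 2 * q ^ m * q ^ (m + 1) := by
    field_simp
    ring
  have ht : a * b * (c * q) * d * e / (l * q) = a * b * c * d * e / l := by
    rw [← mul_div_mul_right _ l hq]
    ring
  have hd := (nrFactor_succ q l d m).symm.trans (nrFactor_succ_eq_mul hq hq1 l d m)
  simp only [nrTerm, nrCore, Fin.prod_univ_five, Matrix.cons_val, hbase, hpow, ht]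
  linear_combination (1 - l ^ 2 * q ^ m * q ^ (m + 1)) /
    (qPochInf (l ^ 2 * q ^ (m + 1)) q * qPoch q q m) * (nrFactor q (l * q) a m *
    nrFactor q (l * q) b m * nrFactor q (l * q) (c * q) m * nrFactor q (l * q) e m) *
    (a * b * c * d * e / l) ^ m * hd

theorem nrTerm_swap (q l a b c d e : ℂ) (m : ℕ) :
    nrTerm q l ![a, b, c, d, e] m = nrTerm q l ![a, b, d, c, e] m := by
  simp only [nrTerm, Fin.prod_univ_five, Matrix.cons_val, mul_right_comm _ c d,
    mul_right_comm _ (nrFactor q l c m)]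

theorem nrCore_swap (q l a b c d e : ℂ) (m : ℕ) :
    nrCore q l a b c d e m = nrCore q l a b d c e m := by
  rw [nrCore, nrCore, mul_right_comm _ c d, mul_comm (nrFactor q (l * q) (c * q) m)]

theorem nrCert_succ (hq : q ≠ 0) (hq1 : ‖q‖ < 1) (l a b c d e : ℂ) (m : ℕ) :
    nrCert q l a b c d e (m + 1) =
      a * b * c * d * e / l * ((1 - l * c) * (1 - l * d)) / (1 - q ^ (m + 1)) *
        ((1 - l * q ^ (m + 1) / a) * (1 - l * q ^ (m + 1) / b) * (1 - l * q ^ (m + 1) / e)) *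
        ((1 - l * q ^ m / c) * (1 - l * q ^ m / d)) * nrCore q l a b c d e m := by
  have hfactor (x : ℂ) : (1 - l * x * q ^ (m + 1)) * nrFactor q (l * q) x (m + 1) =
      (1 - l * q ^ (m + 1) / x) * nrFactor q (l * q) x m := by
    linear_combination nrFactor_succ_mul hq1 (l * q) x m
  have hfactor_mul (x : ℂ) :
      (1 - l * x * q ^ (m + 1 + 1)) * nrFactor q (l * q) (x * q) (m + 1) =
        (1 - l * q ^ m / x) * nrFactor q (l * q) (x * q) m := by
    have := nrFactor_succ_mul hq1 (l * q) (x * q) m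
    rw [mul_div_mul_right _ _ hq] at this
    linear_combination this
  have hbase : (1 - l ^ 2 * q ^ (m + 1)) * qPochInf (l ^ 2 * q ^ (m + 1 + 1)) q =
      qPochInf (l ^ 2 * q ^ (m + 1)) q := by
    rw [qPochInf_eq_mul hq1 (l ^ 2 * q ^ (m + 1)), pow_succ _ (m + 1), mul_assoc (l ^ 2)]
  calc nrCert q l a b c d e (m + 1)
    _ = (1 - l * c) * (1 - l * d) * (a * b * c * d * e / l) ^ (m + 1) *
          (((1 - l * a * q ^ (m + 1)) * nrFactor q (l * q) a (m + 1)) *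
          ((1 - l * b * q ^ (m + 1)) * nrFactor q (l * q) b (m + 1)) *
          ((1 - l * e * q ^ (m + 1)) * nrFactor q (l * q) e (m + 1)) *
          (((1 - l * c * q ^ (m + 1 + 1)) * nrFactor q (l * q) (c * q) (m + 1)) *
          ((1 - l * d * q ^ (m + 1 + 1)) * nrFactor q (l * q) (d * q) (m + 1)))) /
        (((1 - l ^ 2 * q ^ (m + 1)) * qPochInf (l ^ 2 * q ^ (m + 1 + 1)) q) *
          (qPoch q q m * (1 - q ^ (m + 1)))) := by
      rw [nrCert, nrCore, qPoch_succ, ← pow_succ' q m]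
      simp only [div_eq_mul_inv, mul_inv]
      ring
    _ = _ := by
      simp only [hfactor, hfactor_mul, hbase, nrCore, div_eq_mul_inv, mul_inv]
      ring

theorem nrCert_zero (hq : q ≠ 0) (hq1 : ‖q‖ < 1) {l : ℂ} (hl : 1 - l ^ 2 / q ≠ 0)
    (a b c d e : ℂ) : nrCert q l a b c d e 0 = nrTerm q l ![a, b, c, d, e] 0 := by
  have hbase : (1 - l ^ 2 / q) / qPochInf (l ^ 2 / q) q =
      1 / ((1 - l ^ 2) * qPochInf (l ^ 2 * q) q) := by
    rw [qPochInf_eq_mul hq1 (l ^ 2 / q), div_mul_cancel₀ _ hq, qPochInf_eq_mul hq1 (l ^ 2),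
      div_mul_cancel_left₀ hl, one_div]
  have hfactor (x : ℂ) : qPochInf (l * x) q = (1 - l * x) * qPochInf (l * q * x) q := by
    rw [qPochInf_eq_mul hq1, mul_right_comm l]
  have hfactor_mul (x : ℂ) :
      qPochInf (l * x) q = (1 - l * x) * ((1 - l * x * q) * qPochInf (l * q * (x * q)) q) := by
    rw [hfactor, qPochInf_eq_mul hq1 (l * q * x), mul_right_comm l q x, mul_mul_mul_comm l q x q,
      mul_assoc (l * x)]
  simp only [nrCert, nrCore, nrTerm, nrFactor, Fin.prod_univ_five, Matrix.cons_val, qPoch_zero,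
    pow_zero, mul_one, mul_zero, zero_add, pow_one, hbase, hfactor a, hfactor b, hfactor e,
    hfactor_mul c, hfactor_mul d]
  simp only [div_eq_mul_inv, mul_inv]
  ring

theorem contiguous_certificate {l a b c d e x y : ℂ} (hl : l ≠ 0) (ha : a ≠ 0) (hb : b ≠ 0)
    (hc : c ≠ 0) (hd : d ≠ 0) (he : e ≠ 0) (hcd : c ≠ d) (hcd1 : 1 - c * d ≠ 0)
    (hx : 1 - l ^ 2 * x ≠ 0) (hy : 1 - y ≠ 0) :
    a * b * c * d * e / l * (1 - l ^ 2 * x * y) / ((1 - l ^ 2 * x) * (1 - y)) *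
        ((1 - l / a) * (1 - l / b) * (1 - l / e)) *
        ((1 - l * c * y) * (1 - l * x / c) * ((1 - l * d * y) * (1 - l * x / d))) +
      (1 - l * c) * (1 - l * d) / (1 - l ^ 2 * x) *
        ((1 - l * a * x) * (1 - l * b * x) * (1 - l * e * x)) *
        ((1 - l * c * y) * (1 - l * d * y)) =
    (1 - l * d) / ((1 - c * d) * (1 - c / d)) *
        ((1 - c * a) * (1 - c * b) * (1 - c * d) * (1 - c * e)) *
        ((1 - l ^ 2 * x * y) * ((1 - l * d * y) * (1 - l * x / d))) +
      (1 - l * c) / ((1 - d * c) * (1 - d / c)) *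
        ((1 - d * a) * (1 - d * b) * (1 - d * c) * (1 - d * e)) *
        ((1 - l ^ 2 * x * y) * ((1 - l * c * y) * (1 - l * x / c))) +
      a * b * c * d * e / l * ((1 - l * c) * (1 - l * d)) / (1 - y) *
        ((1 - l * y / a) * (1 - l * y / b) * (1 - l * y / e)) *
        ((1 - l * x / c) * (1 - l * x / d)) := by
  have hsub : c - d ≠ 0 := sub_ne_zero.2 hcd
  rw [show 1 - c / d = -((c - d) / d) by field_simp; ring,
    show 1 - d / c = (c - d) / c by field_simp]
  field_simp
  ring

theorem nrTerm_contiguous (hq : q ≠ 0) (hq1 : ‖q‖ < 1) {l a b c d e : ℂ} (hl : l ≠ 0)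
    (ha : a ≠ 0) (hb : b ≠ 0) (hc : c ≠ 0) (hd : d ≠ 0) (he : e ≠ 0) (hcd : c ≠ d)
    (hcd1 : 1 - c * d ≠ 0) (hlΩ : l ^ 2 ∉ Omega q) (m : ℕ) :
    nrTerm q l ![a, b, c, d, e] (m + 1) =
      nrCoeff l c d * ((1 - c * a) * (1 - c * b) * (1 - c * d) * (1 - c * e)) *
          nrTerm q (l * q) ![a, b, c * q, d, e] m +
        nrCoeff l d c * ((1 - d * a) * (1 - d * b) * (1 - d * c) * (1 - d * e)) *
          nrTerm q (l * q) ![a, b, c, d * q, e] m +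
        (nrCert q l a b c d e (m + 1) - nrCert q l a b c d e m) := by
  have hy : 1 - q ^ (m + 1) ≠ 0 := by
    rw [pow_succ']
    exact one_sub_mul_pow_ne_zero (notMem_Omega_of_norm_lt_one hq hq1 hq1) m
  have hcert := contiguous_certificate hl ha hb hc hd he hcd hcd1
    (one_sub_mul_pow_ne_zero hlΩ m) hy
  have hc_term := nrTerm_update_two hq hq1 l a b c d e m
  have hd_term := nrTerm_update_two hq hq1 l a b d c e m
  rw [← nrCore_swap, ← nrTerm_swap] at hd_term
  rw [nrTerm_succ hq hq1, nrCert_succ hq hq1, nrCert, nrCoeff, nrCoeff]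
  linear_combination nrCore q l a b c d e m * hcert -
    (1 - l * d) / ((1 - c * d) * (1 - c / d)) *
      ((1 - c * a) * (1 - c * b) * (1 - c * d) * (1 - c * e)) * hc_term -
    (1 - l * c) / ((1 - d * c) * (1 - d / c)) *
      ((1 - d * a) * (1 - d * b) * (1 - d * c) * (1 - d * e)) * hd_term

theorem tendsto_qPoch (hq1 : ‖q‖ < 1) (x : ℂ) :
    Tendsto (qPoch x q) atTop (𝓝 (qPochInf x q)) :=
  (multipliable_one_sub_mul_pow hq1 x).hasProd.tendsto_prod_nat

theorem tendsto_qPochInf_mul_pow (hq1 : ‖q‖ < 1) (x : ℂ) :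
    Tendsto (fun m : ℕ => qPochInf (x * q ^ m) q) atTop (𝓝 1) := by
  have hcont : Continuous fun y => qPochInf (x * y) q := by fun_prop (disch := assumption)
  simpa [Function.comp_def, qPochInf_zero] using
    (hcont.tendsto 0).comp (tendsto_pow_atTop_nhds_zero_of_norm_lt_one hq1)

theorem tendsto_nrFactor (hq1 : ‖q‖ < 1) (l x : ℂ) :
    Tendsto (nrFactor q l x) atTop (𝓝 (qPochInf (l / x) q)) := by
  unfold nrFactor
  simpa using (tendsto_qPochInf_mul_pow hq1 (l * x)).mul (tendsto_qPoch hq1 (l / x))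

theorem tendsto_nrCore (hq : q ≠ 0) (hq1 : ‖q‖ < 1) {l a b c d e : ℂ}
    (ht : ‖a * b * c * d * e / l‖ < 1) : Tendsto (nrCore q l a b c d e) atTop (𝓝 0) := by
  have hf (x : ℂ) := tendsto_nrFactor hq1 (l * q) x
  have hden := ((tendsto_qPochInf_mul_pow hq1 (l ^ 2)).comp (tendsto_add_atTop_nat 1)).mul
    (tendsto_qPoch hq1 q)
  have hden0 : 1 * qPochInf q q ≠ 0 := by
    simpa using qPochInf_ne_zero_of_norm_lt_one hq hq1 hq1
  unfold nrCore
  simpa using ((((hf a).mul (hf b)).mul (hf e)).mul ((hf (c * q)).mul (hf (d * q)))).div hden hden0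
    |>.mul (tendsto_pow_atTop_nhds_zero_of_norm_lt_one ht)

theorem tendsto_nrCert (hq : q ≠ 0) (hq1 : ‖q‖ < 1) {l a b c d e : ℂ}
    (ht : ‖a * b * c * d * e / l‖ < 1) : Tendsto (nrCert q l a b c d e) atTop (𝓝 0) := by
  have hcont : ContinuousAt (fun x => (1 - l * c) * (1 - l * d) / (1 - l ^ 2 * x) *
      ((1 - l * a * x) * (1 - l * b * x) * (1 - l * e * x)) *
      ((1 - l * c * (x * q)) * (1 - l * d * (x * q)))) 0 := by
    fun_prop (disch := simp)
  unfold nrCert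
  simpa [Function.comp_def, ← pow_succ] using
    (hcont.tendsto.comp (tendsto_pow_atTop_nhds_zero_of_norm_lt_one hq1)).mul
      (tendsto_nrCore hq hq1 ht)

theorem mul_notMem_Omega (hq : q ≠ 0) {x : ℂ} (hx : x ∉ Omega q) : x * q ∉ Omega q := by
  rintro ⟨k, hk⟩
  exact hx ⟨k + 1, by rw [pow_succ, mul_inv, ← hk, mul_inv_cancel_right₀ hq]⟩

theorem mul_sq_div_notMem_Omega (hq : q ≠ 0) {l : ℂ} (hl : l ^ 2 / q ∉ Omega q) :
    (l * q) ^ 2 / q ∉ Omega q := by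
  rw [mul_pow, sq q, ← mul_assoc, mul_div_right_comm, mul_div_right_comm]
  exact mul_notMem_Omega hq (mul_notMem_Omega hq hl)

theorem update_mul_notMem_Omega {ι : Type*} [DecidableEq ι] (hq : q ≠ 0) {l : ℂ} {a : ι → ℂ}
    (ha : ∀ i, l * a i ∉ Omega q) (i j : ι) :
    l * q * Function.update a i (a i * q) j ∉ Omega q := by
  rw [Function.update_apply, mul_right_comm]
  split_ifs
  · rw [← mul_assoc]
    exact mul_notMem_Omega hq (mul_notMem_Omega hq (ha i))
  · exact mul_notMem_Omega hq (ha j)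

theorem update_mul_ne_zero {ι : Type*} [DecidableEq ι] (hq : q ≠ 0) {a : ι → ℂ}
    (ha : ∀ i, a i ≠ 0) (i j : ι) : Function.update a i (a i * q) j ≠ 0 := by
  rw [Function.update_apply]
  split_ifs
  exacts [mul_ne_zero (ha i) hq, ha j]

theorem prod_update_mul {ι : Type*} [Fintype ι] [DecidableEq ι] (a : ι → ℂ) (i : ι) (x : ℂ) :
    ∏ j, Function.update a i (a i * x) j = (∏ j, a j) * x := by
  rw [Finset.prod_update_of_mem (Finset.mem_univ i), mul_right_comm,
    Finset.sdiff_singleton_eq_erase, Finset.mul_prod_erase _ _ (Finset.mem_univ i)]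

theorem prod_Ioi_fin_five {M : Type*} [CommMonoid M] (f : Fin 5 → Fin 5 → M) :
    ∏ i, ∏ j ∈ Finset.Ioi i, f i j =
      f 0 1 * f 0 2 * f 0 3 * f 0 4 * (f 1 2 * f 1 3 * f 1 4) * (f 2 3 * f 2 4) * f 3 4 := by
  rw [Fin.prod_univ_five, show Finset.Ioi (0 : Fin 5) = {1, 2, 3, 4} by decide,
    show Finset.Ioi (1 : Fin 5) = {2, 3, 4} by decide,
    show Finset.Ioi (2 : Fin 5) = {3, 4} by decide, show Finset.Ioi (3 : Fin 5) = {4} by decide,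
    show Finset.Ioi (4 : Fin 5) = ∅ by decide]
  simp [mul_assoc]

theorem pairProd_ne_zero (hq1 : ‖q‖ < 1) {a : Fin 5 → ℂ} (ha : ∀ i j, i ≠ j → a i * a j ∉ Omega q) :
    pairProd q a ≠ 0 :=
  Finset.prod_ne_zero_iff.2 fun i _ => Finset.prod_ne_zero_iff.2 fun j hj =>
    qPochInf_ne_zero hq1 (ha i j (Finset.mem_Ioi.1 hj).ne)

theorem pairProd_update_mul (hq1 : ‖q‖ < 1) (a : Fin 5 → ℂ) (i : Fin 5) :
    pairProd q a =
      (∏ j with j ≠ i, (1 - a i * a j)) * pairProd q (Function.update a i (a i * q)) := by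
  have hleft (x y : ℂ) : qPochInf (x * y) q = (1 - x * y) * qPochInf (x * q * y) q := by
    rw [qPochInf_eq_mul hq1, mul_right_comm]
  have hright (x y : ℂ) : qPochInf (x * y) q = (1 - y * x) * qPochInf (x * (y * q)) q := by
    rw [qPochInf_eq_mul hq1, mul_comm y x, mul_assoc]
  rw [pairProd, pairProd, prod_Ioi_fin_five, prod_Ioi_fin_five, Finset.prod_filter,
    Fin.prod_univ_five]
  fin_cases i
  · simp [hleft (a 0)]
    ring
  · simp [hleft (a 1), hright _ (a 1)]
    ring
  · simp [hleft (a 2), hright _ (a 2)]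
    ring
  · simp [hleft (a 3), hright _ (a 3)]
    ring
  · simp [hright _ (a 4)]
    ring

theorem nrTerm_succ_eq_update (hq : q ≠ 0) (hq1 : ‖q‖ < 1) {l : ℂ} {a : Fin 5 → ℂ}
    (hl : l ≠ 0) (ha : ∀ i, a i ≠ 0) (ha23 : a 2 ≠ a 3) (ha23' : 1 - a 2 * a 3 ≠ 0)
    (hlΩ : l ^ 2 ∉ Omega q) (m : ℕ) :
    nrTerm q l a (m + 1) =
      nrCoeff l (a 2) (a 3) * (∏ j with j ≠ 2, (1 - a 2 * a j)) *
          nrTerm q (l * q) (Function.update a 2 (a 2 * q)) m +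
        nrCoeff l (a 3) (a 2) * (∏ j with j ≠ 3, (1 - a 3 * a j)) *
          nrTerm q (l * q) (Function.update a 3 (a 3 * q)) m +
        (nrCert q l (a 0) (a 1) (a 2) (a 3) (a 4) (m + 1) -
          nrCert q l (a 0) (a 1) (a 2) (a 3) (a 4) m) := by
  have hcontiguous := nrTerm_contiguous hq hq1 hl (ha 0) (ha 1) (ha 2) (ha 3) (ha 4) ha23 ha23'
    hlΩ m
  have ha_eta : ![a 0, a 1, a 2, a 3, a 4] = a := by ext i; fin_cases i <;> rfl
  have hupdate_two : ![a 0, a 1, a 2 * q, a 3, a 4] = Function.update a 2 (a 2 * q) := by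
    ext i; fin_cases i <;> rfl
  have hupdate_three : ![a 0, a 1, a 2, a 3 * q, a 4] = Function.update a 3 (a 3 * q) := by
    ext i; fin_cases i <;> rfl
  rw [ha_eta, hupdate_two, hupdate_three] at hcontiguous
  simpa [Finset.prod_filter, Fin.prod_univ_five] using hcontiguous

theorem summable_nrTerm_update (hq : q ≠ 0) (hq1 : ‖q‖ < 1) {l : ℂ} {a : Fin 5 → ℂ} (hl : l ≠ 0)
    (ha : ∀ i, a i ≠ 0) (hlq : l ^ 2 / q ∉ Omega q) (hla : ∀ i, l * a i ∉ Omega q)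
    (ht : ‖(∏ i, a i) / l‖ < 1) (i : Fin 5) :
    Summable (nrTerm q (l * q) (Function.update a i (a i * q))) := by
  refine summable_nrTerm hq hq1 (mul_ne_zero hl hq) (update_mul_ne_zero hq ha i 4)
    (mul_sq_div_notMem_Omega hq hlq) (update_mul_notMem_Omega hq hla i) ?_
  rwa [prod_update_mul, mul_div_mul_right _ _ hq]

theorem tsum_nrTerm_contiguous (hq : q ≠ 0) (hq1 : ‖q‖ < 1) {l : ℂ} {a : Fin 5 → ℂ} (hl : l ≠ 0)
    (ha : ∀ i, a i ≠ 0) (ha23 : a 2 ≠ a 3) (ha23' : 1 - a 2 * a 3 ≠ 0) (hlq : l ^ 2 / q ∉ Omega q)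
    (hla : ∀ i, l * a i ∉ Omega q) (ht : ‖(∏ i, a i) / l‖ < 1) :
    ∑' m, nrTerm q l a m =
      nrCoeff l (a 2) (a 3) * (∏ j with j ≠ 2, (1 - a 2 * a j)) *
          ∑' m, nrTerm q (l * q) (Function.update a 2 (a 2 * q)) m +
        nrCoeff l (a 3) (a 2) * (∏ j with j ≠ 3, (1 - a 3 * a j)) *
          ∑' m, nrTerm q (l * q) (Function.update a 3 (a 3 * q)) m := by
  set cert := nrCert q l (a 0) (a 1) (a 2) (a 3) (a 4) with hcert
  have hlΩ : l ^ 2 ∉ Omega q := by simpa [hq] using mul_notMem_Omega hq hlq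
  have hstep := nrTerm_succ_eq_update hq hq1 hl ha ha23 ha23' hlΩ
  have hsum := summable_nrTerm hq hq1 hl (ha 4) hlq hla ht
  have hsum_update (i : Fin 5) (c : ℂ) :=
    (summable_nrTerm_update hq hq1 hl ha hlq hla ht i).mul_left c
  have hcert_sum : HasSum (fun m => cert (m + 1) - cert m) (0 - cert 0) := by
    refine (Summable.hasSum_iff_tendsto_nat ?_).2 ?_
    · exact (((summable_nat_add_iff 1).2 hsum).sub ((hsum_update 2 _).add (hsum_update 3 _))).congr
        fun m => sub_eq_of_eq_add' (hstep m)
    · simp only [Finset.sum_range_sub]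
      refine (tendsto_nrCert hq hq1 ?_).sub_const _
      simpa only [Fin.prod_univ_five] using ht
  have hzero : nrTerm q l a 0 = cert 0 := by
    rw [hcert, nrCert_zero hq hq1 (by simpa using one_sub_mul_pow_ne_zero hlq 0)]
    congr 1
    ext i
    fin_cases i <;> rfl
  rw [hsum.tsum_eq_zero_add, tsum_congr hstep,
    ((hsum_update 2 _).add (hsum_update 3 _)).tsum_add hcert_sum.summable, hcert_sum.tsum_eq,
    hzero, (hsum_update 2 _).tsum_add (hsum_update 3 _), tsum_mul_left, tsum_mul_left]
  ring

theorem rightSide_contiguous (hq : q ≠ 0) (hq1 : ‖q‖ < 1) {l : ℂ} {a : Fin 5 → ℂ} (hl : l ≠ 0)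
    (ha : ∀ i, a i ≠ 0) (ha23 : a 2 ≠ a 3) (hlq : l ^ 2 / q ∉ Omega q)
    (hla : ∀ i, l * a i ∉ Omega q) (hpair : ∀ i j, i ≠ j → a i * a j ∉ Omega q)
    (ht : ‖(∏ i, a i) / l‖ < 1) :
    rightSide q l a =
      nrCoeff l (a 2) (a 3) * rightSide q (l * q) (Function.update a 2 (a 2 * q)) +
        nrCoeff l (a 3) (a 2) * rightSide q (l * q) (Function.update a 3 (a 3 * q)) := by
  have hupdate (i : Fin 5) := rightSide_eq_tsum_nrTerm hq hq1 (mul_ne_zero hl hq)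
    (update_mul_ne_zero hq ha i 4) (mul_sq_div_notMem_Omega hq hlq)
    (update_mul_notMem_Omega hq hla i)
  have hpairProd (i : Fin 5) : (∏ j with j ≠ i, (1 - a i * a j)) / pairProd q a =
      1 / pairProd q (Function.update a i (a i * q)) := by
    have hne := pairProd_ne_zero hq1 hpair
    rw [pairProd_update_mul hq1 a i] at hne ⊢
    rw [div_mul_cancel_left₀ (left_ne_zero_of_mul hne), one_div]
  have ha23' : 1 - a 2 * a 3 ≠ 0 := by
    simpa using one_sub_mul_pow_ne_zero (hpair 2 3 (by decide)) 0
  rw [rightSide_eq_tsum_nrTerm hq hq1 hl (ha 4) hlq hla, hupdate, hupdate, prod_update_mul,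
    prod_update_mul, mul_div_mul_right _ _ hq,
    tsum_nrTerm_contiguous hq hq1 hl ha ha23 ha23' hlq hla ht]
  linear_combination 2 * qPochInf ((∏ i, a i) / l) q *
    (nrCoeff l (a 2) (a 3) * (∑' m, nrTerm q (l * q) (Function.update a 2 (a 2 * q)) m) *
      hpairProd 2 + nrCoeff l (a 3) (a 2) *
      (∑' m, nrTerm q (l * q) (Function.update a 3 (a 3 * q)) m) * hpairProd 3)

end NassrallahRahmanSeries

section NassrallahRahmanEvaluation

open Metric Real

variable {q : ℂ}

theorem norm_lt_one_of_norm_sq_div_lt_one (hq : q ≠ 0) (hq1 : ‖q‖ < 1) {l : ℂ}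
    (hlq : ‖l ^ 2 / q‖ < 1) : ‖l‖ < 1 := by
  rw [norm_div, div_lt_one (norm_pos_iff.2 hq), norm_pow] at hlq
  exact (pow_lt_one_iff_of_nonneg (norm_nonneg l) two_ne_zero).1 (hlq.trans hq1)

theorem norm_mul_sq_div_lt_one (hq1 : ‖q‖ < 1) {l : ℂ} (hlq : ‖l ^ 2 / q‖ < 1) :
    ‖(l * q) ^ 2 / q‖ < 1 := by
  rw [show (l * q) ^ 2 / q = (l ^ 2 / q) * (q * q) by ring]
  exact norm_mul_lt_one hlq (norm_mul_lt_one hq1 hq1)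

theorem nrIntegral_eq_awIntegral (hq : q ≠ 0) (hq1 : ‖q‖ < 1) {l : ℂ} {a : Fin 5 → ℂ}
    (hl : ‖l‖ < 1) (ha : a 4 = l) :
    nrIntegral q l a = awIntegral q ![a 0, a 1, a 2, a 3] := by
  refine circleAverage_congr_sphere fun z hz => ?_
  have hl0 := qPochPM_ne_zero hq hq1 (z := z) hl (by simpa using hz)
  simp only [nrWeight, awWeight, Fin.prod_univ_five, Fin.prod_univ_four, Matrix.cons_val, ha]
  field_simp

theorem tsum_rightTerm_of_eq {l : ℂ} {a : Fin 5 → ℂ} (hl : l ≠ 0) (hlq : 1 - l ^ 2 / q ≠ 0)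
    (ha : a 4 = l) : ∑' n, rightTerm q l a n = 1 := by
  have harg : (∏ i, a i) / l = ∏ i : Fin 4, a i.castSucc := by
    rw [Fin.prod_univ_castSucc, show a (Fin.last 4) = l from ha, mul_div_cancel_right₀ _ hl]
  rw [tsum_eq_single 0 fun n hn => ?_]
  · simp [rightTerm, vwpTerm, qPoch_zero, hlq]
  · rw [rightTerm, vwpTerm, harg, Finset.prod_eq_zero (Finset.mem_range.2 (Nat.pos_of_ne_zero hn))
      (by simp), mul_zero]

theorem rightSide_of_eq (hq1 : ‖q‖ < 1) {l : ℂ} {a : Fin 5 → ℂ} (hl : l ≠ 0)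
    (hlq : 1 - l ^ 2 / q ≠ 0) (hla : ∀ i, l * a i ∉ Omega q) (ha : a 4 = l) :
    rightSide q l a = 2 * qPochInf (a 0 * a 1 * a 2 * a 3) q /
      (qPochInf (a 0 * a 1) q * qPochInf (a 0 * a 2) q * qPochInf (a 0 * a 3) q *
        qPochInf (a 1 * a 2) q * qPochInf (a 1 * a 3) q * qPochInf (a 2 * a 3) q) := by
  have hne (i : Fin 5) := qPochInf_ne_zero hq1 (hla i)
  have hcancel : (∏ i, qPochInf (l * a i) q) ≠ 0 := Finset.prod_ne_zero_iff.2 fun i _ => hne i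
  rw [Fin.prod_univ_five, ha, ← sq] at hcancel
  rw [rightSide, tsum_rightTerm_of_eq hl hlq ha, pairProd, prod_Ioi_fin_five, Fin.prod_univ_five,
    Fin.prod_univ_five, ha, mul_div_cancel_right₀ _ hl, ← sq, mul_one,
    mul_left_comm, ← mul_div_mul_left (2 * _) _ hcancel]
  congr 1
  rw [mul_comm l, mul_comm l, mul_comm l, mul_comm l]
  ring

theorem nrIntegral_eq_rightSide_of_eq (hq : q ≠ 0) (hq1 : ‖q‖ < 1) {l : ℂ} {a : Fin 5 → ℂ}
    (hl : l ≠ 0) (ha1 : ∀ i, ‖a i‖ < 1) (hlq : ‖l ^ 2 / q‖ < 1) (ha : a 4 = l) :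
    qPochInf q q * nrIntegral q l a = rightSide q l a := by
  have hl1 := norm_lt_one_of_norm_sq_div_lt_one hq hq1 hlq
  rw [nrIntegral_eq_awIntegral hq hq1 hl1 ha,
    awIntegral_eq hq hq1 (ha1 0) (ha1 1) (ha1 2) (ha1 3),
    rightSide_of_eq hq1 hl (one_sub_ne_zero_of_norm_lt_one hlq)
      (fun i => notMem_Omega_of_norm_lt_one hq hq1 (norm_mul_lt_one hl1 (ha1 i))) ha,
    ← div_div, mul_div_assoc', mul_div_cancel₀ _ (qPochInf_ne_zero_of_norm_lt_one hq hq1 hq1)]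

theorem nrIntegral_eq_rightSide_of_terminating (hq : q ≠ 0) (hq1 : ‖q‖ < 1) (M : ℕ) {l : ℂ}
    {a : Fin 5 → ℂ} (ha4 : a 4 = l * q ^ M) (hl : l ≠ 0) (ha : ∀ i, a i ≠ 0)
    (ha1 : ∀ i, ‖a i‖ < 1) (hlq : ‖l ^ 2 / q‖ < 1) (ha23 : ∀ i j : ℕ, a 2 * q ^ i ≠ a 3 * q ^ j) :
    qPochInf q q * nrIntegral q l a = rightSide q l a := by
  induction M generalizing l a with
  | zero => exact nrIntegral_eq_rightSide_of_eq hq hq1 hl ha1 hlq (by simpa using ha4)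
  | succ M ih =>
    have hl1 := norm_lt_one_of_norm_sq_div_lt_one hq hq1 hlq
    have ht : ‖(∏ i, a i) / l‖ < 1 := by
      rw [Fin.prod_univ_five, ha4, mul_left_comm, mul_div_cancel_left₀ _ hl]
      exact norm_mul_lt_one (norm_mul_lt_one (norm_mul_lt_one (norm_mul_lt_one
        (ha1 0) (ha1 1)) (ha1 2)) (ha1 3)) (norm_pow_lt_one hq1 M.succ_ne_zero)
    have hne : a 2 ≠ a 3 := by simpa using ha23 0 0
    have ih_update (i : Fin 5) (hi : i ≠ 4) := ih (l := l * q) (a := Function.update a i (a i * q))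
      (by rw [Function.update_of_ne hi.symm, ha4, pow_succ', mul_assoc]) (mul_ne_zero hl hq)
      (update_mul_ne_zero hq ha i) (norm_update_lt_one ha1 (norm_mul_lt_one (ha1 i) hq1) i)
      (norm_mul_sq_div_lt_one hq1 hlq)
    have h2 := ih_update 2 (by decide) fun i j => by
      simpa [pow_succ', mul_assoc] using ha23 (i + 1) j
    have h3 := ih_update 3 (by decide) fun i j => by
      simpa [pow_succ', mul_assoc] using ha23 i (j + 1)
    rw [nrIntegral_contiguous hq hq1 l ha1 (ha 2) (ha 3) hne,
      rightSide_contiguous hq hq1 hl ha hne (notMem_Omega_of_norm_lt_one hq hq1 hlq)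
        (fun i => notMem_Omega_of_norm_lt_one hq hq1 (norm_mul_lt_one hl1 (ha1 i)))
        (fun i j _ => notMem_Omega_of_norm_lt_one hq hq1 (norm_mul_lt_one (ha1 i) (ha1 j))) ht,
      ← h2, ← h3]
    ring

theorem differentiableOn_rightSide (hq1 : ‖q‖ < 1) {U : Set ℂ} (hU : IsOpen U) {l : ℂ → ℂ}
    {a : ℂ → Fin 5 → ℂ} (hl : DifferentiableOn ℂ l U)
    (ha : ∀ i, DifferentiableOn ℂ (fun s => a s i) U) (hl0 : ∀ s ∈ U, l s ≠ 0)
    (ha0 : ∀ s ∈ U, ∀ i : Fin 4, a s i.castSucc ≠ 0)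
    (hpair : ∀ s ∈ U, ∀ i j, i ≠ j → a s i * a s j ∉ Omega q)
    (hla : ∀ s ∈ U, ∀ i, l s * a s i ∉ Omega q) (hsq : ∀ s ∈ U, l s ^ 2 ∉ Omega q)
    (hlq : ∀ s ∈ U, ∀ n : ℕ, 1 - l s ^ 2 / q * q ^ (2 * n) ≠ 0)
    (ht : ∀ s ∈ U, ‖(∏ i, a s i) / l s‖ < 1) :
    DifferentiableOn ℂ (fun s => rightSide q (l s) (a s)) U := by
  have hprod : DifferentiableOn ℂ (fun s => (∏ i, a s i) / l s) U := by
    fun_prop (disch := assumption)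
  have htsum : DifferentiableOn ℂ (fun s => ∑' n, rightTerm q (l s) (a s) n) U :=
    differentiableOn_tsum_vwpTerm hq1 hU (by fun_prop)
      (fun i => hl.div (ha i.castSucc) fun s hs => ha0 s hs i) (fun i => hl.mul (ha i))
      (by fun_prop) hprod hlq hla ht
  unfold rightSide pairProd
  refine DifferentiableOn.mul (DifferentiableOn.div (by fun_prop (disch := assumption))
    (by fun_prop (disch := assumption)) fun s hs => ?_) htsum
  exact mul_ne_zero (pairProd_ne_zero hq1 (hpair s hs)) (qPochInf_ne_zero hq1 (hsq s hs))

theorem differentiable_update {ι : Type*} [DecidableEq ι] (a : ι → ℂ) (i j : ι) :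
    Differentiable ℂ fun x => Function.update a i x j := by
  simp only [Function.update_apply]
  split_ifs <;> fun_prop

theorem frequently_nrIntegral_update_eq_rightSide (hq : q ≠ 0) (hq1 : ‖q‖ < 1) {l : ℂ}
    {a : Fin 5 → ℂ} (hl : l ≠ 0) (ha : ∀ i, a i ≠ 0) (ha1 : ∀ i, ‖a i‖ < 1)
    (hlq : ‖l ^ 2 / q‖ < 1) (ha23 : ∀ i j : ℕ, a 2 * q ^ i ≠ a 3 * q ^ j) :
    ∃ᶠ x in 𝓝[≠] (0 : ℂ), qPochInf q q * nrIntegral q l (Function.update a 4 x) =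
      rightSide q l (Function.update a 4 x) := by
  have hl1 := norm_lt_one_of_norm_sq_div_lt_one hq hq1 hlq
  have hne (M : ℕ) : l * q ^ M ≠ 0 := mul_ne_zero hl (pow_ne_zero M hq)
  have hlim : Tendsto (fun M : ℕ => l * q ^ M) atTop (𝓝[≠] 0) := by
    refine tendsto_nhdsWithin_iff.2 ⟨?_, Eventually.of_forall hne⟩
    simpa using (tendsto_pow_atTop_nhds_zero_of_norm_lt_one hq1).const_mul l
  refine hlim.frequently (Frequently.of_forall fun M => ?_)
  refine nrIntegral_eq_rightSide_of_terminating hq hq1 M (Function.update_self ..) hl (fun i => ?_)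
    (norm_update_lt_one ha1 (norm_mul_pow_lt_one hq1 hl1 M) 4) hlq (by simpa using ha23)
  rw [Function.update_apply]
  split_ifs
  exacts [hne M, ha i]

theorem nrIntegral_eq_rightSide (hq : q ≠ 0) (hq1 : ‖q‖ < 1) {l : ℂ} {a : Fin 5 → ℂ}
    (hl : l ≠ 0) (ha : ∀ i, a i ≠ 0) (ha1 : ∀ i, ‖a i‖ < 1) (hlq : ‖l ^ 2 / q‖ < 1)
    (ht : ‖(∏ i, a i) / l‖ < 1) (ha23 : ∀ i j : ℕ, a 2 * q ^ i ≠ a 3 * q ^ j) :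
    qPochInf q q * nrIntegral q l a = rightSide q l a := by
  have hl1 := norm_lt_one_of_norm_sq_div_lt_one hq hq1 hlq
  set k := (∏ i : Fin 4, a i.castSucc) / l
  have hk0 : 0 < ‖k‖ := norm_pos_iff.2 <|
    div_ne_zero (Finset.prod_ne_zero_iff.2 fun i _ => ha i.castSucc) hl
  have hcast (x : ℂ) (i : Fin 4) : Function.update a 4 x i.castSucc = a i.castSucc :=
    Function.update_of_ne (Fin.castSucc_lt_last i).ne ..
  have hprod (x : ℂ) : (∏ i, Function.update a 4 x i) / l = k * x := by
    rw [Fin.prod_univ_castSucc, Fintype.prod_congr _ _ (hcast x),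
      show Function.update a 4 x (Fin.last 4) = x from Function.update_self ..,
      mul_div_right_comm]
  set ρ := min 1 ‖k‖⁻¹
  have hρ : 0 < ρ := lt_min one_pos (inv_pos.2 hk0)
  have hmem {x : ℂ} : x ∈ ball (0 : ℂ) ρ ↔ ‖x‖ < 1 ∧ ‖k * x‖ < 1 := by
    rw [mem_ball_zero_iff, lt_min_iff, norm_mul, ← lt_inv_mul_iff₀ hk0, mul_one]
  have hupdate (i : Fin 5) := (differentiable_update a 4 i).differentiableOn (s := ball 0 ρ)
  have hlt (x : ℂ) (hx : x ∈ ball 0 ρ) := norm_update_lt_one ha1 (hmem.1 hx).1 4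
  have hleft := (differentiableOn_nrIntegral hq hq1 l isOpen_ball hupdate hlt).const_mul
    (qPochInf q q)
  have hright : DifferentiableOn ℂ (fun x => rightSide q l (Function.update a 4 x)) (ball 0 ρ) := by
    refine differentiableOn_rightSide hq1 isOpen_ball (by fun_prop) hupdate (fun _ _ => hl)
      (fun x _ i => by rw [hcast]; exact ha _)
      (fun x hx i j _ => notMem_Omega_of_norm_lt_one hq hq1 (norm_mul_lt_one (hlt x hx i)
        (hlt x hx j)))
      (fun x hx i => notMem_Omega_of_norm_lt_one hq hq1 (norm_mul_lt_one hl1 (hlt x hx i)))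
      (fun _ _ => notMem_Omega_of_norm_lt_one hq hq1 (norm_pow_lt_one hl1 two_ne_zero))
      (fun _ _ n => one_sub_mul_pow_ne_zero (notMem_Omega_of_norm_lt_one hq hq1 hlq) (2 * n))
      (fun x hx => by rw [hprod]; exact (hmem.1 hx).2)
  have heq := (hleft.analyticOnNhd isOpen_ball).eqOn_of_preconnected_of_frequently_eq
    (hright.analyticOnNhd isOpen_ball) (convex_ball 0 ρ).isPreconnected (mem_ball_self hρ)
    (frequently_nrIntegral_update_eq_rightSide hq hq1 hl ha ha1 hlq ha23)
  have ha4 : a 4 ∈ ball 0 ρ := hmem.2 ⟨ha1 4, by rwa [← hprod, Function.update_eq_self]⟩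
  simpa only [Function.update_eq_self] using heq ha4

end NassrallahRahmanEvaluation

section Residues

variable {q : ℂ}

/-- The terms of the very-well-poised series to which the poles `a 0 * q ^ n` of the
Nassrallah--Rahman weight contribute. -/
def leftTerm (q l : ℂ) (a : Fin 5 → ℂ) (n : ℕ) : ℂ :=
  vwpTerm (a 0 ^ 2) (fun j : Fin 4 => a 0 * a j.succ)
    (Fin.cons (l * a 0) fun j : Fin 4 => q * a 0 / a j.succ : Fin 5 → ℂ) q
    (q ^ 2 * a 0 / ∏ i, a i) (q * l / ∏ i, a i) n

/-- The coefficient of the series `∑' n, leftTerm q l a n` on the sum side of the identity; up to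
the factor `(q; q)_∞` it is the residue of the Nassrallah--Rahman weight at `a 0`. -/
def leftFactor (q l : ℂ) (a : Fin 5 → ℂ) : ℂ :=
  qPochInf (l * a 0) q * qPochInf (1 / a 0 ^ 2) q * qPochInf (l / a 0) q /
    ((∏ j : Fin 4, qPochInf (a 0 * a j.succ) q) * ∏ j : Fin 4, qPochInf (a j.succ / a 0) q)

/-- The multiplier of `nrWeight` under `z ↦ q * z`. -/
def nrMultiplier (q l : ℂ) (a : Fin 5 → ℂ) (z : ℂ) : ℂ :=
  q * (1 - q ^ 2 * z ^ 2) / (1 - z ^ 2) * ((q * z - l) / (1 - l * z)) /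
    ∏ i, ((q * z - a i) / (1 - a i * z))

theorem qPochInf_sq_mul_qPochInf_inv_sq (hq : q ≠ 0) (hq1 : ‖q‖ < 1) {z : ℂ} (hz : z ≠ 0)
    (h1 : 1 - z ^ 2 ≠ 0) :
    qPochInf ((q * z) ^ 2) q * qPochInf (1 / (q * z) ^ 2) q =
      (1 - q ^ 2 * z ^ 2) / (q ^ 3 * z ^ 4 * (1 - z ^ 2)) *
        (qPochInf (z ^ 2) q * qPochInf (1 / z ^ 2) q) := by
  have hsq : qPochInf (z ^ 2) q =
      (1 - z ^ 2) * ((1 - q * z ^ 2) * qPochInf ((q * z) ^ 2) q) := by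
    rw [qPochInf_eq_mul hq1, qPochInf_eq_mul hq1 (z ^ 2 * q)]
    ring_nf
  have hinv : qPochInf (1 / (q * z) ^ 2) q =
      (1 - 1 / (q * z) ^ 2) * ((1 - 1 / (q * z ^ 2)) * qPochInf (1 / z ^ 2) q) := by
    rw [qPochInf_eq_mul hq1, qPochInf_eq_mul hq1 (1 / (q * z) ^ 2 * q),
      show 1 / (q * z) ^ 2 * q = 1 / (q * z ^ 2) by field_simp,
      show 1 / (q * z ^ 2) * q = 1 / z ^ 2 by field_simp]
  rw [hsq, hinv]
  field_simp
  ring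

theorem qPochPM_q_mul (hq : q ≠ 0) (hq1 : ‖q‖ < 1) {x z : ℂ} (hz : z ≠ 0) (hx : 1 - x * z ≠ 0) :
    qPochPM x q (q * z) = (q * z - x) / (1 - x * z) / (q * z) * qPochPM x q z := by
  have hmul : qPochInf (x * z) q = (1 - x * z) * qPochInf (x * (q * z)) q := by
    rw [qPochInf_eq_mul hq1]
    ring_nf
  have hdiv : qPochInf (x / (q * z)) q = (1 - x / (q * z)) * qPochInf (x / z) q := by
    rw [qPochInf_eq_mul hq1, show x / (q * z) * q = x / z by field_simp]
  rw [qPochPM, qPochPM, hmul, hdiv]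
  field_simp

theorem nrWeight_q_mul (hq : q ≠ 0) (hq1 : ‖q‖ < 1) {l : ℂ} (hl1 : ‖l‖ < 1) {a : Fin 5 → ℂ}
    (ha1 : ∀ i, ‖a i‖ < 1) {z : ℂ} (hz : z ≠ 0) (hz1 : ‖z‖ < 1) :
    nrWeight q l a (q * z) = nrMultiplier q l a z * nrWeight q l a z := by
  have hsq : 1 - z ^ 2 ≠ 0 := one_sub_ne_zero_of_norm_lt_one (norm_pow_lt_one hz1 two_ne_zero)
  have hmul {x : ℂ} (hx : ‖x‖ < 1) : 1 - x * z ≠ 0 :=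
    one_sub_ne_zero_of_norm_lt_one (norm_mul_lt_one hx hz1)
  have hprod : ∏ i, qPochPM (a i) q (q * z) =
      (∏ i, ((q * z - a i) / (1 - a i * z))) / (q * z) ^ 5 * ∏ i, qPochPM (a i) q z := by
    rw [Finset.prod_congr rfl fun i _ => qPochPM_q_mul hq hq1 hz (hmul (ha1 i)),
      Finset.prod_mul_distrib, Finset.prod_div_distrib (g := fun _ => q * z), Finset.prod_const,
      Finset.card_fin]
  have hlz := hmul hl1
  rw [nrWeight, nrWeight, awWeight, awWeight, nrMultiplier,
    qPochInf_sq_mul_qPochInf_inv_sq hq hq1 hz hsq, qPochPM_q_mul hq hq1 hz hlz, hprod]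
  field_simp

theorem continuousAt_nrMultiplier {l : ℂ} {a : Fin 5 → ℂ} {z : ℂ} (hz : 1 - z ^ 2 ≠ 0)
    (hl : 1 - l * z ≠ 0) (ha : ∀ i, 1 - a i * z ≠ 0) (hq : ∀ i, q * z - a i ≠ 0) :
    ContinuousAt (nrMultiplier q l a) z := by
  have hprod : ∏ i, ((q * z - a i) / (1 - a i * z)) ≠ 0 :=
    Finset.prod_ne_zero_iff.2 fun i _ => div_ne_zero (hq i) (ha i)
  have hfactor : ContinuousAt (fun z => ∏ i, ((q * z - a i) / (1 - a i * z))) z :=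
    tendsto_finsetProd _ fun i _ => ContinuousAt.div (by fun_prop) (by fun_prop) (ha i)
  unfold nrMultiplier
  fun_prop (disch := assumption)

theorem nrMultiplier_zero (q l : ℂ) (a : Fin 5 → ℂ) :
    nrMultiplier q l a 0 = q * l / ∏ i, a i := by
  have hpow : (-1 : ℂ) ^ 5 = -1 := by norm_num
  simp [nrMultiplier, Finset.prod_neg, hpow]

theorem nrMultiplier_eq_vwpRatio {l : ℂ} {a : Fin 5 → ℂ} (ha : ∀ i, a i ≠ 0) (x : ℂ) :
    nrMultiplier q l a (a 0 * x) = vwpRatio (a 0 ^ 2) (fun j : Fin 4 => a 0 * a j.succ)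
      (Fin.cons (l * a 0) fun j : Fin 4 => q * a 0 / a j.succ : Fin 5 → ℂ) q
      (q ^ 2 * a 0 / ∏ i, a i) (q * l / ∏ i, a i) x := by
  have h0 := ha 0
  have htail : ∏ j : Fin 4, a j.succ ≠ 0 := Finset.prod_ne_zero_iff.2 fun j _ => ha _
  have hden : ∏ j : Fin 4, (1 - q * a 0 / a j.succ * x) =
      (∏ j : Fin 4, (q * (a 0 * x) - a j.succ)) / ∏ j : Fin 4, a j.succ := by
    have hj (j : Fin 4) : 1 - q * a 0 / a j.succ * x =
        -((q * (a 0 * x) - a j.succ) / a j.succ) := by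
      field_simp [ha j.succ]
      ring
    simp only [hj, Finset.prod_neg, Finset.prod_div_distrib, Finset.card_fin]
    ring
  have hnum : ∏ j : Fin 4, (1 - a 0 * a j.succ * x) = ∏ j : Fin 4, (1 - a j.succ * (a 0 * x)) :=
    Finset.prod_congr rfl fun j _ => by ring
  simp only [nrMultiplier, vwpRatio, Fin.prod_univ_succ (n := 4), Fin.cons_zero, Fin.cons_succ,
    hden, hnum, Finset.prod_div_distrib]
  rw [show q * (a 0 * x) - a 0 = -(a 0 * (1 - q * x)) by ring,
    show q * l / (a 0 * ∏ j : Fin 4, a j.succ) - q ^ 2 * a 0 / (a 0 * ∏ j : Fin 4, a j.succ) * x =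
      -(q * (q * (a 0 * x) - l)) / (a 0 * ∏ j : Fin 4, a j.succ) by ring,
    show 1 - a 0 * (a 0 * x) = 1 - a 0 ^ 2 * x by ring, mul_pow, mul_assoc l, mul_assoc (a 0 ^ 2),
    mul_left_comm (a 0 ^ 2)]
  generalize 1 - a 0 ^ 2 * x = A
  generalize 1 - a 0 ^ 2 * x ^ 2 = B
  generalize 1 - l * (a 0 * x) = L
  generalize 1 - q * x = X
  field_simp

theorem tendsto_sub_mul_nrWeight (hq : q ≠ 0) (hq1 : ‖q‖ < 1) (l : ℂ) {a : Fin 5 → ℂ}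
    (ha : a 0 ≠ 0) (ha1 : ∀ i, ‖a i‖ < 1) (hdiv : ∀ j : Fin 4, a j.succ / a 0 ∉ Omega q) :
    Tendsto (fun z => (z - a 0) * (z⁻¹ * nrWeight q l a z)) (𝓝[≠] (a 0))
      (𝓝 (leftFactor q l a / qPochInf q q)) := by
  let K : ℂ → ℂ := fun z => qPochPM l q z * (qPochInf (z ^ 2) q * qPochInf (1 / z ^ 2) q) /
    (qPochInf (a 0 * z) q * qPochInf (a 0 / z * q) q * ∏ j : Fin 4, qPochPM (a j.succ) q z)
  have hpair (i : Fin 5) : qPochInf (a i * a 0) q ≠ 0 :=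
    qPochInf_ne_zero_of_norm_lt_one hq hq1 (norm_mul_lt_one (ha1 i) (ha1 0))
  have hpair0 := hpair 0
  have hqq : qPochInf q q ≠ 0 := qPochInf_ne_zero_of_norm_lt_one hq hq1 hq1
  have hK : K (a 0) = leftFactor q l a / qPochInf q q := by
    simp only [K, leftFactor, qPochPM, Finset.prod_mul_distrib, div_self ha, one_mul, ← sq,
      mul_comm (a 0)]
    rw [← sq] at hpair0
    field_simp
  have hK0 : qPochInf (a 0 * a 0) q * qPochInf (a 0 / a 0 * q) q *
      ∏ j : Fin 4, qPochPM (a j.succ) q (a 0) ≠ 0 := by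
    rw [div_self ha, one_mul]
    exact mul_ne_zero (mul_ne_zero hpair0 hqq) (Finset.prod_ne_zero_iff.2 fun j _ =>
      mul_ne_zero (hpair _) (qPochInf_ne_zero hq1 (hdiv j)))
  have hKcont : ContinuousAt K (a 0) := by
    have hsq : a 0 ^ 2 ≠ 0 := pow_ne_zero 2 ha
    have hPM (x : ℂ) : ContinuousAt (qPochPM x q) (a 0) := by
      unfold qPochPM
      fun_prop (disch := assumption)
    have hprod : ContinuousAt (fun z => ∏ j : Fin 4, qPochPM (a j.succ) q z) (a 0) :=
      tendsto_finsetProd _ fun j _ => hPM _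
    have hl := hPM l
    fun_prop (disch := assumption)
  rw [← hK]
  refine (hKcont.tendsto.mono_left nhdsWithin_le_nhds).congr' ?_
  filter_upwards [self_mem_nhdsWithin, (eventually_ne_nhds ha).filter_mono nhdsWithin_le_nhds]
    with z hza hz
  have hsub : z - a 0 ≠ 0 := sub_ne_zero.2 hza
  have hPM : qPochPM (a 0) q z =
      qPochInf (a 0 * z) q * ((1 - a 0 / z) * qPochInf (a 0 / z * q) q) := by
    rw [qPochPM, qPochInf_eq_mul hq1 (a 0 / z)]
  simp only [K, nrWeight, awWeight, Fin.prod_univ_succ (n := 4)]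
  rw [hPM, one_sub_div hz]
  field_simp

theorem tendsto_sub_mul_comp_mul_left {f : ℂ → ℂ} {c m p : ℂ} (hq : q ≠ 0)
    {g : ℂ → ℂ} (hg : Tendsto g (𝓝[≠] p) (𝓝 m))
    (hfg : ∀ᶠ z in 𝓝[≠] p, f (q * z) = g z * f z)
    (hf : Tendsto (fun z => (z - p) * (z⁻¹ * f z)) (𝓝[≠] p) (𝓝 c)) :
    Tendsto (fun z => (z - q * p) * (z⁻¹ * f z)) (𝓝[≠] (q * p)) (𝓝 (m * c)) := by
  have hmap : 𝓝[≠] (q * p) = map (fun z => q * z) (𝓝[≠] p) :=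
    ((Homeomorph.mulLeft₀ q hq).map_punctured_nhds_eq p).symm
  rw [hmap, tendsto_map'_iff]
  refine (hg.mul hf).congr' ?_
  filter_upwards [hfg] with z hz
  rw [Function.comp_apply, hz]
  field_simp

theorem mul_mul_pow_sub_ne_zero (hq1 : ‖q‖ < 1) {ι : Type*} {a : ι → ℂ}
    (ha : ∀ i, a i ≠ 0) (hdiv : ∀ i j, i ≠ j → a i / a j ∉ Omega q) (i j : ι) (n : ℕ) :
    q * (a i * q ^ n) - a j ≠ 0 := by
  have hj := ha j
  have hfactor : q * (a i * q ^ n) - a j = -(a j * (1 - a i / a j * q ^ (n + 1))) := by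
    field_simp
    ring
  rw [hfactor]
  refine neg_ne_zero.2 (mul_ne_zero hj ?_)
  rcases eq_or_ne i j with rfl | hij
  · rw [div_self hj, one_mul]
    exact one_sub_ne_zero_of_norm_lt_one (norm_pow_lt_one hq1 n.succ_ne_zero)
  · exact one_sub_mul_pow_ne_zero (hdiv i j hij) (n + 1)

theorem tendsto_sub_mul_pow_mul_nrWeight (hq : q ≠ 0) (hq1 : ‖q‖ < 1) {l : ℂ} (hl1 : ‖l‖ < 1)
    {a : Fin 5 → ℂ} (ha : ∀ i, a i ≠ 0) (ha1 : ∀ i, ‖a i‖ < 1)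
    (hdiv : ∀ i j, i ≠ j → a i / a j ∉ Omega q) (n : ℕ) :
    Tendsto (fun z => (z - a 0 * q ^ n) * (z⁻¹ * nrWeight q l a z)) (𝓝[≠] (a 0 * q ^ n))
      (𝓝 (leftFactor q l a * leftTerm q l a n / qPochInf q q)) := by
  have hsq : ‖a 0 ^ 2‖ < 1 := norm_pow_lt_one (ha1 0) two_ne_zero
  have hΩ := notMem_Omega_of_norm_lt_one hq hq1 hsq
  induction n with
  | zero =>
    have h1 := one_sub_ne_zero_of_norm_lt_one hsq
    have hterm : leftTerm q l a 0 = 1 := by simp [leftTerm, vwpTerm, qPoch_zero, h1]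
    simpa [hterm] using tendsto_sub_mul_nrWeight hq hq1 l (ha 0) ha1
      fun j => hdiv _ _ (Fin.succ_ne_zero j)
  | succ n ih =>
    have hp0 : a 0 * q ^ n ≠ 0 := mul_ne_zero (ha 0) (pow_ne_zero n hq)
    have hp1 := norm_mul_pow_lt_one hq1 (ha1 0) n
    have hmul {x : ℂ} (hx : ‖x‖ < 1) : 1 - x * (a 0 * q ^ n) ≠ 0 :=
      one_sub_ne_zero_of_norm_lt_one (norm_mul_lt_one hx hp1)
    have hmultiplier : Tendsto (nrMultiplier q l a) (𝓝[≠] (a 0 * q ^ n))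
        (𝓝 (nrMultiplier q l a (a 0 * q ^ n))) :=
      (continuousAt_nrMultiplier (one_sub_ne_zero_of_norm_lt_one
        (norm_pow_lt_one hp1 two_ne_zero)) (hmul hl1) (fun i => hmul (ha1 i))
        fun i => mul_mul_pow_sub_ne_zero hq1 ha hdiv 0 i n).continuousWithinAt
    have hfunctional : ∀ᶠ z in 𝓝[≠] (a 0 * q ^ n),
        nrWeight q l a (q * z) = nrMultiplier q l a z * nrWeight q l a z := by
      filter_upwards [(eventually_ne_nhds hp0).filter_mono nhdsWithin_le_nhds,
        (continuous_norm.continuousAt.eventually_lt_const hp1).filter_mono nhdsWithin_le_nhds]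
        with z hz hz1 using nrWeight_q_mul hq hq1 hl1 ha1 hz hz1
    have hstep := tendsto_sub_mul_comp_mul_left hq hmultiplier hfunctional ih
    rw [nrMultiplier_eq_vwpRatio ha] at hstep
    rw [leftTerm, vwpTerm_succ fun m => one_sub_mul_pow_ne_zero hΩ (2 * m), pow_succ',
      mul_left_comm, mul_left_comm (leftFactor q l a), mul_div_assoc]
    exact hstep

end Residues

section ResidueSum

open Metric Real

variable {q : ℂ}

theorem circleAverage_sub_circleAverage_eq_sum_residues {ι : Type*} {r R : ℝ} (hr : 0 < r)
    (hrR : r ≤ R) {s : Finset ι} {p : ι → ℂ} (hp : Function.Injective p)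
    (hs : ∀ i ∈ s, r < ‖p i‖ ∧ ‖p i‖ < R) {f : ℂ → ℂ} {c : ι → ℂ}
    (hf : ∀ z, r ≤ ‖z‖ → ‖z‖ ≤ R → (∀ i ∈ s, z ≠ p i) → DifferentiableAt ℂ f z)
    (hres : ∀ i ∈ s, Tendsto (fun z => (z - p i) * (z⁻¹ * f z)) (𝓝[≠] (p i)) (𝓝 (c i))) :
    circleAverage f 0 R - circleAverage f 0 r = ∑ i ∈ s, c i := by
  classical
  have hmem {P : ℂ → Prop} (h : ∀ i ∈ s, P (p i)) : ∀ z ∈ s.image p, P z := fun z hz => by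
    obtain ⟨i, hi, rfl⟩ := Finset.mem_image.1 hz
    exact h i hi
  have hcircle := circleIntegral_sub_circleIntegral_eq_sum_residues hr hrR (hmem hs)
    (f := fun z => z⁻¹ * f z) (c := Function.extend p c 0)
    (fun z hzr hzR hz => by
      have hz0 : z ≠ 0 := norm_pos_iff.1 (hr.trans_le hzr)
      have hfz := hf z hzr hzR fun i hi h => hz (h ▸ Finset.mem_image_of_mem p hi)
      fun_prop (disch := assumption))
    (hmem fun i hi => by simpa only [hp.extend_apply] using hres i hi)
  simp only [Finset.sum_image hp.injOn, hp.extend_apply] at hcircle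
  simp only [circleAverage_eq_circleIntegral (hr.trans_le hrR).ne',
    circleAverage_eq_circleIntegral hr.ne', sub_zero, smul_eq_mul, ← mul_sub, hcircle]
  exact inv_mul_cancel_left₀ Complex.two_pi_I_ne_zero _

theorem norm_le_mul_pow_of_comp_mul_left {f g : ℂ → ℂ} {r C κ : ℝ} (hq : q ≠ 0) (hq1 : ‖q‖ < 1)
    (hr : 0 < r) (hfg : ∀ z, z ≠ 0 → ‖z‖ ≤ r → f (q * z) = g z * f z)
    (hg : ∀ z, ‖z‖ ≤ r → ‖g z‖ ≤ κ) (hf : ∀ z, ‖z‖ = r → ‖f z‖ ≤ C) (m : ℕ) {z : ℂ}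
    (hz : ‖z‖ = r * ‖q‖ ^ m) : ‖f z‖ ≤ C * κ ^ m := by
  induction m generalizing z with
  | zero => simpa using hf z (by simpa using hz)
  | succ m ih =>
    have hq0 : 0 < ‖q‖ := norm_pos_iff.2 hq
    have hw : ‖z / q‖ = r * ‖q‖ ^ m := by
      rw [norm_div, hz, pow_succ, ← mul_assoc, mul_div_cancel_right₀ _ hq0.ne']
    have hw0 : z / q ≠ 0 := norm_pos_iff.1 (hw ▸ by positivity)
    have hwr : ‖z / q‖ ≤ r :=
      hw.trans_le (mul_le_of_le_one_right hr.le (pow_le_one₀ hq0.le hq1.le))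
    calc ‖f z‖ = ‖g (z / q)‖ * ‖f (z / q)‖ := by
          rw [← norm_mul, ← hfg _ hw0 hwr, mul_div_cancel₀ z hq]
      _ ≤ κ * (C * κ ^ m) :=
          mul_le_mul (hg _ hwr) (ih hw) (norm_nonneg _) ((norm_nonneg _).trans (hg _ hwr))
      _ = C * κ ^ (m + 1) := by ring

theorem tendsto_const_mul_norm_pow (hq1 : ‖q‖ < 1) (ρ : ℝ) :
    Tendsto (fun N : ℕ => ρ * ‖q‖ ^ N) atTop (𝓝 0) := by
  simpa using (tendsto_pow_atTop_nhds_zero_of_lt_one (norm_nonneg q) hq1).const_mul ρ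

theorem tendsto_circleAverage_of_comp_mul_left {f g : ℂ → ℂ} (hq : q ≠ 0) (hq1 : ‖q‖ < 1)
    (hfg : ∀ᶠ z in 𝓝[≠] 0, f (q * z) = g z * f z) (hg : ContinuousAt g 0) (hg0 : ‖g 0‖ < 1)
    {ρ : ℝ} (hρ : 0 < ρ) (hf : ∀ N : ℕ, ContinuousOn f (sphere 0 (ρ * ‖q‖ ^ N))) :
    Tendsto (fun N : ℕ => circleAverage f 0 (ρ * ‖q‖ ^ N)) atTop (𝓝 0) := by
  obtain ⟨κ, hκ, hκ1⟩ := exists_between hg0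
  obtain ⟨δ, hδ, hball⟩ := Metric.eventually_nhds_iff.1
    ((hg.norm.eventually_lt_const hκ).and (eventually_nhdsWithin_iff.1 hfg))
  obtain ⟨M, hM⟩ := ((tendsto_const_mul_norm_pow hq1 ρ).eventually_lt_const hδ).exists
  have hnear {z : ℂ} (hz : ‖z‖ ≤ ρ * ‖q‖ ^ M) :=
    hball ((dist_zero_right z).trans_lt (hz.trans_lt hM))
  obtain ⟨C, hC⟩ := (isCompact_sphere (0 : ℂ) (ρ * ‖q‖ ^ M)).exists_bound_of_continuousOn (hf M)
  rw [← tendsto_add_atTop_iff_nat M]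
  refine squeeze_zero_norm (a := fun m => C * κ ^ m) (fun m => ?_) ?_
  · refine norm_circleAverage_le_of_norm_le_const fun z hz => ?_
    refine norm_le_mul_pow_of_comp_mul_left hq hq1 (by positivity)
      (fun z hz0 hz => (hnear hz).2 hz0) (fun z hz => (hnear hz).1.le)
      (fun z hz => hC z (by simpa using hz)) m ?_
    rw [mul_assoc, ← pow_add, add_comm M]
    simpa [abs_of_pos hρ] using hz
  · have hκ0 : 0 ≤ κ := (norm_nonneg _).trans hκ.le
    simpa using (tendsto_pow_atTop_nhds_zero_of_lt_one hκ0 hκ1).const_mul C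

theorem differentiableAt_nrWeight {ι : Type*} [Fintype ι] (hq : q ≠ 0) (hq1 : ‖q‖ < 1) (l : ℂ)
    {a : ι → ℂ} (ha1 : ∀ i, ‖a i‖ < 1) {z : ℂ} (hz : z ≠ 0) (hz1 : ‖z‖ ≤ 1)
    (hpole : ∀ i, ∀ n : ℕ, z ≠ a i * q ^ n) : DifferentiableAt ℂ (nrWeight q l a) z := by
  have hz2 : z ^ 2 ≠ 0 := pow_ne_zero 2 hz
  have hden : ∏ i, qPochPM (a i) q z ≠ 0 := by
    refine Finset.prod_ne_zero_iff.2 fun i _ => mul_ne_zero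
      (qPochInf_ne_zero_of_norm_lt_one hq hq1 ?_) (qPochInf_ne_zero hq1 ?_)
    · rw [norm_mul]
      exact mul_lt_one_of_nonneg_of_lt_one_left (norm_nonneg _) (ha1 i) hz1
    · rintro ⟨n, hn⟩
      refine hpole i n ?_
      rw [div_eq_iff hz, ← div_eq_inv_mul, eq_div_iff (pow_ne_zero n hq)] at hn
      exact hn.symm
  unfold nrWeight awWeight
  unfold qPochPM at hden ⊢
  fun_prop (disch := assumption)

theorem mul_pow_ne_mul_pow (hq : q ≠ 0) {x y : ℂ} (hx : x ≠ 0) (hy : y ≠ 0) (hxy : x / y ∉ Omega q)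
    (hyx : y / x ∉ Omega q) (m n : ℕ) : x * q ^ m ≠ y * q ^ n := by
  wlog hmn : m ≤ n generalizing x y m n
  · exact (this hy hx hyx hxy n m (le_of_not_ge hmn)).symm
  obtain ⟨k, rfl⟩ := Nat.exists_eq_add_of_le hmn
  intro h
  have hk : x = y * q ^ k := by
    rwa [pow_add, mul_left_comm, mul_comm x, mul_right_inj' (pow_ne_zero m hq)] at h
  refine hyx ⟨k, ?_⟩
  rw [hk, div_mul_cancel_left₀ hy]

theorem injective_mul_pow (hq : q ≠ 0) (hq1 : ‖q‖ < 1) {ι : Type*} {a : ι → ℂ} (ha : ∀ i, a i ≠ 0)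
    (hdiv : ∀ i j, i ≠ j → a i / a j ∉ Omega q) :
    Function.Injective fun p : ι × ℕ => a p.1 * q ^ p.2 := by
  rintro ⟨i, m⟩ ⟨j, n⟩ h
  rcases eq_or_ne i j with rfl | hij
  · have hpow : ‖q‖ ^ m = ‖q‖ ^ n := by
      rw [← norm_pow, ← norm_pow, mul_left_cancel₀ (ha i) h]
    rw [pow_right_injective₀ (norm_pos_iff.2 hq) hq1.ne hpow]
  · exact absurd h (mul_pow_ne_mul_pow hq (ha i) (ha j) (hdiv i j hij) (hdiv j i hij.symm) m n)

theorem exists_radius_mul_pow_ne (hq : q ≠ 0) {ι : Type*} [Countable ι] (v : ι → ℝ) :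
    ∃ ρ : ℝ, 0 < ρ ∧ ρ < 1 ∧ ∀ i, ∀ N : ℕ, ρ * ‖q‖ ^ N ≠ v i := by
  obtain ⟨ρ, hρ, h0, h1⟩ := ((Set.countable_range fun p : ι × ℕ =>
    v p.1 / ‖q‖ ^ p.2).dense_compl ℝ).exists_between (zero_lt_one' ℝ)
  refine ⟨ρ, h0, h1, fun i N h => hρ ⟨(i, N), ?_⟩⟩
  simp only [← h, mul_div_cancel_right₀ _ (pow_ne_zero N (norm_ne_zero_iff.2 hq))]

theorem finite_lt_norm_mul_pow (hq1 : ‖q‖ < 1) {ι : Type*} [Finite ι] (a : ι → ℂ) {r : ℝ}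
    (hr : 0 < r) : {p : ι × ℕ | r < ‖a p.1 * q ^ p.2‖}.Finite := by
  have hfiber (i : ι) : {n : ℕ | r < ‖a i * q ^ n‖}.Finite := by
    have hsmall := (tendsto_const_mul_norm_pow hq1 ‖a i‖).eventually_le_const hr
    rw [← Nat.cofinite_eq_atTop] at hsmall
    simpa using hsmall
  refine (Set.finite_iUnion fun i => (hfiber i).image (Prod.mk i)).subset fun p hp => ?_
  exact Set.mem_iUnion.2 ⟨p.1, p.2, hp, rfl⟩

theorem tendsto_toFinset_lt_atTop {α : Type*} {v : α → ℝ} (hv : ∀ x, 0 < v x) {r : ℕ → ℝ}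
    (hr : Tendsto r atTop (𝓝 0)) (hfin : ∀ N, {x | r N < v x}.Finite) :
    Tendsto (fun N => (hfin N).toFinset) atTop atTop := by
  refine tendsto_atTop.2 fun s => ?_
  filter_upwards [(eventually_all_finset s).2 fun x _ => hr.eventually_lt_const (hv x)]
    with N hN x hx using (hfin N).mem_toFinset.2 (hN x hx)

/-- The contribution of the pole `a k * q ^ n` to the integral of the Nassrallah--Rahman weight,
multiplied by `(q; q)_∞`, for `p = (k, n)`. -/
def residueTerm (q l : ℂ) (a : Fin 5 → ℂ) (p : Fin 5 × ℕ) : ℂ :=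
  leftFactor q l (a ∘ Equiv.swap 0 p.1) * leftTerm q l (a ∘ Equiv.swap 0 p.1) p.2

/-- The sum side of the five-term identity. -/
def leftSide (q l : ℂ) (a : Fin 5 → ℂ) : ℂ :=
  symSum (fun a => leftFactor q l a * ∑' n, leftTerm q l a n) a

theorem tendsto_sub_mul_nrWeight_residueTerm (hq : q ≠ 0) (hq1 : ‖q‖ < 1) {l : ℂ} (hl1 : ‖l‖ < 1)
    {a : Fin 5 → ℂ} (ha : ∀ i, a i ≠ 0) (ha1 : ∀ i, ‖a i‖ < 1)
    (hdiv : ∀ i j, i ≠ j → a i / a j ∉ Omega q) (p : Fin 5 × ℕ) :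
    Tendsto (fun z => (z - a p.1 * q ^ p.2) * (z⁻¹ * nrWeight q l a z)) (𝓝[≠] (a p.1 * q ^ p.2))
      (𝓝 (residueTerm q l a p / qPochInf q q)) := by
  have h := tendsto_sub_mul_pow_mul_nrWeight hq hq1 hl1 (a := a ∘ Equiv.swap 0 p.1)
    (fun i => ha _) (fun i => ha1 _) (fun i j hij => hdiv _ _ ((Equiv.injective _).ne hij)) p.2
  simpa only [residueTerm, nrWeight, awWeight_comp_perm, Function.comp_apply,
    Equiv.swap_apply_left] using h

theorem nrIntegral_sub_circleAverage (hq : q ≠ 0) (hq1 : ‖q‖ < 1) {l : ℂ} (hl1 : ‖l‖ < 1)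
    {a : Fin 5 → ℂ} (ha : ∀ i, a i ≠ 0) (ha1 : ∀ i, ‖a i‖ < 1)
    (hdiv : ∀ i j, i ≠ j → a i / a j ∉ Omega q) {r : ℝ} (hr : 0 < r) (hr1 : r < 1)
    (hrne : ∀ p : Fin 5 × ℕ, r ≠ ‖a p.1 * q ^ p.2‖) :
    nrIntegral q l a - circleAverage (nrWeight q l a) 0 r =
      ∑ p ∈ (finite_lt_norm_mul_pow hq1 a hr).toFinset, residueTerm q l a p / qPochInf q q := by
  refine circleAverage_sub_circleAverage_eq_sum_residues hr hr1.le
    (injective_mul_pow hq hq1 ha hdiv)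
    (fun p hp => ⟨by simpa using hp, norm_mul_pow_lt_one hq1 (ha1 _) _⟩) (fun z hzr hz1 hz => ?_)
    fun p _ => tendsto_sub_mul_nrWeight_residueTerm hq hq1 hl1 ha ha1 hdiv p
  refine differentiableAt_nrWeight hq hq1 l ha1 (norm_pos_iff.1 (hr.trans_le hzr)) hz1 ?_
  rintro i n rfl
  exact hz (i, n) ((Set.Finite.mem_toFinset _).2 (hzr.lt_of_ne (hrne (i, n)))) rfl

theorem tendsto_circleAverage_nrWeight (hq : q ≠ 0) (hq1 : ‖q‖ < 1) {l : ℂ} (hl1 : ‖l‖ < 1)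
    {a : Fin 5 → ℂ} (ha : ∀ i, a i ≠ 0) (ha1 : ∀ i, ‖a i‖ < 1) (hlow : ‖q * l / ∏ i, a i‖ < 1)
    {ρ : ℝ} (hρ : 0 < ρ) (hρ1 : ρ < 1)
    (hρne : ∀ (p : Fin 5 × ℕ) (N : ℕ), ρ * ‖q‖ ^ N ≠ ‖a p.1 * q ^ p.2‖) :
    Tendsto (fun N : ℕ => circleAverage (nrWeight q l a) 0 (ρ * ‖q‖ ^ N)) atTop (𝓝 0) := by
  have hq0 : 0 < ‖q‖ := norm_pos_iff.2 hq
  refine tendsto_circleAverage_of_comp_mul_left hq hq1 (g := nrMultiplier q l a) ?_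
    (continuousAt_nrMultiplier (by simp) (by simp) (by simp) (by simpa using ha))
    (by rwa [nrMultiplier_zero]) hρ fun N z hz => ?_
  · filter_upwards [self_mem_nhdsWithin, mem_nhdsWithin_of_mem_nhds (ball_mem_nhds 0 one_pos)]
      with z hz hz1 using nrWeight_q_mul hq hq1 hl1 ha1 hz (mem_ball_zero_iff.1 hz1)
  · rw [mem_sphere_zero_iff_norm] at hz
    have hz1 : ‖z‖ ≤ 1 := hz ▸ mul_le_one₀ hρ1.le (by positivity) (pow_le_one₀ hq0.le hq1.le)
    have hz0 : z ≠ 0 := norm_pos_iff.1 (hz ▸ by positivity)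
    exact (differentiableAt_nrWeight hq hq1 l ha1 hz0 hz1 fun i n h =>
      hρne (i, n) N (by rw [← hz, h])).continuousAt.continuousWithinAt

theorem summable_leftTerm (hq1 : ‖q‖ < 1) {l : ℂ} {a : Fin 5 → ℂ}
    (ha : ∀ n : ℕ, 1 - a 0 ^ 2 * q ^ (2 * n) ≠ 0) (hlow : ‖q * l / ∏ i, a i‖ < 1) :
    Summable (leftTerm q l a) :=
  summable_vwpTerm hq1 ha _ _ _ hlow

theorem prod_comp_swap (a : Fin 5 → ℂ) (k : Fin 5) :
    ∏ i, (a ∘ Equiv.swap 0 k) i = ∏ i, a i :=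
  Equiv.prod_comp (Equiv.swap 0 k) a

theorem hasSum_prod_mul_tsum {ι κ : Type*} [Fintype ι] {c : ι → ℂ} {f : ι → κ → ℂ}
    (hf : ∀ i, Summable (f i)) :
    HasSum (fun p : ι × κ => c p.1 * f p.1 p.2) (∑ i, c i * ∑' k, f i k) := by
  have hfiber (i : ι) : Summable fun k => c i * f i k := (hf i).mul_left (c i)
  have hsum : Summable fun p : ι × κ => c p.1 * f p.1 p.2 :=
    summable_norm_iff.1 <| (summable_prod_of_nonneg fun _ => norm_nonneg _).2
      ⟨fun i => (hfiber i).norm, Summable.of_finite⟩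
  have htsum := hsum.tsum_prod
  simp only [tsum_fintype, tsum_mul_left] at htsum
  exact htsum ▸ hsum.hasSum

theorem hasSum_residueTerm (hq1 : ‖q‖ < 1) {l : ℂ} {a : Fin 5 → ℂ}
    (ha : ∀ i, ∀ n : ℕ, 1 - a i ^ 2 * q ^ (2 * n) ≠ 0) (hlow : ‖q * l / ∏ i, a i‖ < 1) :
    HasSum (residueTerm q l a) (leftSide q l a) := by
  have hleft (k : Fin 5) : Summable (leftTerm q l (a ∘ Equiv.swap 0 k)) :=
    summable_leftTerm hq1 (by simpa only [Function.comp_apply, Equiv.swap_apply_left] using ha k)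
      (by rwa [prod_comp_swap])
  change HasSum (fun p => residueTerm q l a p) _
  simpa only [residueTerm, leftSide, symSum] using
    hasSum_prod_mul_tsum (c := fun k => leftFactor q l (a ∘ Equiv.swap 0 k)) hleft

theorem nrIntegral_eq_leftSide (hq : q ≠ 0) (hq1 : ‖q‖ < 1) {l : ℂ} (hl1 : ‖l‖ < 1)
    {a : Fin 5 → ℂ} (ha : ∀ i, a i ≠ 0) (ha1 : ∀ i, ‖a i‖ < 1) (hlow : ‖q * l / ∏ i, a i‖ < 1)
    (hdiv : ∀ i j, i ≠ j → a i / a j ∉ Omega q) :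
    qPochInf q q * nrIntegral q l a = leftSide q l a := by
  have hqq := qPochInf_ne_zero_of_norm_lt_one hq hq1 hq1
  have hq0 : 0 < ‖q‖ := norm_pos_iff.2 hq
  obtain ⟨ρ, hρ, hρ1, hρne⟩ := exists_radius_mul_pow_ne hq fun p : Fin 5 × ℕ => ‖a p.1 * q ^ p.2‖
  have hpos (N : ℕ) : 0 < ρ * ‖q‖ ^ N := by positivity
  have hlt (N : ℕ) : ρ * ‖q‖ ^ N < 1 :=
    mul_lt_one_of_nonneg_of_lt_one_left hρ.le hρ1 (pow_le_one₀ hq0.le hq1.le)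
  have hcauchy := ((tendsto_circleAverage_nrWeight hq hq1 hl1 ha ha1 hlow hρ hρ1 hρne).const_sub
    (nrIntegral q l a)).const_mul (qPochInf q q)
  simp only [fun N => nrIntegral_sub_circleAverage hq hq1 hl1 ha ha1 hdiv (hpos N) (hlt N)
    fun p => hρne p N, sub_zero, Finset.mul_sum, mul_div_cancel₀ _ hqq] at hcauchy
  have hΩ (i : Fin 5) := notMem_Omega_of_norm_lt_one hq hq1 (norm_pow_lt_one (ha1 i) two_ne_zero)
  refine tendsto_nhds_unique hcauchy ((hasSum_residueTerm hq1
    (fun i n => one_sub_mul_pow_ne_zero (hΩ i) _) hlow).comp (tendsto_toFinset_lt_atTop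
      (fun p => norm_pos_iff.2 (mul_ne_zero (ha _) (pow_ne_zero _ hq)))
      (tendsto_const_mul_norm_pow hq1 ρ) _))

end ResidueSum

section Series

variable {q : ℂ}

theorem qPoch_sqrt_quotient {b r : ℂ} (hr : r ^ 2 = b) (hb : ∀ n : ℕ, 1 - b * q ^ (2 * n) ≠ 0)
    (n : ℕ) : qPoch (q * r) q n * qPoch (-(q * r)) q n / (qPoch r q n * qPoch (-r) q n) =
      (1 - b * q ^ (2 * n)) / (1 - b) := by
  have hfactor (j : ℕ) : 1 - b * q ^ (2 * j) = (1 - r * q ^ j) * (1 - -r * q ^ j) := by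
    rw [← hr]
    ring
  have hbase : 1 - b = (1 - r) * (1 - -r) := by simpa using hfactor 0
  have hne (j : ℕ) := mul_ne_zero_iff.1 (hfactor j ▸ hb j)
  have hpoch : qPoch r q n * qPoch (-r) q n ≠ 0 :=
    mul_ne_zero (Finset.prod_ne_zero_iff.2 fun j _ => (hne j).1)
      (Finset.prod_ne_zero_iff.2 fun j _ => (hne j).2)
  have hshift (x : ℂ) : (1 - x) * qPoch (q * x) q n = qPoch x q n * (1 - x * q ^ n) := by
    rw [← qPoch_succ, qPoch_succ', mul_comm x q]
  rw [div_eq_div_iff hpoch (by simpa using hb 0), hfactor, hbase, ← mul_neg]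
  linear_combination ((1 - -r) * qPoch (q * -r) q n) * hshift r +
    (qPoch r q n * (1 - r * q ^ n)) * hshift (-r)

theorem WTerm_eq_vwpTerm {b : ℂ} (hb : ∀ n : ℕ, 1 - b * q ^ (2 * n) ≠ 0) (c : Fin 4 → ℂ)
    {d : Fin 5 → ℂ} {e y z : ℂ} {cs : List ℂ} (hcs : cs.Perm (e :: List.ofFn c))
    (hd : (cs.map fun x => q * b / x).Perm (List.ofFn d)) (hy : y = z * e) (n : ℕ) :
    WTerm b cs q z n = vwpTerm b c d q y z n := by
  have hnum : (cs.map fun x => qPoch x q n).prod = qPoch e q n * ∏ i, qPoch (c i) q n := by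
    rw [(hcs.map _).prod_eq, List.map_cons, List.prod_cons, List.map_ofFn, List.prod_ofFn]
    rfl
  have hden : (cs.map fun x => qPoch (q * b / x) q n).prod = ∏ i, qPoch (d i) q n := by
    have := (hd.map fun x => qPoch x q n).prod_eq
    rwa [List.map_map, List.map_ofFn, List.prod_ofFn] at this
  have hlen : cs.length = 5 := by simpa using hcs.length_eq
  have hsqrt : Complex.sqrt b ^ 2 = b := Complex.cpow_ofNat_inv_pow b 2
  rw [vwpTerm, prod_range_sub_mul_pow hy, ← qPoch_sqrt_quotient hsqrt hb]
  simp only [WTerm, phiTerm, vwpNum, vwpDen, List.map_append, List.map_cons, List.map_nil,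
    List.prod_append, List.prod_cons, List.prod_nil, List.length_append, List.length_cons,
    List.length_map, List.length_nil, List.map_map, Function.comp_def, hnum, hden, hlen]
  norm_num
  simp only [div_eq_mul_inv, mul_inv]
  ring

theorem WTerm_leftParams (hq : q ≠ 0) {l : ℂ} (hl : l ≠ 0) {a : Fin 5 → ℂ} (ha : ∀ i, a i ≠ 0)
    (hb : ∀ n : ℕ, 1 - a 0 ^ 2 * q ^ (2 * n) ≠ 0) :
    WTerm (a 0 ^ 2) (leftParams l q a) q (q * l / ∏ i, a i) = leftTerm q l a := by
  have h0 := ha 0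
  refine funext fun n => WTerm_eq_vwpTerm hb _ (e := q * a 0 / l) ?_ ?_ ?_ n
  · simpa [leftParams] using (List.perm_append_singleton (q * a 0 / l)
      [a 0 * a 1, a 0 * a 2, a 0 * a 3, a 0 * a 4])
  · have hd (i : Fin 5) : q * a 0 ^ 2 / (a 0 * a i) = q * a 0 / a i := by
      have := ha i
      field_simp
    have he : q * a 0 ^ 2 / (q * a 0 / l) = l * a 0 := by field_simp
    simpa [leftParams, hd, he] using (List.perm_append_singleton (l * a 0)
      [q * a 0 / a 1, q * a 0 / a 2, q * a 0 / a 3, q * a 0 / a 4])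
  · field_simp

theorem WTerm_rightParams (hq : q ≠ 0) {l : ℂ} (hl : l ≠ 0) {a : Fin 5 → ℂ} (ha : ∀ i, a i ≠ 0)
    (hb : ∀ n : ℕ, 1 - l ^ 2 / q * q ^ (2 * n) ≠ 0) :
    WTerm (l ^ 2 / q) (rightParams l a) q ((∏ i, a i) / l) = rightTerm q l a := by
  have hd (i : Fin 5) : q * (l ^ 2 / q) / (l / a i) = l * a i := by
    have := ha i
    field_simp
  refine funext fun n => WTerm_eq_vwpTerm hb _ (e := l / a 4) ?_ ?_ (prod_castSucc_eq hl (ha 4)) n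
  · simpa [rightParams] using (List.perm_append_singleton (l / a 4)
      [l / a 0, l / a 1, l / a 2, l / a 3])
  · simp [rightParams, hd]

theorem summable_WTerm_leftParams (hq : q ≠ 0) (hq1 : ‖q‖ < 1) {l : ℂ} (hl : l ≠ 0)
    {a : Fin 5 → ℂ} (ha : ∀ i, a i ≠ 0) (hb : ∀ n : ℕ, 1 - a 0 ^ 2 * q ^ (2 * n) ≠ 0)
    (hlow : ‖q * l / ∏ i, a i‖ < 1) :
    Summable (WTerm (a 0 ^ 2) (leftParams l q a) q (q * l / ∏ i, a i)) := by
  rw [WTerm_leftParams hq hl ha hb]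
  exact summable_leftTerm hq1 hb hlow

theorem leftSummand_eq (hq : q ≠ 0) {l : ℂ} (hl : l ≠ 0) {a : Fin 5 → ℂ} (ha : ∀ i, a i ≠ 0)
    (hb : ∀ n : ℕ, 1 - a 0 ^ 2 * q ^ (2 * n) ≠ 0) :
    leftSummand l q a = leftFactor q l a * ∑' n, leftTerm q l a n := by
  rw [leftSummand, W, WTerm_leftParams hq hl ha hb, leftFactor]

theorem symSum_leftSummand (hq : q ≠ 0) {l : ℂ} (hl : l ≠ 0) {a : Fin 5 → ℂ} (ha : ∀ i, a i ≠ 0)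
    (hb : ∀ i, ∀ n : ℕ, 1 - a i ^ 2 * q ^ (2 * n) ≠ 0) :
    symSum (leftSummand l q) a = leftSide q l a :=
  Finset.sum_congr rfl fun _ _ => leftSummand_eq hq hl (fun _ => ha _) (hb _)

end Series

section Continuation

variable {q : ℂ}

/-- The nonvanishing conditions of the identity that are not invariant under the scaling
`(a, l) ↦ (s * a, s ^ 5 * l)`. -/
structure Admissible (q l : ℂ) (a : Fin 5 → ℂ) : Prop where
  pair : ∀ i j, i ≠ j → a i * a j ∉ Omega q
  pos : ∀ i, a i ∉ Omega q
  neg : ∀ i, -a i ∉ Omega q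
  mul : ∀ i, l * a i ∉ Omega q
  sq : l ^ 2 / q ∉ Omega q

/-- The hypotheses of the identity that are invariant under the scaling
`(a, l) ↦ (s * a, s ^ 5 * l)`. -/
structure ScalingInvariantConditions (q l : ℂ) (a : Fin 5 → ℂ) : Prop where
  l_ne_zero : l ≠ 0
  a_ne_zero : ∀ i, a i ≠ 0
  div : ∀ i j, i ≠ j → a i / a j ∉ Omega q
  low : ‖q * l / ∏ i, a i‖ < 1
  up : ‖(∏ i, a i) / l‖ < 1

theorem ScalingInvariantConditions.scale {l : ℂ} {a : Fin 5 → ℂ}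
    (h : ScalingInvariantConditions q l a) {s : ℂ} (hs : s ≠ 0) :
    ScalingInvariantConditions q (s ^ 5 * l) fun i => s * a i := by
  have hprod : ∏ i, s * a i = s ^ 5 * ∏ i, a i := by simp [Finset.prod_mul_distrib]
  have hs5 : s ^ 5 ≠ 0 := pow_ne_zero 5 hs
  refine ⟨mul_ne_zero hs5 h.l_ne_zero, fun i => mul_ne_zero hs (h.a_ne_zero i), fun i j hij => ?_,
    ?_, ?_⟩
  · rw [mul_div_mul_left _ _ hs]
    exact h.div i j hij
  · rw [hprod, mul_left_comm, mul_div_mul_left _ _ hs5]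
    exact h.low
  · rw [hprod, mul_div_mul_left _ _ hs5]
    exact h.up

theorem norm_mul_div_lt_one_of_norm_lt {l A : ℂ} (h : ‖q‖ < ‖A / l‖) : ‖q * l / A‖ < 1 := by
  rw [← div_div_eq_mul_div, norm_div]
  exact (div_lt_one ((norm_nonneg q).trans_lt h)).2 h

theorem one_sub_sq_mul_pow_ne_zero {x : ℂ} (hx : x ∉ Omega q) (hx' : -x ∉ Omega q) (n : ℕ) :
    1 - x ^ 2 * q ^ (2 * n) ≠ 0 := by
  rw [show 1 - x ^ 2 * q ^ (2 * n) = (1 - x * q ^ n) * (1 - -x * q ^ n) by ring]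
  exact mul_ne_zero (one_sub_mul_pow_ne_zero hx n) (one_sub_mul_pow_ne_zero hx' n)

theorem div_notMem_Omega (hq : q ≠ 0) {x : ℂ} (hx : x ∉ Omega q) (hxq : x ≠ q) :
    x / q ∉ Omega q := by
  rintro ⟨k, hk⟩
  rw [div_eq_iff hq] at hk
  cases k with
  | zero => exact hxq (by simpa using hk)
  | succ k => exact hx ⟨k, by rw [hk, pow_succ, mul_inv, inv_mul_cancel_right₀ hq]⟩

theorem admissible_of_norm_lt_one (hq : q ≠ 0) (hq1 : ‖q‖ < 1) {l : ℂ} {a : Fin 5 → ℂ}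
    (ha1 : ∀ i, ‖a i‖ < 1) (hlq : ‖l ^ 2 / q‖ < 1) : Admissible q l a where
  pair i j _ := notMem_Omega_of_norm_lt_one hq hq1 (norm_mul_lt_one (ha1 i) (ha1 j))
  pos i := notMem_Omega_of_norm_lt_one hq hq1 (ha1 i)
  neg i := notMem_Omega_of_norm_lt_one hq hq1 (by simpa using ha1 i)
  mul i := notMem_Omega_of_norm_lt_one hq hq1
    (norm_mul_lt_one (norm_lt_one_of_norm_sq_div_lt_one hq hq1 hlq) (ha1 i))
  sq := notMem_Omega_of_norm_lt_one hq hq1 hlq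

theorem isClosed_Omega (hq : q ≠ 0) (hq1 : ‖q‖ < 1) : IsClosed (Omega q) := by
  have hzeros : Omega q = (fun x => qPochInf x q) ⁻¹' {0} := by
    ext x
    refine ⟨?_, not_imp_not.1 (qPochInf_ne_zero hq1)⟩
    rintro ⟨k, rfl⟩
    rw [Set.mem_preimage, Set.mem_singleton_iff, qPochInf_eq_qPoch_mul hq1 _ (k + 1), qPoch_succ,
      inv_mul_cancel₀ (pow_ne_zero k hq), sub_self, mul_zero, zero_mul]
  rw [hzeros]
  exact isClosed_singleton.preimage (continuous_qPochInf hq1)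

theorem eventually_cocountable_mul_pow_notMem_Omega (q : ℂ) {c : ℂ} (hc : c ≠ 0) {m : ℕ}
    (hm : 0 < m) : ∀ᶠ s in cocountable, c * s ^ m ∉ Omega q := by
  classical
  refine mem_cocountable.2 <| (Set.countable_iUnion fun k : ℕ =>
    (Polynomial.nthRoots m ((q ^ k)⁻¹ / c)).toFinset.countable_toSet).mono fun s hs => ?_
  obtain ⟨k, hk⟩ := not_not.1 hs
  refine Set.mem_iUnion.2 ⟨k, ?_⟩
  rw [Finset.mem_coe, Multiset.mem_toFinset, Polynomial.mem_nthRoots hm, ← hk,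
    mul_div_cancel_left₀ _ hc]

theorem eventually_cocountable_admissible (hq : q ≠ 0) {l : ℂ} (hl : l ≠ 0) {a : Fin 5 → ℂ}
    (ha : ∀ i, a i ≠ 0) :
    ∀ᶠ s in cocountable, Admissible q (s ^ 5 * l) fun i => s * a i := by
  have hΩ {c : ℂ} (hc : c ≠ 0) {m : ℕ} (hm : 0 < m) :=
    eventually_cocountable_mul_pow_notMem_Omega q hc hm
  filter_upwards [
    eventually_all.2 fun i => eventually_all.2 fun j => hΩ (mul_ne_zero (ha i) (ha j)) two_pos,
    eventually_all.2 fun i => hΩ (ha i) one_pos,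
    eventually_all.2 fun i => hΩ (neg_ne_zero.2 (ha i)) one_pos,
    eventually_all.2 fun i => hΩ (mul_ne_zero hl (ha i)) (Nat.succ_pos 5),
    hΩ (div_ne_zero (pow_ne_zero 2 hl) hq) (Nat.succ_pos 9)] with s hpair hpos hneg hmul hsq
  refine ⟨fun i j _ => ?_, fun i => ?_, fun i => ?_, fun i => ?_, ?_⟩
  · rw [show s * a i * (s * a j) = a i * a j * s ^ 2 by ring]
    exact hpair i j
  · rw [show s * a i = a i * s ^ 1 by ring]
    exact hpos i
  · rw [show -(s * a i) = -a i * s ^ 1 by ring]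
    exact hneg i
  · rw [show s ^ 5 * l * (s * a i) = l * a i * s ^ 6 by ring]
    exact hmul i
  · rw [show (s ^ 5 * l) ^ 2 / q = l ^ 2 / q * s ^ 10 by ring]
    exact hsq

theorem isOpen_setOf_admissible (hq : q ≠ 0) (hq1 : ‖q‖ < 1) {X : Type*} [TopologicalSpace X]
    {l : X → ℂ} {a : X → Fin 5 → ℂ} (hl : Continuous l) (ha : ∀ i, Continuous fun s => a s i) :
    IsOpen {s | Admissible q (l s) (a s)} := by
  refine isOpen_iff_eventually.2 fun s hs => ?_
  have hΩ {f : X → ℂ} (hf : Continuous f) (hfs : f s ∉ Omega q) : ∀ᶠ t in 𝓝 s, f t ∉ Omega q :=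
    hf.continuousAt.eventually_mem ((isClosed_Omega hq hq1).isOpen_compl.mem_nhds hfs)
  filter_upwards [
    eventually_all.2 fun i => eventually_all.2 fun j =>
      eventually_imp_distrib_left.2 fun hij => hΩ ((ha i).mul (ha j)) (hs.pair i j hij),
    eventually_all.2 fun i => hΩ (ha i) (hs.pos i),
    eventually_all.2 fun i => hΩ (ha i).neg (hs.neg i),
    eventually_all.2 fun i => hΩ (hl.mul (ha i)) (hs.mul i),
    hΩ ((hl.pow 2).div_const q) hs.sq]
    with t hpair hpos hneg hmul hsq using ⟨hpair, hpos, hneg, hmul, hsq⟩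

theorem eqOn_of_countable_compl {f g : ℂ → ℂ} {U : Set ℂ} (hU : IsOpen U) (hUc : Uᶜ.Countable)
    (hf : DifferentiableOn ℂ f U) (hg : DifferentiableOn ℂ g U) {z : ℂ}
    (hfg : ∀ᶠ s in 𝓝[≠] z, s ∈ U ∧ f s = g s) : Set.EqOn f g U := by
  have hconn : IsPreconnected U := by
    simpa using (hUc.isPathConnected_compl_of_one_lt_rank
      (Complex.rank_real_complex ▸ Cardinal.one_lt_two)).isConnected.isPreconnected
  obtain ⟨w, ⟨hw, hwU, -⟩, hwz⟩ := ((eventually_eventually_nhdsWithin.2 hfg).and hfg).and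
    self_mem_nhdsWithin |>.exists
  rw [isOpen_compl_singleton.nhdsWithin_eq hwz] at hw
  exact (hf.analyticOnNhd hU).eqOn_of_preconnected_of_eventuallyEq (hg.analyticOnNhd hU) hconn
    hwU (hw.mono fun _ h => h.2)

theorem differentiableOn_leftFactor (hq1 : ‖q‖ < 1) {U : Set ℂ} {l : ℂ → ℂ} {a : ℂ → Fin 5 → ℂ}
    (hl : DifferentiableOn ℂ l U) (ha : ∀ i, DifferentiableOn ℂ (fun s => a s i) U)
    (ha0 : ∀ s ∈ U, a s 0 ≠ 0) (hpair : ∀ s ∈ U, ∀ j : Fin 4, a s 0 * a s j.succ ∉ Omega q)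
    (hdiv : ∀ s ∈ U, ∀ j : Fin 4, a s j.succ / a s 0 ∉ Omega q) :
    DifferentiableOn ℂ (fun s => leftFactor q (l s) (a s)) U := by
  have hsq (s : ℂ) (hs : s ∈ U) : a s 0 ^ 2 ≠ 0 := pow_ne_zero 2 (ha0 s hs)
  have hden (s : ℂ) (hs : s ∈ U) : (∏ j : Fin 4, qPochInf (a s 0 * a s j.succ) q) *
      ∏ j : Fin 4, qPochInf (a s j.succ / a s 0) q ≠ 0 :=
    mul_ne_zero (Finset.prod_ne_zero_iff.2 fun j _ => qPochInf_ne_zero hq1 (hpair s hs j))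
      (Finset.prod_ne_zero_iff.2 fun j _ => qPochInf_ne_zero hq1 (hdiv s hs j))
  unfold leftFactor
  fun_prop (disch := assumption)

theorem differentiableOn_tsum_leftTerm (hq : q ≠ 0) (hq1 : ‖q‖ < 1) {U : Set ℂ} (hU : IsOpen U)
    {l : ℂ → ℂ} {a : ℂ → Fin 5 → ℂ} (hl : DifferentiableOn ℂ l U)
    (ha : ∀ i, DifferentiableOn ℂ (fun s => a s i) U) (ha0 : ∀ s ∈ U, ∀ i, a s i ≠ 0)
    (hsq : ∀ s ∈ U, ∀ n : ℕ, 1 - a s 0 ^ 2 * q ^ (2 * n) ≠ 0)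
    (hmul : ∀ s ∈ U, l s * a s 0 ∉ Omega q)
    (hdiv : ∀ s ∈ U, ∀ j : Fin 4, a s 0 / a s j.succ ∉ Omega q)
    (hlow : ∀ s ∈ U, ‖q * l s / ∏ i, a s i‖ < 1) :
    DifferentiableOn ℂ (fun s => ∑' n, leftTerm q (l s) (a s) n) U := by
  have hprod (s : ℂ) (hs : s ∈ U) : ∏ i, a s i ≠ 0 :=
    Finset.prod_ne_zero_iff.2 fun i _ => ha0 s hs i
  unfold leftTerm
  refine differentiableOn_tsum_vwpTerm hq1 hU (by fun_prop) (fun j => by fun_prop) ?_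
    (by fun_prop (disch := assumption)) (by fun_prop (disch := assumption)) hsq ?_ hlow
  · refine Fin.cases ?_ fun j => ?_
    · exact hl.mul (ha 0)
    · exact ((ha 0).const_mul q).div (ha j.succ) fun s hs => ha0 s hs _
  · refine fun s hs => Fin.cases (hmul s hs) fun j => ?_
    simpa only [Fin.cons_succ, mul_comm q, mul_div_right_comm] using
      mul_notMem_Omega hq (hdiv s hs j)

theorem differentiableOn_leftSide (hq : q ≠ 0) (hq1 : ‖q‖ < 1) {U : Set ℂ} (hU : IsOpen U)
    {l : ℂ → ℂ} {a : ℂ → Fin 5 → ℂ} (hl : DifferentiableOn ℂ l U)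
    (ha : ∀ i, DifferentiableOn ℂ (fun s => a s i) U)
    (hinv : ∀ s ∈ U, ScalingInvariantConditions q (l s) (a s))
    (had : ∀ s ∈ U, Admissible q (l s) (a s)) :
    DifferentiableOn ℂ (fun s => leftSide q (l s) (a s)) U := by
  unfold leftSide symSum
  refine DifferentiableOn.fun_sum fun k _ => ?_
  have hne (j : Fin 4) : Equiv.swap 0 k j.succ ≠ Equiv.swap 0 k 0 :=
    (Equiv.injective _).ne (Fin.succ_ne_zero j)
  refine (differentiableOn_leftFactor hq1 (a := fun s => a s ∘ Equiv.swap 0 k) hl (fun i => ha _)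
    (fun s hs => (hinv s hs).a_ne_zero _) (fun s hs j => (had s hs).pair _ _ (hne j).symm)
    fun s hs j => (hinv s hs).div _ _ (hne j)).mul
    (differentiableOn_tsum_leftTerm hq hq1 hU (a := fun s => a s ∘ Equiv.swap 0 k) hl
      (fun i => ha _) (fun s hs i => (hinv s hs).a_ne_zero _)
      (fun s hs => one_sub_sq_mul_pow_ne_zero ((had s hs).pos _) ((had s hs).neg _))
      (fun s hs => (had s hs).mul _) (fun s hs j => (hinv s hs).div _ _ (hne j).symm)
      fun s hs => ?_)
  rw [prod_comp_swap]
  exact (hinv s hs).low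

theorem leftSide_eq_rightSide_of_norm_lt_one (hq : q ≠ 0) (hq1 : ‖q‖ < 1) {l : ℂ}
    {a : Fin 5 → ℂ} (h : ScalingInvariantConditions q l a) (ha1 : ∀ i, ‖a i‖ < 1)
    (hlq : ‖l ^ 2 / q‖ < 1) : leftSide q l a = rightSide q l a := by
  rw [← nrIntegral_eq_leftSide hq hq1 (norm_lt_one_of_norm_sq_div_lt_one hq hq1 hlq) h.a_ne_zero
    ha1 h.low h.div]
  exact nrIntegral_eq_rightSide hq hq1 h.l_ne_zero h.a_ne_zero ha1 hlq h.up
    (mul_pow_ne_mul_pow hq (h.a_ne_zero 2) (h.a_ne_zero 3) (h.div 2 3 (by decide))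
      (h.div 3 2 (by decide)))

theorem eventually_norm_scaling_lt_one (q l : ℂ) (a : Fin 5 → ℂ) :
    ∀ᶠ s in 𝓝 (0 : ℂ), (∀ i, ‖s * a i‖ < 1) ∧ ‖(s ^ 5 * l) ^ 2 / q‖ < 1 := by
  have hsmall {f : ℂ → ℂ} (hf : Continuous f) (hf0 : f 0 = 0) : ∀ᶠ s in 𝓝 0, ‖f s‖ < 1 :=
    hf.norm.continuousAt.eventually_lt_const (by simp [hf0])
  exact (eventually_all.2 fun i => hsmall (by fun_prop) (by simp)).and
    (hsmall (by fun_prop) (by simp))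

theorem leftSide_eq_rightSide (hq : q ≠ 0) (hq1 : ‖q‖ < 1) {l : ℂ} {a : Fin 5 → ℂ}
    (h : ScalingInvariantConditions q l a) (had : Admissible q l a) :
    leftSide q l a = rightSide q l a := by
  let U : Set ℂ := {0}ᶜ ∩ {s | Admissible q (s ^ 5 * l) fun i => s * a i}
  have hU : IsOpen U :=
    isOpen_compl_singleton.inter (isOpen_setOf_admissible hq hq1 (by fun_prop) (by fun_prop))
  have hUc : U ∈ cocountable :=
    inter_mem (by simp) (eventually_cocountable_admissible hq h.l_ne_zero h.a_ne_zero)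
  have hinv (s : ℂ) (hs : s ∈ U) := h.scale hs.1
  have hleft : DifferentiableOn ℂ (fun s => leftSide q (s ^ 5 * l) fun i => s * a i) U :=
    differentiableOn_leftSide hq hq1 hU (by fun_prop) (by fun_prop) hinv fun s hs => hs.2
  have hright : DifferentiableOn ℂ (fun s => rightSide q (s ^ 5 * l) fun i => s * a i) U :=
    differentiableOn_rightSide hq1 hU (by fun_prop) (by fun_prop)
      (fun s hs => (hinv s hs).l_ne_zero) (fun s hs i => (hinv s hs).a_ne_zero _)
      (fun s hs => hs.2.pair) (fun s hs => hs.2.mul)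
      (fun s hs => by simpa only [div_mul_cancel₀ _ hq] using mul_notMem_Omega hq hs.2.sq)
      (fun s hs n => one_sub_mul_pow_ne_zero hs.2.sq _) fun s hs => (hinv s hs).up
  have hsmall : ∀ᶠ s in 𝓝[≠] (0 : ℂ), s ∈ U ∧ leftSide q (s ^ 5 * l) (fun i => s * a i) =
      rightSide q (s ^ 5 * l) fun i => s * a i := by
    filter_upwards [(eventually_norm_scaling_lt_one q l a).filter_mono nhdsWithin_le_nhds,
      self_mem_nhdsWithin] with s ⟨ha1, hlq⟩ hs
    have hsU : s ∈ U := ⟨hs, admissible_of_norm_lt_one hq hq1 ha1 hlq⟩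
    exact ⟨hsU, leftSide_eq_rightSide_of_norm_lt_one hq hq1 (hinv s hsU) ha1 hlq⟩
  have h1U : (1 : ℂ) ∈ U := ⟨one_ne_zero, by simpa using had⟩
  simpa using eqOn_of_countable_compl hU (mem_cocountable.1 hUc) hleft hright hsmall h1U

end Continuation

end

end BasicHyp

theorem mainTheorem8 (q l : ℂ) (a : Fin 5 → ℂ)
    (hq0 : q ≠ 0) (hq1 : ‖q‖ < 1) (hl : l ≠ 0) (ha : ∀ i, a i ≠ 0)
    -- the convergence condition `|q| < |a_1a_2a_3a_4a_5/λ| < 1`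
    (hlow : ‖q‖ < ‖(∏ i, a i) / l‖) (hup : ‖(∏ i, a i) / l‖ < 1)
    -- no infinite product in a denominator vanishes
    (haa : ∀ i j, i ≠ j → a i * a j ∉ BasicHyp.Omega q)
    (hdiv : ∀ i j, i ≠ j → a j / a i ∉ BasicHyp.Omega q)
    (hll : l ^ 2 ∉ BasicHyp.Omega q)
    -- no denominator parameter of an `_8W_7` lies in `Ω_q`; given the conditions above this
    -- leaves `±√(a_i²) = ±a_i`, `λ a_i` and `±√(λ²/q)` (the last one only if `λ² = q`)
    (hpos : ∀ i, a i ∉ BasicHyp.Omega q) (hneg : ∀ i, -a i ∉ BasicHyp.Omega q)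
    (hla : ∀ i, l * a i ∉ BasicHyp.Omega q) (hlq : l ^ 2 ≠ q) :
    (∀ k : Fin 5, Summable (BasicHyp.WTerm ((a ∘ Equiv.swap 0 k) 0 ^ 2)
        (BasicHyp.leftParams l q (a ∘ Equiv.swap 0 k)) q (q * l / ∏ i, a i))) ∧
    Summable (BasicHyp.WTerm (l ^ 2 / q) (BasicHyp.rightParams l a) q ((∏ i, a i) / l)) ∧
    BasicHyp.symSum (BasicHyp.leftSummand l q) a =
      2 * ((∏ i, BasicHyp.qPochInf (l * a i) q) * BasicHyp.qPochInf ((∏ i, a i) / l) q) /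
          ((∏ i, ∏ j ∈ Finset.Ioi i, BasicHyp.qPochInf (a i * a j) q) *
            BasicHyp.qPochInf (l ^ 2) q) *
        BasicHyp.W (l ^ 2 / q) (BasicHyp.rightParams l a) q ((∏ i, a i) / l) := by
  have hinv : BasicHyp.ScalingInvariantConditions q l a :=
    ⟨hl, ha, fun i j hij => hdiv j i hij.symm, BasicHyp.norm_mul_div_lt_one_of_norm_lt hlow, hup⟩
  have had : BasicHyp.Admissible q l a :=
    ⟨haa, hpos, hneg, hla, BasicHyp.div_notMem_Omega hq0 hll hlq⟩
  have hsq (i : Fin 5) := BasicHyp.one_sub_sq_mul_pow_ne_zero (hpos i) (hneg i)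
  have hright := BasicHyp.WTerm_rightParams hq0 hl ha fun n =>
    BasicHyp.one_sub_mul_pow_ne_zero had.sq _
  refine ⟨fun k => ?_, ?_, ?_⟩
  · rw [← BasicHyp.prod_comp_swap a k]
    exact BasicHyp.summable_WTerm_leftParams hq0 hq1 hl (fun i => ha _) (hsq _)
      (by rw [BasicHyp.prod_comp_swap]; exact hinv.low)
  · rw [hright]
    exact BasicHyp.summable_vwpTerm hq1 (fun n => BasicHyp.one_sub_mul_pow_ne_zero had.sq _) _ _ _
      hup
  · rw [BasicHyp.symSum_leftSummand hq0 hl ha hsq, BasicHyp.W, hright]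
    exact BasicHyp.leftSide_eq_rightSide hq0 hq1 hinv had
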